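/- A \emph{closed 3-manifold triangulation of size $n$} is a collection of $n$ tetrahedra whose $4n$ faces are affinely identified in $2n$ pairs so that the resulting quotient space is a closed 3-manifold, i.e. a compact Hausdorff space that is locally homeomorphic to $\mathbb{R}^3$ at every point (different vertices, edges or faces of the same tetrahedron may be identified). Number the normal disc types of the triangulation: four triangle types (one for each vertex) and three quadrilateral types (one for each partition of the vertices into two pairs) in each tetrahedron. The \emph{projective solution space} is the polytope of all $x \in \mathbb{R}^{7n}$, indexed by these disc types, that have non-negative coordinates with sum $1$ and satisfy the matching equations: for each pair of identified faces and each of the three types of normal arc in this face, the sum of the coordinates of the disc types meeting the face in this type of arc is the same on both sides. A vertex of this polytope is \emph{admissible} if for each tetrahedron at most one of its three quadrilateral coordinates is non-zero. The \emph{admissible vertex count} $\sigma$ of the triangulation is the number of admissible vertices of its projective solution space. **Theorem.** For every positive integer $n \neq 1,2,3,5$ there exists a connected closed 3-manifold triangulation of size $n$ whose admissible vertex count is as follows: - if $n = 4k$ ($k \geq 1$), then $\sigma = 17^k + k$; - if $n = 4k+1$ ($k \geq 2$), then $\sigma = 581 \cdot 17^{k-2} + k + 1$; - if $n = 4k+2$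 ($k \geq 1$), then $\sigma = 69 \cdot 17^{k-1} + k$; - if $n = 4k+3$ ($k \geq 1$), then $\sigma = 141 \cdot 17^{k-1} + k + 2$. -/

import Mathlib

/-- A collection of `n` tetrahedra, each with vertices `0, 1, 2, 3`, whose `4n` faces are affinely
identified in `2n` pairs.  Face `i` of a tetrahedron is the one opposite its vertex `i`.

Face `i` of tetrahedron `t` is glued to face `glue t i i` of tetrahedron `nbr t i`, and the affine
identification of these two faces sends each vertex `v ≠ i` of the first to the vertex `glue t i v`
of the second. -/
structure FaceGluing (n : ℕ) where
  /-- The tetrahedron on the other side of face `i` of tetrahedron `t`. -/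
  nbr : Fin n → Fin 4 → Fin n
  /-- How the vertices of face `i` of tetrahedron `t` are matched with those of its partner. -/
  glue : Fin n → Fin 4 → Equiv.Perm (Fin 4)
  /-- The partner of the partner of a face is that face. -/
  nbr_nbr : ∀ t i, nbr (nbr t i) (glue t i i) = t
  /-- The identification seen from the other side is the inverse one. -/
  glue_glue : ∀ t i, glue (nbr t i) (glue t i i) = (glue t i)⁻¹
  /-- No face is glued to itself. -/
  ne_self : ∀ t i, (nbr t i, glue t i i) ≠ (t, i)

/-- Compact Hausdorff spaces that are locally homeomorphic to `ℝ³` at every point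
(second countability is then automatic). -/
structure IsClosedThreeManifold (X : Type*) [TopologicalSpace X] : Prop where
  compact : CompactSpace X
  hausdorff : T2Space X
  locallyEuclidean : Nonempty (ChartedSpace (EuclideanSpace ℝ (Fin 3)) X)

namespace FaceGluing

variable {n : ℕ}

/-- The elementary identifications of points in the disjoint union of `n` tetrahedra, in
barycentric coordinates: a point of face `i` of a tetrahedron is identified with its image under
the affine gluing map of that face. -/
def Identified (T : FaceGluing n) (a b : Fin n × stdSimplex ℝ (Fin 4)) : Prop :=
  ∃ i : Fin 4, a.2.1 i = 0 ∧ b.1 = T.nbr a.1 i ∧ ∀ v, b.2.1 (T.glue a.1 i v) = a.2.1 v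

/-- The topological space obtained from `n` tetrahedra by the gluings: the quotient of their
disjoint union by the equivalence relation that the gluings generate. -/
abbrev Space (T : FaceGluing n) : Type := Quot T.Identified

/-- The gluing is a closed 3-manifold triangulation (of size `n`). -/
def IsClosedThreeManifoldTriangulation (T : FaceGluing n) : Prop :=
  IsClosedThreeManifold T.Space

end FaceGluing

/-- The `7n` normal disc types: in each tetrahedron four triangle types `Sum.inl v`
(the triangle cutting off vertex `v`) and three quadrilateral types `Sum.inr q`. -/
abbrev DiscType (n : ℕ) : Type := Fin n × (Fin 4 ⊕ Fin 3)

/-- Quadrilateral type `q` separates the four vertices of a tetrahedron into two pairs, `{0,1}`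
and `{2,3}`, or `{0,2}` and `{1,3}`, or `{0,3}` and `{1,2}`; `quadMate q v` is the vertex in the
same pair as `v`. -/
def quadMate : Fin 3 → Fin 4 → Fin 4 :=
  ![![1, 0, 3, 2], ![2, 3, 0, 1], ![3, 2, 1, 0]]

namespace FaceGluing

variable {n : ℕ}

/-- For `v ≠ i`, the number of normal arcs of the type that cuts off vertex `v` in face `i` of
tetrahedron `t`: these come from the triangles about `v`, and from the quadrilaterals
that keep `v` together with `i` (hence separate it from the other two vertices of the face). -/
noncomputable def arcCount (x : DiscType n → ℝ) (t : Fin n) (i v : Fin 4) : ℝ :=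
  x (t, Sum.inl v) + ∑ q : Fin 3, if quadMate q i = v then x (t, Sum.inr q) else 0

/-- The matching equations: for each pair of identified faces and each of the three arc types in
it, the numbers of arcs on both sides agree. -/
def Matching (T : FaceGluing n) (x : DiscType n → ℝ) : Prop :=
  ∀ t i v, v ≠ i →
    arcCount x t i v = arcCount x (T.nbr t i) (T.glue t i i) (T.glue t i v)

/-- The quadrilateral constraints: at most one quadrilateral coordinate is non-zero in each
tetrahedron. -/
def QuadConstraints (x : DiscType n → ℝ) : Prop :=
  ∀ t q q', x (t, Sum.inr q) ≠ 0 → x (t, Sum.inr q') ≠ 0 → q = q'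

/-- The projective solution space: the cross-section by the hyperplane `∑ x = 1` of the cone in
`ℝ^{7n}` of non-negative solutions of the matching equations. -/
def projectiveSolutionSpace (T : FaceGluing n) : Set (DiscType n → ℝ) :=
  {x | (∀ d, 0 ≤ x d) ∧ T.Matching x ∧ ∑ d, x d = 1}

/-- The admissible vertices: the vertices (extreme points) of the projective solution space that
satisfy the quadrilateral constraints. -/
def admissibleVertices (T : FaceGluing n) : Set (DiscType n → ℝ) :=
  {x | x ∈ T.projectiveSolutionSpace.extremePoints ℝ ∧ QuadConstraints x}

/-- The admissible vertex count `σ`. -/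
noncomputable def admissibleVertexCount (T : FaceGluing n) : ℕ∞ :=
  T.admissibleVertices.encard

end FaceGluing

/-! The triangulations are cyclic chains of links. The basic link is a snapped tetrahedron: two of
its faces are folded onto each other, which leaves two free faces, each a triangle with an apex
whose other two vertices are identified, so that the opposite edge is a loop. Links are glued apex
to apex (`join`) or with a rotation that puts the apex of each face against a loop vertex of the
other (`twist`). Apex to apex one may also insert a cap: a tetrahedron carrying a second, folded
tetrahedron on two of its faces. A last twist closes the chain.

Topology: up to a homeomorphism fixing the two free faces, a snapped tetrahedron absorbs a further
snapped tetrahedron (with or without twist) or a cap. This follows from two local replacements: two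
tetrahedra sharing a face against three around an edge (`bipyramid_equivalent`), and three
tetrahedra folded like a pleat against one (`pleat_equivalent`). So every closed chain is a single
tetrahedron with its faces glued in two pairs, and this is the join of two circles, the three-sphere
(`closeTwist_snap`, `twoFolds_homeomorph`).

Normal coordinates: a fold forces two quadrilateral coordinates to be equal, so the quadrilateral
constraint kills both, and the admissible solutions of a whole chain form a linear space
(`snapTet_iff`, `capTet_iff`). All loop vertices carry the same number `c` of arcs. A join or a cap
transmits the number of arcs at the apex; a twist forces it to be `c` on both sides. Thus the chain
falls, at its twists, into blocks that share only `c` (`family_append`).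

Counting: the admissible vertices are the extreme rays of the cone of nonnegative admissible
solutions. Those with `c > 0` rescale to vertices of the slice `c = 1`, a product over the blocks,
so their numbers multiply. Those with `c = 0` are extreme rays of a product of cones, so their
numbers add (`encard_vertices`, `encard_rigidPoints_glue`, `encard_extremeRays_glue`). In each block
the relevant points have 0/1 parameters up to scale and can be enumerated. The standard block of 4
tetrahedra has 17 points with `c = 1` and 1 ray; starting blocks of 6, 7 and 9 tetrahedra have 69,
141 and 581 points and 1, 3 and 3 rays. Appending standard blocks multiplies the first number by 17
and adds 1 to the second. -/

section

open Equiv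

/-! ### Complexes of tetrahedra with marked faces, and exchange of equivalent pieces -/

/-- The standard tetrahedron in barycentric coordinates. -/
abbrev Tet : Type := stdSimplex ℝ (Fin 4)

namespace Tet

/-- The affine automorphism of the tetrahedron that sends vertex `v` to vertex `σ v`. -/
def act (σ : Perm (Fin 4)) (x : Tet) : Tet :=
  ⟨fun v => x.1 (σ⁻¹ v), fun v => x.2.1 _, by
    rw [← x.2.2]; exact Equiv.sum_comp σ⁻¹ x.1⟩

@[simp] theorem act_val (σ : Perm (Fin 4)) (x : Tet) (v : Fin 4) :
    (act σ x).1 v = x.1 (σ⁻¹ v) := rfl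

theorem act_apply (σ : Perm (Fin 4)) (x : Tet) (v : Fin 4) : (act σ x).1 (σ v) = x.1 v := by
  simp

theorem ext_val {x y : Tet} (h : ∀ v, x.1 v = y.1 v) : x = y := Subtype.ext (funext h)

@[simp] theorem act_one (x : Tet) : act 1 x = x := rfl

theorem act_mul (σ τ : Perm (Fin 4)) (x : Tet) : act (σ * τ) x = act σ (act τ x) :=
  ext_val fun v => by simp

@[simp] theorem act_inv_act (σ : Perm (Fin 4)) (x : Tet) : act σ⁻¹ (act σ x) = x := by
  rw [← act_mul]; simp

@[simp] theorem act_act_inv (σ : Perm (Fin 4)) (x : Tet) : act σ (act σ⁻¹ x) = x := by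
  rw [← act_mul]; simp

theorem continuous_act (σ : Perm (Fin 4)) : Continuous (act σ) := by
  refine Continuous.subtype_mk (continuous_pi fun v => ?_) _
  exact (continuous_apply _).comp continuous_subtype_val

theorem continuous_coord (v : Fin 4) : Continuous fun x : Tet => x.1 v :=
  (continuous_apply _).comp continuous_subtype_val

theorem sum_coord (x : Tet) : x.1 0 + x.1 1 + x.1 2 + x.1 3 = 1 := by
  have := x.2.2; rwa [Fin.sum_univ_four] at this

theorem nonneg (x : Tet) (v : Fin 4) : 0 ≤ x.1 v := x.2.1 v

end Tet

open Tet

/-- A face pairing `(t, i, u, τ)`: face `i` of cell `t` is glued to face `τ i` of cell `u`,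
vertex `v` being sent to vertex `τ v`. -/
abbrev Pairing (T : Type) : Type := T × Fin 4 × T × Perm (Fin 4)

/-- Tetrahedra with some face pairings, and some marked faces (the ports).  Port `(t, σ)` is the
face of cell `t` opposite vertex `σ 3`, with its other vertices labelled by `σ`. -/
structure Ported (E : Type) where
  Cell : Type
  [top : TopologicalSpace Cell]
  [disc : DiscreteTopology Cell]
  [fin : Finite Cell]
  pairing : Set (Pairing Cell)
  port : E → Cell × Perm (Fin 4)

namespace Ported

attribute [instance] Ported.top Ported.disc Ported.fin

variable {E E' : Type}

/-- Points identified directly by a face pairing. -/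
def Adj (X : Ported E) (a b : X.Cell × Tet) : Prop :=
  ∃ i τ, (a.1, i, b.1, τ) ∈ X.pairing ∧ a.2.1 i = 0 ∧ b.2 = act τ a.2

/-- The quotient space. -/
def Space (X : Ported E) : Type := Quot X.Adj

instance (X : Ported E) : TopologicalSpace X.Space := inferInstanceAs (TopologicalSpace (Quot _))

instance (X : Ported E) : CompactSpace X.Space := inferInstanceAs (CompactSpace (Quot _))

/-- The point of the quotient with coordinates `x` in cell `t`. -/
def pt (X : Ported E) (t : X.Cell) (x : Tet) : X.Space := Quot.mk _ (t, x)

theorem continuous_pt (X : Ported E) (t : X.Cell) : Continuous (X.pt t) :=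
  continuous_quot_mk.comp (Continuous.prodMk_right t)

theorem pt_eq {X : Ported E} {t u i τ} (h : (t, i, u, τ) ∈ X.pairing) {x : Tet} (hx : x.1 i = 0) :
    X.pt t x = X.pt u (act τ x) :=
  Quot.sound ⟨i, τ, h, hx, rfl⟩

theorem pt_eq_symm {X : Ported E} {t u i τ} (h : (t, i, u, τ) ∈ X.pairing) {x : Tet}
    (hx : x.1 (τ i) = 0) : X.pt u x = X.pt t (act τ⁻¹ x) := by
  rw [pt_eq h (by simpa using hx)]; simp

theorem ind {X : Ported E} {p : X.Space → Prop} (h : ∀ t x, p (X.pt t x)) (a) : p a :=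
  Quot.ind (fun a => h a.1 a.2) a

/-- A family of maps on the cells descends to the quotient. -/
def desc (X : Ported E) {Z : Type*} (f : X.Cell → Tet → Z)
    (h : ∀ t i u τ, (t, i, u, τ) ∈ X.pairing → ∀ x : Tet, x.1 i = 0 → f t x = f u (act τ x)) :
    X.Space → Z :=
  Quot.lift (fun a => f a.1 a.2) (by
    rintro ⟨t, x⟩ ⟨u, y⟩ ⟨i, τ, hp, hx, hy⟩
    dsimp at *
    rw [hy]; exact h _ _ _ _ hp _ hx)

@[simp] theorem desc_pt (X : Ported E) {Z : Type*} (f : X.Cell → Tet → Z) (h) (t x) :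
    X.desc f h (X.pt t x) = f t x := rfl

theorem continuous_desc (X : Ported E) {Z : Type*} [TopologicalSpace Z] (f : X.Cell → Tet → Z) (h)
    (hf : ∀ t, Continuous (f t)) : Continuous (X.desc f h) :=
  continuous_quot_lift _ (continuous_prod_of_discrete_left.2 hf)

/-- The point of port `e` with coordinates `x` (where `x 3 = 0`). -/
def portPt (X : Ported E) (e : E) (x : Tet) : X.Space := X.pt (X.port e).1 (act (X.port e).2 x)

/-- Homeomorphic by a homeomorphism that respects the ports. -/
def Equivalent (X Y : Ported E) : Prop :=
  ∃ h : X.Space ≃ₜ Y.Space, ∀ e x, x.1 3 = 0 → h (X.portPt e x) = Y.portPt e x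

infix:50 " ≈ₚ " => Equivalent

theorem Equivalent.refl (X : Ported E) : X ≈ₚ X := ⟨Homeomorph.refl _, fun _ _ _ => rfl⟩

theorem Equivalent.symm {X Y : Ported E} : X ≈ₚ Y → Y ≈ₚ X := fun ⟨h, hp⟩ =>
  ⟨h.symm, fun e x hx => by rw [← hp e x hx]; simp⟩

theorem Equivalent.trans {X Y Z : Ported E} : X ≈ₚ Y → Y ≈ₚ Z → X ≈ₚ Z := fun ⟨h, hp⟩ ⟨k, kp⟩ =>
  ⟨h.trans k, fun e x hx => by simp [hp e x hx, kp e x hx]⟩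

/-- Spaces with continuous injections onto the same subset of a Hausdorff space. -/
theorem exists_homeomorph_of_range_eq {X Y Z : Type*} [TopologicalSpace X] [TopologicalSpace Y]
    [TopologicalSpace Z] [CompactSpace X] [CompactSpace Y] [T2Space Z] {f : X → Z} {g : Y → Z}
    (hf : Continuous f) (hg : Continuous g) (fi : f.Injective) (gi : g.Injective)
    (h : Set.range f = Set.range g) :
    ∃ e : X ≃ₜ Y, ∀ x y, f x = g y → e x = y := by
  have cf := (hf.isClosedEmbedding fi).isEmbedding
  have cg := (hg.isClosedEmbedding gi).isEmbedding
  refine ⟨(cf.toHomeomorph.trans (Homeomorph.setCongr h)).trans cg.toHomeomorph.symm, ?_⟩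
  intro x y hxy
  simp only [Homeomorph.trans_apply]
  rw [Homeomorph.symm_apply_eq]
  apply Subtype.ext
  exact hxy

theorem equivalent_of_range_eq {X Y : Ported E} {Z : Type*} [TopologicalSpace Z] [T2Space Z]
    {f : X.Space → Z} {g : Y.Space → Z}
    (hf : Continuous f) (hg : Continuous g) (fi : f.Injective) (gi : g.Injective)
    (h : Set.range f = Set.range g)
    (hp : ∀ e x, x.1 3 = 0 → f (X.portPt e x) = g (Y.portPt e x)) : X ≈ₚ Y := by
  obtain ⟨e, he⟩ := exists_homeomorph_of_range_eq hf hg fi gi h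
  exact ⟨e, fun p x hx => he _ _ (hp p x hx)⟩

/-- Both spaces are compact, so continuous maps to a Hausdorff model that separate exactly the
points not identified by the pairings are embeddings; equal images then give the homeomorphism. The
model itself need never be described. -/
theorem equivalent_of_maps {X Y : Ported E} {Z : Type*} [TopologicalSpace Z] [T2Space Z]
    {f : X.Cell → Tet → Z} {g : Y.Cell → Tet → Z}
    (hf : ∀ t, Continuous (f t)) (hg : ∀ t, Continuous (g t))
    (hf' : ∀ t i u τ, (t, i, u, τ) ∈ X.pairing → ∀ x : Tet, x.1 i = 0 → f t x = f u (act τ x))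
    (hg' : ∀ t i u τ, (t, i, u, τ) ∈ Y.pairing → ∀ x : Tet, x.1 i = 0 → g t x = g u (act τ x))
    (fi : ∀ t x u y, f t x = f u y → X.pt t x = X.pt u y)
    (gi : ∀ t x u y, g t x = g u y → Y.pt t x = Y.pt u y)
    (hfg : ∀ t x, ∃ u y, g u y = f t x) (hgf : ∀ t x, ∃ u y, f u y = g t x)
    (hp : ∀ e x, x.1 3 = 0 → f (X.port e).1 (act (X.port e).2 x) =
      g (Y.port e).1 (act (Y.port e).2 x)) : X ≈ₚ Y := by
  refine equivalent_of_range_eq (f := X.desc f hf') (g := Y.desc g hg') (continuous_desc _ _ _ hf)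
    (continuous_desc _ _ _ hg) ?_ ?_ ?_ hp
  · rintro ⟨t, x⟩ ⟨u, y⟩ h
    exact fi t x u y h
  · rintro ⟨t, x⟩ ⟨u, y⟩ h
    exact gi t x u y h
  · apply Set.eq_of_subset_of_subset
    · rintro _ ⟨⟨t, x⟩, rfl⟩
      obtain ⟨u, y, h⟩ := hfg t x
      exact ⟨Y.pt u y, h⟩
    · rintro _ ⟨⟨t, x⟩, rfl⟩
      obtain ⟨u, y, h⟩ := hgf t x
      exact ⟨X.pt u y, h⟩

/-- Mutually inverse relabellings of cells and vertices that match the pairings and the ports. -/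
theorem equivalent_of_relabel {X Y : Ported E} (φ : X.Cell ≃ Y.Cell) (s : X.Cell → Perm (Fin 4))
    (h₁ : ∀ t i u τ, (t, i, u, τ) ∈ X.pairing →
      (φ t, s t i, φ u, s u * τ * (s t)⁻¹) ∈ Y.pairing ∨
      (φ u, s u (τ i), φ t, s t * τ⁻¹ * (s u)⁻¹) ∈ Y.pairing)
    (h₂ : ∀ t i u τ, (φ t, i, φ u, τ) ∈ Y.pairing →
      (t, (s t)⁻¹ i, u, (s u)⁻¹ * τ * s t) ∈ X.pairing ∨
      (u, (s u)⁻¹ (τ i), t, (s t)⁻¹ * τ⁻¹ * s u) ∈ X.pairing)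
    (hp : ∀ e, Y.port e = (φ (X.port e).1, s (X.port e).1 * (X.port e).2)) : X ≈ₚ Y := by
  let f : X.Space → Y.Space := X.desc (fun t x => Y.pt (φ t) (act (s t) x)) (by
    intro t i u τ h x hx
    rcases h₁ t i u τ h with h | h
    · rw [pt_eq h (by simpa using hx)]; simp [act_mul]
    · rw [pt_eq_symm h (by simpa using hx)]; simp [act_mul])
  let g : Y.Space → X.Space := Y.desc (fun t x => X.pt (φ.symm t) (act (s (φ.symm t))⁻¹ x)) (by
    intro t i u τ h x hx
    rcases h₂ (φ.symm t) i (φ.symm u) τ (by simpa using h) with h | h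
    · rw [pt_eq h (by simpa using hx)]; simp [act_mul]
    · rw [pt_eq_symm h (by simpa using hx)]; simp [act_mul])
  have hf : Continuous f := X.continuous_desc _ _ fun t =>
    (Y.continuous_pt (φ t)).comp (continuous_act (s t))
  have hg : Continuous g := Y.continuous_desc _ _ fun t =>
    (X.continuous_pt (φ.symm t)).comp (continuous_act (s (φ.symm t))⁻¹)
  refine ⟨⟨⟨f, g, ind fun t x => ?_, ind fun t x => ?_⟩, hf, hg⟩, ?_⟩
  · simp [f, g]
  · simp [f, g]
  · intro e x hx
    change f (X.portPt e x) = Y.portPt e x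
    simp [f, portPt, hp e, act_mul]

/-- A face of `X` glued to the rest: either a port of `X`, or a face of an outer cell. -/
def place (X : Ported E) (C : Type) : E ⊕ C → (X.Cell ⊕ C) × Perm (Fin 4)
  | .inl e => (.inl (X.port e).1, (X.port e).2)
  | .inr c => (.inr c, 1)

/-- A pairing between ports of `X` and faces of outer cells, as a pairing of cells. -/
def pushPairing (X : Ported E) (C : Type) (g : Pairing (E ⊕ C)) : Pairing (X.Cell ⊕ C) :=
  ((X.place C g.1).1, (X.place C g.1).2 g.2.1, (X.place C g.2.2.1).1,
    (X.place C g.2.2.1).2 * g.2.2.2 * (X.place C g.1).2⁻¹)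

def inlPairing {A : Type} (C : Type) (g : Pairing A) : Pairing (A ⊕ C) :=
  (.inl g.1, g.2.1, .inl g.2.2.1, g.2.2.2)

/-- Adjoin outer cells `C` to `X`, with pairings `ρ` between ports of `X` and faces of outer
cells, and new ports `p`.  A port of `X` enters as a cell of which only face `3` is used. -/
abbrev assemble (X : Ported E) (C : Type) [TopologicalSpace C] [DiscreteTopology C] [Finite C]
    (ρ : Set (Pairing (E ⊕ C))) (p : E' → (E ⊕ C) × Perm (Fin 4)) : Ported E' where
  Cell := X.Cell ⊕ C
  pairing := inlPairing C '' X.pairing ∪ X.pushPairing C '' ρ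
  port e := ((X.place C (p e).1).1, (X.place C (p e).1).2 * (p e).2)

/-- Only face `3` of each port is used. -/
structure Proper {C : Type} (ρ : Set (Pairing (E ⊕ C))) (p : E' → (E ⊕ C) × Perm (Fin 4)) :
    Prop where
  left : ∀ e i v τ, (Sum.inl e, i, v, τ) ∈ ρ → i = 3
  right : ∀ u i e τ, (u, i, Sum.inl e, τ) ∈ ρ → τ i = 3
  port : ∀ e' e σ, p e' = (Sum.inl e, σ) → σ 3 = 3

section assemble

variable {C : Type} [TopologicalSpace C] [DiscreteTopology C] [Finite C]
  {ρ : Set (Pairing (E ⊕ C))} {p : E' → (E ⊕ C) × Perm (Fin 4)}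

/-- A point of a port of `X` or of an outer cell, in the assembled space. -/
def placePt (X : Ported E) (ρ : Set (Pairing (E ⊕ C))) (p : E' → (E ⊕ C) × Perm (Fin 4))
    (u : E ⊕ C) (x : Tet) : (X.assemble C ρ p).Space :=
  (X.assemble C ρ p).pt (X.place C u).1 (act (X.place C u).2 x)

theorem placePt_eq (X : Ported E) {u i v τ} (h : (u, i, v, τ) ∈ ρ) {x : Tet} (hx : x.1 i = 0) :
    X.placePt ρ p u x = X.placePt ρ p v (act τ x) := by
  unfold placePt
  have : X.pushPairing C (u, i, v, τ) ∈ (X.assemble C ρ p).pairing := .inr ⟨_, h, rfl⟩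
  rw [pt_eq this (by simpa using hx)]
  simp [act_mul]

/-- The inclusion of the space of `X`. -/
def incl (X : Ported E) (ρ : Set (Pairing (E ⊕ C))) (p : E' → (E ⊕ C) × Perm (Fin 4)) :
    X.Space → (X.assemble C ρ p).Space :=
  X.desc (fun t x => (X.assemble C ρ p).pt (.inl t) x) fun t i u τ h x hx => by
    have : inlPairing C (t, i, u, τ) ∈ (X.assemble C ρ p).pairing := .inl ⟨_, h, rfl⟩
    exact pt_eq this hx

theorem continuous_incl (X : Ported E) : Continuous (X.incl ρ p) :=
  X.continuous_desc _ _ fun _ => continuous_pt _ _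

/-- A port-respecting map is controlled on the face of the port only, hence the condition on
coordinate `3`; on an outer cell nothing has to be assumed. -/
theorem assemble_elim_place {X Y : Ported E} (h : X.Space → Y.Space)
    (hp : ∀ e x, x.1 3 = 0 → h (X.portPt e x) = Y.portPt e x) (u : E ⊕ C) (x : Tet)
    (hx : ∀ e, u = Sum.inl e → x.1 3 = 0) :
    (X.place C u).1.elim (fun t => Y.incl ρ p (h (X.pt t (act (X.place C u).2 x))))
      (fun c => (Y.assemble C ρ p).pt (.inr c) (act (X.place C u).2 x)) =
    Y.placePt ρ p u x := by
  rcases u with e | c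
  · have := hp e x (hx e rfl)
    simp only [portPt] at this
    simp only [place, Sum.elim_inl, this]
    rfl
  · rfl

/-- The map of assembled spaces induced by a map that respects ports. -/
def assembleMap {X Y : Ported E} (hρ : Proper ρ p) (h : X.Space → Y.Space)
    (hp : ∀ e x, x.1 3 = 0 → h (X.portPt e x) = Y.portPt e x) :
    (X.assemble C ρ p).Space → (Y.assemble C ρ p).Space :=
  (X.assemble C ρ p).desc
    (fun t x => t.elim (fun t => Y.incl ρ p (h (X.pt t x)))
      fun c => (Y.assemble C ρ p).pt (.inr c) x) (by
    rintro t i u τ (⟨⟨t', i', u', τ'⟩, hg, hh⟩ | ⟨⟨t', i', u', τ'⟩, hg, hh⟩) x hx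
    · simp only [inlPairing] at hh
      obtain ⟨rfl, rfl, rfl, rfl⟩ := hh
      simp only [Sum.elim_inl]
      rw [pt_eq hg hx]
    · simp only [pushPairing] at hh
      obtain ⟨rfl, rfl, rfl, rfl⟩ := hh
      have h1 := assemble_elim_place (ρ := ρ) (p := p) h hp t' (act (X.place C t').2⁻¹ x) (by
        rintro e rfl
        obtain rfl := hρ.left _ _ _ _ hg
        simpa using hx)
      have h2 := assemble_elim_place (ρ := ρ) (p := p) h hp u' (act τ' (act (X.place C t').2⁻¹ x)) (by
        rintro e rfl
        have h3 := hρ.right _ _ _ _ hg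
        rw [← h3]
        simpa using hx)
      rw [act_act_inv] at h1
      rw [act_mul, act_mul, h1, h2]
      exact Y.placePt_eq hg (by simpa using hx))

theorem continuous_assembleMap {X Y : Ported E} (hρ : Proper ρ p) (h : X.Space → Y.Space)
    (hp) (hc : Continuous h) :
    Continuous (assembleMap hρ h hp : (X.assemble C ρ p).Space → (Y.assemble C ρ p).Space) := by
  refine continuous_desc _ _ _ ?_
  rintro (t | c)
  · exact (Y.continuous_incl).comp (hc.comp (X.continuous_pt t))
  · exact continuous_pt _ _

theorem assembleMap_comp {X Y : Ported E} (hρ : Proper ρ p) (h : X.Space → Y.Space)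
    (hp) (k : Y.Space → X.Space) (kp) (hk : ∀ a, k (h a) = a) (a) :
    assembleMap hρ k kp (assembleMap hρ h hp a : (Y.assemble C ρ p).Space) = a := by
  have key : ∀ b, assembleMap hρ k kp (Y.incl ρ p b) = X.incl ρ p (k b) :=
    ind fun t x => rfl
  refine ind (p := fun a => assembleMap hρ k kp (assembleMap hρ h hp a : (Y.assemble C ρ p).Space) = a)
    (fun t x => ?_) a
  rcases t with t | c
  · change assembleMap hρ k kp (Y.incl ρ p (h (X.pt t x))) = _
    rw [key, hk]
    rfl
  · rfl

/-- Equivalent pieces can be exchanged. -/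
theorem Equivalent.assemble {X Y : Ported E} (hXY : X ≈ₚ Y) (hρ : Proper ρ p) :
    X.assemble C ρ p ≈ₚ Y.assemble C ρ p := by
  obtain ⟨h, hp⟩ := hXY
  have hp' : ∀ e x, x.1 3 = 0 → h.symm (Y.portPt e x) = X.portPt e x := fun e x hx => by
    rw [← hp e x hx]; simp
  refine ⟨⟨⟨assembleMap hρ h hp, assembleMap hρ h.symm hp', assembleMap_comp hρ h hp h.symm hp' (by simp),
    assembleMap_comp hρ h.symm hp' h hp (by simp)⟩,
    continuous_assembleMap hρ h hp h.continuous,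
    continuous_assembleMap hρ h.symm hp' h.symm.continuous⟩, ?_⟩
  intro e' x hx
  have h1 : (X.assemble C ρ p).portPt e' x = X.placePt ρ p (p e').1 (act (p e').2 x) := by
    simp [portPt, placePt, Ported.assemble, act_mul]
  have h2 : (Y.assemble C ρ p).portPt e' x = Y.placePt ρ p (p e').1 (act (p e').2 x) := by
    simp [portPt, placePt, Ported.assemble, act_mul]
  rw [h1, h2]
  change assembleMap hρ h hp (X.placePt ρ p (p e').1 (act (p e').2 x)) = _
  refine assemble_elim_place h hp _ _ fun e he => ?_
  have h3 := hρ.port e' e (p e').2 (by rw [← he])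
  have h4 := act_apply (p e').2 x 3
  rw [h3, hx] at h4
  exact h4

end assemble

end Ported

end

/-! ### The 2-3 move: two tetrahedra on a face, or three around an edge -/

section

open Equiv Tet

namespace Ported

/-- Two tetrahedra sharing a face; vertex `3` of each is an apex. -/
abbrev bipyramidTwo : Ported (Bool × Fin 3) where
  Cell := Bool
  pairing := {(true, 3, false, 1)}
  port e := (e.1, swap e.2.castSucc 3)

/-- The pairings of three tetrahedra around a common edge. -/
def bipyramidThreePairings : List (Pairing (Fin 3)) :=
  [(0, 1, 1, swap 0 1), (0, 2, 2, swap 0 2), (1, 2, 2, swap 1 2)]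

/-- Three tetrahedra around a common edge; in cell `j` this edge joins vertices `j` and `3`. -/
abbrev bipyramidThree : Ported (Bool × Fin 3) where
  Cell := Fin 3
  pairing := {g | g ∈ bipyramidThreePairings}
  port e := (e.2, if e.1 then swap e.2.castSucc 3 else 1)

/-- The model is the bipyramid over an equatorial triangle: coordinates `0, 1, 2` record the mass at
its corners, and coordinate `3` is a signed height. -/
noncomputable def bipyramidTwoMap (s : Bool) (x : Tet) (v : Fin 4) : ℝ :=
  if v = 3 then (if s then x.1 3 else -x.1 3) else x.1 v

/-- Vertices `3` and `j` of cell `j` are the two apices. What they have in common, `min` from each,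
cancels in height; this mass `2 * min` is spread evenly over the three equatorial corners, whence `2
/ 3`. -/
noncomputable def bipyramidThreeMap (j : Fin 3) (x : Tet) (v : Fin 4) : ℝ :=
  if v = 3 then x.1 3 - x.1 j.castSucc
  else (if v = j.castSucc then 0 else x.1 v) + 2 / 3 * min (x.1 3) (x.1 j.castSucc)

theorem bipyramidTwoMap_desc (t : Bool) (i) (u : Bool) (τ) (h : (t, i, u, τ) ∈ bipyramidTwo.pairing) (x : Tet)
    (hx : x.1 i = 0) : bipyramidTwoMap t x = bipyramidTwoMap u (act τ x) := by
  obtain ⟨rfl, rfl, rfl, rfl⟩ : t = true ∧ i = 3 ∧ u = false ∧ τ = 1 := by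
    have h : (t, i, u, τ) = (true, 3, false, 1) := h
    simpa using h
  funext v
  simp only [bipyramidTwoMap, act_one]
  split_ifs <;> simp_all

theorem bipyramidThreeMap_desc (t : Fin 3) (i) (u : Fin 3) (τ) (h : (t, i, u, τ) ∈ bipyramidThree.pairing) (x : Tet)
    (hx : x.1 i = 0) : bipyramidThreeMap t x = bipyramidThreeMap u (act τ x) := by
  replace h : (t, i, u, τ) ∈ bipyramidThreePairings := h
  simp only [bipyramidThreePairings, List.mem_cons, List.not_mem_nil, Prod.mk.injEq,
    or_false] at h
  rcases h with ⟨rfl, rfl, rfl, rfl⟩ | ⟨rfl, rfl, rfl, rfl⟩ | ⟨rfl, rfl, rfl, rfl⟩ <;>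
  · funext v
    fin_cases v <;> simp [bipyramidThreeMap, swap_apply_def, hx]

theorem eq_of_min_eq_of_sub_eq {a b c d : ℝ} (h : min a b = min c d) (h' : a - b = c - d) :
    a = c ∧ b = d := by
  rcases le_total a b with h1 | h1 <;> rcases le_total c d with h2 | h2 <;>
  simp only [min_eq_left, min_eq_right, h1, h2] at h <;> constructor <;> linarith

theorem bipyramidThree_glue {j k : Fin 3} (hjk : j ≠ k) {x y : Tet} (hx : x.1 k.castSucc = 0)
    (hy : y = act (swap j.castSucc k.castSucc) x) :
    bipyramidThree.pt j x = bipyramidThree.pt k y := by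
  subst hy
  have key : ∀ j k : Fin 3, j ≠ k →
      (j, k.castSucc, k, swap j.castSucc k.castSucc) ∈ bipyramidThreePairings ∨
      (k, j.castSucc, j, swap k.castSucc j.castSucc) ∈ bipyramidThreePairings := by decide
  rcases key j k hjk with h | h
  · exact pt_eq (X := bipyramidThree) h hx
  · rw [pt_eq_symm (X := bipyramidThree) h (by simpa using hx), swap_inv, swap_comm]

theorem castSucc_ne_three (j : Fin 3) : j.castSucc ≠ (3 : Fin 4) := by revert j; decide

theorem bipyramidTwoMap_inj (s : Bool) (x : Tet) (s' : Bool) (y : Tet)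
    (h : bipyramidTwoMap s x = bipyramidTwoMap s' y) :
    bipyramidTwo.pt s x = bipyramidTwo.pt s' y := by
  have h0 := congrFun h 0
  have h1 := congrFun h 1
  have h2 := congrFun h 2
  have h3 := congrFun h 3
  have e1 := x.sum_coord
  have e2 := y.sum_coord
  simp [bipyramidTwoMap] at h0 h1 h2 h3
  have h4 : x.1 3 = y.1 3 := by linarith
  have hxy : x = y := ext_val fun v => by fin_cases v <;> assumption
  subst hxy
  have hg : ∀ x : Tet, x.1 3 = 0 → bipyramidTwo.pt true x = bipyramidTwo.pt false x :=
    fun x hx => pt_eq (X := bipyramidTwo) (i := 3) (τ := 1) rfl hx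
  cases s <;> cases s' <;> simp at h3 <;> try rfl
  · exact (hg x (by linarith)).symm
  · exact hg x (by linarith)

/-- In cell `j` the image coordinate `j` is the bare `2 / 3 * min`, the least of the equatorial
ones; with the height it determines both apex coordinates. If points of cells `j ≠ k` have equal
images, comparing coordinates `j` and `k` shows that both lie on the shared face. -/
theorem bipyramidThreeMap_inj (j : Fin 3) (x : Tet) (k : Fin 3) (y : Tet)
    (h : bipyramidThreeMap j x = bipyramidThreeMap k y) :
    bipyramidThree.pt j x = bipyramidThree.pt k y := by
  have h3 : x.1 3 - x.1 j.castSucc = y.1 3 - y.1 k.castSucc := congrFun h 3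
  by_cases hjk : j = k
  · subst hjk
    have hj := congrFun h j.castSucc
    simp only [bipyramidThreeMap, castSucc_ne_three, if_false, if_true, zero_add] at hj
    obtain ⟨e1, e2⟩ := eq_of_min_eq_of_sub_eq (by linarith) h3
    congr 1
    refine ext_val fun v => ?_
    have hv := congrFun h v
    simp only [bipyramidThreeMap] at hv
    by_cases h4 : v = 3
    · rw [h4, e1]
    by_cases h5 : v = j.castSucc
    · rw [h5, e2]
    simp only [h4, h5, if_false] at hv
    linarith
  · have hj := congrFun h j.castSucc
    have hk := congrFun h k.castSucc
    have hne' : j.castSucc ≠ k.castSucc := by simpa using hjk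
    simp only [bipyramidThreeMap, castSucc_ne_three, if_false, if_true, hne', hne'.symm] at hj hk
    have n1 := y.nonneg j.castSucc
    have n2 := x.nonneg k.castSucc
    obtain ⟨e1, e2⟩ := eq_of_min_eq_of_sub_eq (by linarith) h3
    refine bipyramidThree_glue hjk (by linarith) (ext_val fun v => ?_)
    rw [act_val, swap_inv]
    by_cases h5 : v = j.castSucc
    · rw [h5, swap_apply_left]; linarith
    by_cases h6 : v = k.castSucc
    · rw [h6, swap_apply_right]; linarith
    rw [swap_apply_of_ne_of_ne h5 h6]
    by_cases h4 : v = 3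
    · rw [h4, e1]
    have hv := congrFun h v
    simp only [bipyramidThreeMap, h4, h5, h6, if_false] at hv
    linarith

/-- Replace two coordinates and shift the others. -/
theorem sum_shift (j : Fin 3) (x : Fin 4 → ℝ) (a b c : ℝ) :
    (∑ v, if v = 3 then a else if v = j.castSucc then b else x v + c) =
      a + b + 2 * c + (∑ v, x v) - x 3 - x j.castSucc := by
  fin_cases j <;> simp [Fin.sum_univ_four] <;> ring

theorem bipyramid_exists_three (s : Bool) (x : Tet) :
    ∃ j y, bipyramidThreeMap j y = bipyramidTwoMap s x := by
  obtain ⟨j, hj⟩ : ∃ j : Fin 3, ∀ v : Fin 3, x.1 j.castSucc ≤ x.1 v.castSucc :=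
    Finite.exists_min fun j : Fin 3 => x.1 j.castSucc
  have hj' : ∀ v : Fin 4, v ≠ 3 → x.1 j.castSucc ≤ x.1 v := fun v hv => by
    obtain ⟨w, rfl⟩ := Fin.exists_castSucc_eq.2 hv
    exact hj w
  have n3 := x.nonneg 3
  have nj := x.nonneg j.castSucc
  -- The point lies over the cell of its least equatorial coordinate, which must equal `2 / 3` of
  -- the smaller apex coordinate; the larger one exceeds it by the height.
  refine ⟨j, ⟨fun v => if v = 3 then (if s then x.1 3 else 0) + 3 / 2 * x.1 j.castSucc else
    if v = j.castSucc then (if s then 0 else x.1 3) + 3 / 2 * x.1 j.castSucc else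
      x.1 v + -x.1 j.castSucc, fun v => ?_, ?_⟩, funext fun v => ?_⟩
  · have := hj' v
    cases s <;> dsimp only <;> split_ifs with h1 h2 <;> first | positivity | simp_all
  · rw [sum_shift, x.2.2]
    cases s <;> simp <;> ring
  · have hm : min ((if s then x.1 3 else 0) + 3 / 2 * x.1 j.castSucc)
        ((if s then 0 else x.1 3) + 3 / 2 * x.1 j.castSucc) = 3 / 2 * x.1 j.castSucc := by
      cases s <;> simp [n3]
    simp only [bipyramidThreeMap, bipyramidTwoMap, castSucc_ne_three, if_false, if_true, hm]
    by_cases h1 : v = 3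
    · cases s <;> simp [h1]
    by_cases h2 : v = j.castSucc
    · simp only [h2, if_true, if_false, castSucc_ne_three]; ring
    · simp only [h1, h2, if_false]; ring

theorem bipyramid_exists_two (j : Fin 3) (x : Tet) :
    ∃ s y, bipyramidTwoMap s y = bipyramidThreeMap j x := by
  have n3 := x.nonneg 3
  have nj := x.nonneg j.castSucc
  refine ⟨decide (x.1 j.castSucc ≤ x.1 3), ⟨fun v => if v = 3 then |x.1 3 - x.1 j.castSucc| else
    if v = j.castSucc then 2 / 3 * min (x.1 3) (x.1 j.castSucc) else
      x.1 v + 2 / 3 * min (x.1 3) (x.1 j.castSucc), fun v => ?_, ?_⟩, funext fun v => ?_⟩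
  · have := x.nonneg v
    dsimp only
    split_ifs <;> positivity
  · rw [sum_shift, x.2.2]
    rcases le_total (x.1 3) (x.1 j.castSucc) with h | h
    · rw [min_eq_left h, abs_of_nonpos (by linarith)]; ring
    · rw [min_eq_right h, abs_of_nonneg (by linarith)]; ring
  · simp only [bipyramidThreeMap, bipyramidTwoMap]
    by_cases h1 : v = 3
    · by_cases h : x.1 j.castSucc ≤ x.1 3
      · simp [h1, h]
      · have h' : x.1 3 - x.1 j.castSucc ≤ 0 := by linarith
        simp [h1, h, abs_of_nonpos h']
    by_cases h2 : v = j.castSucc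
    · simp [h2, castSucc_ne_three]
    · simp [h1, h2]

theorem bipyramid_equivalent : bipyramidTwo ≈ₚ bipyramidThree := by
  refine equivalent_of_maps (f := bipyramidTwoMap) (g := bipyramidThreeMap)
    (fun s => continuous_pi fun v => ?_) (fun j => continuous_pi fun v => ?_)
    bipyramidTwoMap_desc bipyramidThreeMap_desc bipyramidTwoMap_inj bipyramidThreeMap_inj
    bipyramid_exists_three bipyramid_exists_two ?_
  · unfold bipyramidTwoMap
    split_ifs
    · exact continuous_coord 3
    · exact (continuous_coord 3).neg
    · exact continuous_coord v
  · unfold bipyramidThreeMap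
    have := fun v => continuous_coord v
    split_ifs
    · exact (this _).sub (this _)
    · exact continuous_const.add (continuous_const.mul ((this _).min (this _)))
    · exact (this _).add (continuous_const.mul ((this _).min (this _)))
  · rintro ⟨s, j⟩ x hx
    have nj := x.nonneg j.castSucc
    have hne := castSucc_ne_three j
    funext v
    cases s
    · by_cases h1 : v = 3
      · simp [bipyramidTwoMap, bipyramidThreeMap, hx, h1]
      by_cases h2 : v = j.castSucc
      · simp [bipyramidTwoMap, bipyramidThreeMap, hx, h2, hne, nj]
      simp [bipyramidTwoMap, bipyramidThreeMap, hx, h1, h2, nj,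
        swap_apply_of_ne_of_ne]
    · by_cases h1 : v = 3
      · simp [bipyramidTwoMap, bipyramidThreeMap, hx, h1]
      by_cases h2 : v = j.castSucc
      · simp [bipyramidTwoMap, bipyramidThreeMap, hx, h2, hne, nj]
      simp [bipyramidTwoMap, bipyramidThreeMap, hx, h1, h2, nj,
        swap_apply_of_ne_of_ne]

/-! ### Pleats: three folded copies of a tetrahedron are one tetrahedron -/

/-- Three copies of a tetrahedron: the first two share the faces in `I`, the last two share the
others. -/
abbrev pleat (I : Finset (Fin 4)) : Ported (Fin 4) where
  Cell := Fin 3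
  pairing := {g | ∃ i, g = if i ∈ I then (0, i, 1, 1) else (1, i, 2, 1)}
  port e := (if e ∈ I then 2 else 0, swap e 3)

/-- A single tetrahedron. -/
abbrev single : Ported (Fin 4) where
  Cell := Unit
  pairing := ∅
  port e := ((), swap e 3)

section pleat

variable {I : Finset (Fin 4)}

/-- Move by `δ`, away from the faces in `I` and towards the others. -/
noncomputable def shift (I : Finset (Fin 4)) (δ : ℝ) (x : Fin 4 → ℝ) (v : Fin 4) : ℝ :=
  if v ∈ I then x v + δ / (I.card : ℝ) else x v - δ / (Iᶜ.card : ℝ)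

theorem sum_shift_eq (hI : I.Nonempty) (hJ : Iᶜ.Nonempty) (δ : ℝ) (x : Fin 4 → ℝ) :
    ∑ v, shift I δ x v = ∑ v, x v := by
  have h1 : (I.card : ℝ) ≠ 0 := by simpa using hI.ne_empty
  have h2 : (Iᶜ.card : ℝ) ≠ 0 := by exact_mod_cast hJ.card_ne_zero
  have : ∀ v, shift I δ x v = x v + (if v ∈ I then δ / (I.card : ℝ) else -(δ / (Iᶜ.card : ℝ))) := by
    intro v; unfold shift; split_ifs <;> ring
  simp_rw [this]
  rw [Finset.sum_add_distrib, ← Finset.sum_add_sum_compl I (fun v => if v ∈ I then _ else _),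
    Finset.sum_congr rfl (fun v hv => if_pos hv),
    Finset.sum_congr (s₁ := Iᶜ) rfl (fun v hv => if_neg (Finset.mem_compl.1 hv))]
  simp only [Finset.sum_const, nsmul_eq_mul]
  field_simp
  ring

theorem inf'_add_const {J : Finset (Fin 4)} (hJ : J.Nonempty) {x y : Fin 4 → ℝ} {c : ℝ}
    (h : ∀ v ∈ J, y v = x v + c) : J.inf' hJ y = J.inf' hJ x + c := by
  apply le_antisymm
  · obtain ⟨v, hv, e⟩ := J.exists_mem_eq_inf' hJ x
    rw [e, ← h v hv]
    exact Finset.inf'_le _ hv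
  · refine Finset.le_inf' _ _ fun v hv => ?_
    rw [h v hv]
    linarith [Finset.inf'_le x hv]

variable (hI : I.Nonempty) (hJ : Iᶜ.Nonempty)

theorem inf'_shift (δ : ℝ) (x : Fin 4 → ℝ) :
    I.inf' hI (shift I δ x) = I.inf' hI x + δ / (I.card : ℝ) :=
  inf'_add_const hI fun v hv => by simp [shift, hv]

theorem inf'_compl_shift (δ : ℝ) (x : Fin 4 → ℝ) :
    Iᶜ.inf' hJ (shift I δ x) = Iᶜ.inf' hJ x - δ / (Iᶜ.card : ℝ) := by
  rw [sub_eq_add_neg]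
  exact inf'_add_const hJ fun v hv => by
    have := Finset.mem_compl.1 hv
    simp only [shift, this, if_false]; ring

/-- The scaled distance to the faces in `I`. -/
noncomputable def lower (x : Fin 4 → ℝ) : ℝ := I.card * I.inf' hI x

/-- The scaled distance to the faces outside `I`. -/
noncomputable def upper (x : Fin 4 → ℝ) : ℝ := Iᶜ.card * Iᶜ.inf' hJ x

theorem lower_shift (δ : ℝ) (x : Fin 4 → ℝ) : lower hI (shift I δ x) = lower hI x + δ := by
  have h1 : (I.card : ℝ) ≠ 0 := by simpa using hI.ne_empty
  rw [lower, lower, inf'_shift]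
  field_simp

theorem upper_shift (δ : ℝ) (x : Fin 4 → ℝ) : upper hJ (shift I δ x) = upper hJ x - δ := by
  have h1 : (Iᶜ.card : ℝ) ≠ 0 := by exact_mod_cast hJ.card_ne_zero
  rw [upper, upper, inf'_compl_shift]
  field_simp

theorem lower_nonneg {x : Fin 4 → ℝ} (hx : ∀ v, 0 ≤ x v) : 0 ≤ lower hI x :=
  mul_nonneg (by positivity) (Finset.le_inf' _ _ fun v _ => hx v)

theorem upper_nonneg {x : Fin 4 → ℝ} (hx : ∀ v, 0 ≤ x v) : 0 ≤ upper hJ x :=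
  mul_nonneg (by positivity) (Finset.le_inf' _ _ fun v _ => hx v)

theorem exists_eq_zero_of_lower {x : Fin 4 → ℝ} (h : lower hI x = 0) : ∃ i ∈ I, x i = 0 := by
  have h1 : (I.card : ℝ) ≠ 0 := by simpa using hI.ne_empty
  obtain ⟨i, hi, e⟩ := I.exists_mem_eq_inf' hI x
  rw [lower, e] at h
  exact ⟨i, hi, by simpa [h1] using h⟩

theorem exists_eq_zero_of_upper {x : Fin 4 → ℝ} (h : upper hJ x = 0) : ∃ i, i ∉ I ∧ x i = 0 := by
  have h1 : (Iᶜ.card : ℝ) ≠ 0 := by exact_mod_cast hJ.card_ne_zero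
  obtain ⟨i, hi, e⟩ := Iᶜ.exists_mem_eq_inf' hJ x
  rw [upper, e] at h
  exact ⟨i, Finset.mem_compl.1 hi, by simpa [h1] using h⟩

theorem lower_eq_zero {x : Fin 4 → ℝ} (hx : ∀ v, 0 ≤ x v) {i} (hi : i ∈ I) (h : x i = 0) :
    lower hI x = 0 := by
  have : I.inf' hI x = 0 := le_antisymm (h ▸ Finset.inf'_le x hi)
    (Finset.le_inf' _ _ fun v _ => hx v)
  rw [lower, this, mul_zero]

theorem upper_eq_zero {x : Fin 4 → ℝ} (hx : ∀ v, 0 ≤ x v) {i} (hi : i ∉ I) (h : x i = 0) :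
    upper hJ x = 0 := by
  have : Iᶜ.inf' hJ x = 0 := le_antisymm (h ▸ Finset.inf'_le x (Finset.mem_compl.2 hi))
    (Finset.le_inf' _ _ fun v _ => hx v)
  rw [upper, this, mul_zero]

theorem shift_shift (δ ε : ℝ) (x : Fin 4 → ℝ) : shift I δ (shift I ε x) = shift I (δ + ε) x := by
  funext v
  unfold shift
  split_ifs <;> ring

theorem shift_zero (x : Fin 4 → ℝ) : shift I 0 x = x := by
  funext v
  unfold shift
  split_ifs <;> ring

/-- Shifting keeps coordinates nonnegative until the opposite faces are reached. -/
theorem shift_nonneg {δ : ℝ} {x : Fin 4 → ℝ} (h1 : 0 ≤ lower hI x + δ) (h2 : 0 ≤ upper hJ x - δ)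
    (v : Fin 4) : 0 ≤ shift I δ x v := by
  rw [← lower_shift hI] at h1
  rw [← upper_shift hJ] at h2
  by_cases hv : v ∈ I
  · have h3 : (0 : ℝ) < I.card := by exact_mod_cast hI.card_pos
    exact (nonneg_of_mul_nonneg_right h1 h3).trans (Finset.inf'_le _ hv)
  · have h3 : (0 : ℝ) < Iᶜ.card := by exact_mod_cast hJ.card_pos
    exact (nonneg_of_mul_nonneg_right h2 h3).trans (Finset.inf'_le _ (Finset.mem_compl.2 hv))

theorem continuous_lower : Continuous fun x : Tet => lower hI x.1 :=
  continuous_const.mul (Continuous.finset_inf'_apply _ fun v _ => continuous_coord v)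

theorem continuous_upper : Continuous fun x : Tet => upper hJ x.1 :=
  continuous_const.mul (Continuous.finset_inf'_apply _ fun v _ => continuous_coord v)

/-- How far the copies are moved when the pleat is stretched onto one tetrahedron. -/
noncomputable def stretch (c : Fin 3) (x : Fin 4 → ℝ) : ℝ :=
  ![2 / 3 * upper hJ x, 2 / 3 * upper hJ x - 2 / 3 * lower hI x, -(2 / 3 * lower hI x)] c

/-- Along a line in the direction of `shift`, `ℓ = lower + upper` is constant and `t = lower` runs
from `0` on the faces in `I` to `ℓ` on the others. Copies `0, 1, 2` move `t` to `(t + 2ℓ)/3`, `(2ℓ -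
t)/3`, `t/3`: a zigzag through the three thirds of the segment, turning at `t = 0` between copies
`0, 1` and at `t = ℓ` between copies `1, 2`. -/
noncomputable def pleatMap (c : Fin 3) (x : Tet) : Fin 4 → ℝ := shift I (stretch hI hJ c x.1) x.1

theorem pleat_glue (x : Tet) {i : Fin 4} (hx : x.1 i = 0) :
    if i ∈ I then (pleat I).pt (0 : Fin 3) x = (pleat I).pt (1 : Fin 3) x
    else (pleat I).pt (1 : Fin 3) x = (pleat I).pt (2 : Fin 3) x := by
  split_ifs with hi
  · exact pt_eq (X := pleat I) (t := (0 : Fin 3)) (u := (1 : Fin 3)) (i := i) (τ := 1)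
      ⟨i, by rw [if_pos hi]⟩ hx
  · exact pt_eq (X := pleat I) (t := (1 : Fin 3)) (u := (2 : Fin 3)) (i := i) (τ := 1)
      ⟨i, by rw [if_neg hi]⟩ hx

theorem pleatMap_inj (c : Fin 3) (x : Tet) (d : Fin 3) (y : Tet)
    (h : pleatMap hI hJ c x = pleatMap hI hJ d y) : (pleat I).pt c x = (pleat I).pt d y := by
  have l1 := congrArg (lower hI) h
  have u1 := congrArg (upper hJ) h
  simp only [pleatMap, lower_shift, upper_shift] at l1 u1
  have nx := lower_nonneg hI x.2.1
  have nx' := upper_nonneg hJ x.2.1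
  have ny := lower_nonneg hI y.2.1
  have ny' := upper_nonneg hJ y.2.1
  have hxy : stretch hI hJ c x.1 = stretch hI hJ d y.1 → x = y := by
    intro e
    simp only [pleatMap, e] at h
    have := congrArg (shift I (-stretch hI hJ d y.1)) h
    rw [shift_shift, shift_shift, neg_add_cancel, shift_zero, shift_zero] at this
    exact Subtype.ext this
  have g01 : ∀ z : Tet, lower hI z.1 = 0 → (pleat I).pt (0 : Fin 3) z = (pleat I).pt (1 : Fin 3) z := by
    intro z hz
    obtain ⟨i, hi, hz⟩ := exists_eq_zero_of_lower hI hz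
    have := pleat_glue (I := I) z hz
    rwa [if_pos hi] at this
  have g12 : ∀ z : Tet, upper hJ z.1 = 0 → (pleat I).pt (1 : Fin 3) z = (pleat I).pt (2 : Fin 3) z := by
    intro z hz
    obtain ⟨i, hi, hz⟩ := exists_eq_zero_of_upper hJ hz
    have := pleat_glue (I := I) z hz
    rwa [if_neg hi] at this
  fin_cases c <;> fin_cases d <;>
    simp [stretch] at l1 u1 hxy ⊢
  · rw [hxy (by linarith)]
  · rw [hxy (by linarith)]
    exact g01 y (by linarith)
  · rw [hxy (by linarith)]
    exact (g01 y (by linarith)).trans (g12 y (by linarith))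
  · rw [hxy (by linarith)]
    exact (g01 y (by linarith)).symm
  · rw [hxy (by linarith)]
  · rw [hxy (by linarith)]
    exact g12 y (by linarith)
  · rw [hxy (by linarith)]
    exact ((g01 y (by linarith)).trans (g12 y (by linarith))).symm
  · rw [hxy (by linarith)]
    exact (g12 y (by linarith)).symm
  · rw [hxy (by linarith)]

theorem pleatMap_mem (c : Fin 3) (x : Tet) : ∃ y : Tet, y.1 = pleatMap hI hJ c x := by
  have nx := lower_nonneg hI x.2.1
  have nx' := upper_nonneg hJ x.2.1
  refine ⟨⟨pleatMap hI hJ c x, fun v => ?_, ?_⟩, rfl⟩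
  · apply shift_nonneg hI hJ <;> fin_cases c <;> simp [stretch] <;> linarith
  · exact (sum_shift_eq hI hJ _ _).trans x.2.2

theorem pleatMap_surj (y : Tet) : ∃ c x, pleatMap hI hJ c x = y.1 := by
  have ny := lower_nonneg hI y.2.1
  have ny' := upper_nonneg hJ y.2.1
  have key : ∀ (c : Fin 3) (δ : ℝ), 0 ≤ lower hI y.1 + δ → 0 ≤ upper hJ y.1 - δ →
      stretch hI hJ c (shift I δ y.1) = -δ → ∃ c x, pleatMap hI hJ c x = y.1 := by
    intro c δ h1 h2 h3
    refine ⟨c, ⟨shift I δ y.1, shift_nonneg hI hJ h1 h2, (sum_shift_eq hI hJ _ _).trans y.2.2⟩, ?_⟩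
    rw [pleatMap, h3, shift_shift, neg_add_cancel, shift_zero]
  -- The three cases are the thirds of the segment through `y`; each shift inverts the corresponding
  -- branch of the zigzag.
  rcases le_total (2 * upper hJ y.1) (lower hI y.1) with h | h
  · refine key 0 (-(2 * upper hJ y.1)) (by linarith) (by linarith) ?_
    simp [stretch, upper_shift]; ring
  rcases le_total (2 * lower hI y.1) (upper hJ y.1) with h' | h'
  · refine key 2 (2 * lower hI y.1) (by linarith) (by linarith) ?_
    simp [stretch, lower_shift]; ring
  · refine key 1 (2 * upper hJ y.1 - 2 * lower hI y.1) (by linarith) (by linarith) ?_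
    simp [stretch, lower_shift, upper_shift]; ring

theorem pleat_equivalent (hI : I.Nonempty) (hJ : Iᶜ.Nonempty) : pleat I ≈ₚ single := by
  refine equivalent_of_maps (f := pleatMap hI hJ) (g := fun _ x => x.1)
    (fun (c : Fin 3) => continuous_pi fun v => ?_) (fun _ => continuous_subtype_val)
    ?_ (fun t i u τ h => h.elim) (pleatMap_inj hI hJ) (fun _ x _ y h => ?_)
    (fun c x => ?_) (fun _ y => pleatMap_surj hI hJ y) ?_
  · have hs : Continuous fun x : Tet => stretch hI hJ c x.1 := by
      have h1 := continuous_lower hI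
      have h2 := continuous_upper hJ
      fin_cases c
      · exact continuous_const.mul h2
      · exact (continuous_const.mul h2).sub (continuous_const.mul h1)
      · exact (continuous_const.mul h1).neg
    unfold pleatMap shift
    split_ifs
    · exact (continuous_coord v).add (hs.div_const _)
    · exact (continuous_coord v).sub (hs.div_const _)
  · rintro (t : Fin 3) i (u : Fin 3) τ ⟨j, hj⟩ x hx
    split_ifs at hj with h
    · replace hj : (t, i, u, τ) = ((0 : Fin 3), j, (1 : Fin 3), (1 : Perm (Fin 4))) := hj
      obtain ⟨rfl, rfl, rfl, rfl⟩ : t = 0 ∧ i = j ∧ u = 1 ∧ τ = 1 := by simpa using hj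
      have := lower_eq_zero hI x.2.1 h hx
      simp [pleatMap, stretch, this]
    · replace hj : (t, i, u, τ) = ((1 : Fin 3), j, (2 : Fin 3), (1 : Perm (Fin 4))) := hj
      obtain ⟨rfl, rfl, rfl, rfl⟩ : t = 1 ∧ i = j ∧ u = 2 ∧ τ = 1 := by simpa using hj
      have := upper_eq_zero hJ x.2.1 h hx
      simp [pleatMap, stretch, this]
  · rw [Subtype.ext h]
  · obtain ⟨y, hy⟩ := pleatMap_mem hI hJ c x
    exact ⟨(), y, hy⟩
  · intro e x hx
    have hy : (act (swap e 3) x).1 e = 0 := by simpa using hx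
    change shift I (stretch hI hJ (if e ∈ I then 2 else 0) (act (swap e 3) x).1) _ =
      (act (swap e 3) x).1
    -- The free faces are the two ends of the zigzag, so they stay in place.
    have : stretch hI hJ (if e ∈ I then 2 else 0) (act (swap e 3) x).1 = 0 := by
      split_ifs with h
      · simp [stretch, lower_eq_zero hI (act (swap e 3) x).2.1 h hy]
      · simp [stretch, upper_eq_zero hJ (act (swap e 3) x).2.1 h hy]
    rw [this, shift_zero]

end pleat

end Ported

/-! ### Finite lists of pairings and decidable relabelling -/

/-- The permutation `0, 1, 2, 3 ↦ a, b, c, d`. -/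
def perm4 (a b c d : Fin 4) (h : (∀ v, (fun w => if w = a then 0 else if w = b then 1 else
      if w = c then 2 else 3 : Fin 4 → Fin 4) (![a, b, c, d] v) = v) ∧
    ∀ w : Fin 4, ![a, b, c, d] (if w = a then 0 else if w = b then 1 else
      if w = c then 2 else 3) = w := by decide) : Perm (Fin 4) where
  toFun := ![a, b, c, d]
  invFun w := if w = a then 0 else if w = b then 1 else if w = c then 2 else 3
  left_inv := h.1
  right_inv := h.2

namespace Ported

variable {E E' : Type}

/-- A pairing seen from the other side. -/
def revPairing {T : Type} (g : Pairing T) : Pairing T := (g.2.2.1, g.2.2.2 g.2.1, g.1, g.2.2.2⁻¹)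

/-- A pairing after relabelling cells by `φ` and their vertices by `s`. -/
def mapPairing {T U : Type} (φ : T → U) (s : T → Perm (Fin 4)) (g : Pairing T) : Pairing U :=
  (φ g.1, s g.1 g.2.1, φ g.2.2.1, s g.2.2.1 * g.2.2.2 * (s g.1)⁻¹)

theorem revPairing_revPairing {T : Type} (g : Pairing T) : revPairing (revPairing g) = g := by
  simp [revPairing]

theorem mapPairing_injective {T U : Type} {φ : T → U} (hφ : φ.Injective) (s : T → Perm (Fin 4)) :
    (mapPairing φ s).Injective := by
  rintro ⟨t, i, u, τ⟩ ⟨t', i', u', τ'⟩ h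
  simp only [mapPairing, Prod.mk.injEq] at h
  obtain ⟨h1, h2, h3, h4⟩ := h
  obtain rfl := hφ h1
  obtain rfl := hφ h3
  simp_all

theorem mapPairing_revPairing {T U : Type} (φ : T → U) (s : T → Perm (Fin 4)) (g : Pairing T) :
    mapPairing φ s (revPairing g) = revPairing (mapPairing φ s g) := by
  simp [mapPairing, revPairing, mul_assoc]

/-- Relabelling, in terms of sets of pairings up to reversal. -/
theorem equivalent_of_mapPairing {X Y : Ported E} (φ : X.Cell ≃ Y.Cell) (s : X.Cell → Perm (Fin 4))
    (h₁ : ∀ g ∈ X.pairing, mapPairing φ s g ∈ Y.pairing ∨ revPairing (mapPairing φ s g) ∈ Y.pairing)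
    (h₂ : ∀ g ∈ Y.pairing, ∃ g' ∈ X.pairing,
      mapPairing φ s g' = g ∨ revPairing (mapPairing φ s g') = g)
    (hp : ∀ e, Y.port e = (φ (X.port e).1, s (X.port e).1 * (X.port e).2)) : X ≈ₚ Y := by
  refine equivalent_of_relabel φ s (fun t i u τ h => ?_) (fun t i u τ h => ?_) hp
  · simpa [mapPairing, revPairing, mul_assoc] using h₁ _ h
  · have key : mapPairing φ s (t, (s t)⁻¹ i, u, (s u)⁻¹ * τ * s t) = (φ t, i, φ u, τ) := by
      simp [mapPairing, mul_assoc]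
    obtain ⟨g', hg', h | h⟩ := h₂ _ h
    · left
      rw [← key] at h
      rwa [← mapPairing_injective φ.injective s h]
    · right
      rw [← key, ← mapPairing_revPairing] at h
      have := congrArg revPairing (mapPairing_injective φ.injective s h)
      rw [revPairing_revPairing] at this
      rw [this] at hg'
      simpa [revPairing, mul_assoc] using hg'

/-- A list enumerates the pairings, each from at least one side. -/
def Lists (X : Ported E) (L : List (Pairing X.Cell)) : Prop := ∀ g, g ∈ X.pairing ↔ g ∈ L

theorem Lists.assemble {X : Ported E} {L : List (Pairing X.Cell)} (h : X.Lists L)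
    (C : Type) [TopologicalSpace C] [DiscreteTopology C] [Finite C] (R : List (Pairing (E ⊕ C)))
    (p : E' → (E ⊕ C) × Perm (Fin 4)) :
    (X.assemble C {g | g ∈ R} p).Lists (L.map (inlPairing C) ++ R.map (X.pushPairing C)) := by
  have key : ∀ g : Pairing (X.Cell ⊕ C), g ∈ L.map (inlPairing C) ++ R.map (X.pushPairing C) ↔
      g ∈ inlPairing C '' X.pairing ∪ X.pushPairing C '' {g | g ∈ R} := by
    intro g
    rw [List.mem_append, List.mem_map, List.mem_map]
    refine or_congr ?_ Iff.rfl
    exact exists_congr fun a => and_congr_left fun _ => (h a).symm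
  exact fun g => (key g).symm

theorem Lists.equivalent {X Y : Ported E} {L : List (Pairing X.Cell)} {M : List (Pairing Y.Cell)}
    (hL : X.Lists L) (hM : Y.Lists M) (φ : X.Cell ≃ Y.Cell) (s : X.Cell → Perm (Fin 4))
    (h₁ : ∀ g ∈ L, mapPairing φ s g ∈ M ∨ revPairing (mapPairing φ s g) ∈ M)
    (h₂ : ∀ g ∈ M, ∃ g' ∈ L, mapPairing φ s g' = g ∨ revPairing (mapPairing φ s g') = g)
    (hp : ∀ e, Y.port e = (φ (X.port e).1, s (X.port e).1 * (X.port e).2)) : X ≈ₚ Y := by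
  refine equivalent_of_mapPairing φ s (fun g hg => ?_) (fun g hg => ?_) hp
  · rw [hM, hM]; exact h₁ g ((hL g).1 hg)
  · obtain ⟨g', h, h'⟩ := h₂ g ((hM g).1 hg)
    exact ⟨g', (hL g').2 h, h'⟩

theorem lists_bipyramidTwo : bipyramidTwo.Lists [((true, 3, false, 1) : Pairing Bool)] :=
  fun g => (List.mem_singleton (a := (g : Pairing Bool))).symm

theorem lists_bipyramidThree : bipyramidThree.Lists bipyramidThreePairings := fun _ => Iff.rfl

/-- The pairings of a pleat. -/
def pleatPairings (I : Finset (Fin 4)) : List (Pairing (Fin 3)) :=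
  (List.finRange 4).map fun i => if i ∈ I then (0, i, 1, 1) else (1, i, 2, 1)

theorem lists_pleat (I : Finset (Fin 4)) : (pleat I).Lists (pleatPairings I) := by
  have key : ∀ g : Pairing (Fin 3), g ∈ pleatPairings I ↔
      ∃ i, g = if i ∈ I then (0, i, 1, 1) else (1, i, 2, 1) := by
    intro g
    rw [pleatPairings, List.mem_map]
    exact exists_congr fun i => by simp only [List.mem_finRange, true_and]; exact eq_comm
  exact fun g => (key g).symm

theorem lists_single : single.Lists [] := fun _ => ⟨fun h => h.elim, fun h => (List.not_mem_nil h).elim⟩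

/-- A decidable form of `Proper`. -/
theorem proper_of_list {C : Type} {R : List (Pairing (E ⊕ C))} {p : E' → (E ⊕ C) × Perm (Fin 4)}
    (h : ∀ g ∈ R, (g.1.isLeft → g.2.1 = 3) ∧ (g.2.2.1.isLeft → g.2.2.2 g.2.1 = 3))
    (h' : ∀ e, (p e).1.isLeft → (p e).2 3 = 3) : Proper {g | g ∈ R} p where
  left e i v τ hg := (h _ hg).1 rfl
  right u i e τ hg := (h _ hg).2 rfl
  port e' e σ he := by have := h' e'; rw [he] at this; exact this rfl

/-! ### The links of a chain -/

/-- A tetrahedron with two faces folded together, as a piece with two ports. -/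
abbrev snap : Ported Bool where
  Cell := Unit
  pairing := {g | g ∈ [((), 1, (), perm4 0 2 1 3)]}
  port e := ((), if e then 1 else perm4 1 2 3 0)

theorem lists_snap : snap.Lists [(((), 1, (), perm4 0 2 1 3) : Pairing Unit)] := fun _ => Iff.rfl

def twistPairings : List (Pairing (Bool ⊕ Unit)) :=
  [(.inr (), 1, .inr (), perm4 0 2 1 3), (.inl true, 3, .inr (), perm4 1 2 3 0)]

def snapEnds : Bool → (Bool ⊕ Unit) × Perm (Fin 4)
  | true => (.inr (), 1)
  | false => (.inl false, 1)

/-- A piece followed by a snapped tetrahedron, with a twist. -/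
abbrev twistSnap (X : Ported Bool) : Ported Bool := X.assemble Unit {g | g ∈ twistPairings} snapEnds

def joinPairings : List (Pairing (Bool ⊕ Unit)) :=
  [(.inr (), 1, .inr (), perm4 0 2 1 3), (.inl true, 3, .inr (), perm4 3 1 2 0)]

/-- A piece followed by a snapped tetrahedron. -/
abbrev joinSnap (X : Ported Bool) : Ported Bool := X.assemble Unit {g | g ∈ joinPairings} snapEnds

def capPairings : List (Pairing (Bool ⊕ Bool)) :=
  [(.inl true, 3, .inr false, perm4 2 0 3 1), (.inr false, 2, .inr true, perm4 2 3 0 1),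
    (.inr false, 3, .inr true, perm4 2 3 0 1), (.inr true, 2, .inr true, perm4 0 1 3 2)]

def capEnds : Bool → (Bool ⊕ Bool) × Perm (Fin 4)
  | true => (.inr false, perm4 2 1 3 0)
  | false => (.inl false, 1)

/-- A piece followed by two tetrahedra sharing two faces, the second of them folded. -/
abbrev joinCap (X : Ported Bool) : Ported Bool := X.assemble Bool {g | g ∈ capPairings} capEnds

theorem Equivalent.twistSnap {X Y : Ported Bool} (h : X ≈ₚ Y) : X.twistSnap ≈ₚ Y.twistSnap :=
  h.assemble (proper_of_list (by decide) (by decide))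

theorem Equivalent.joinSnap {X Y : Ported Bool} (h : X ≈ₚ Y) : X.joinSnap ≈ₚ Y.joinSnap :=
  h.assemble (proper_of_list (by decide) (by decide))

theorem Equivalent.joinCap {X Y : Ported Bool} (h : X ≈ₚ Y) : X.joinCap ≈ₚ Y.joinCap :=
  h.assemble (proper_of_list (by decide) (by decide))

/-- Decidable conditions for a relabelling of listed pairings and ports. -/
def Relabels {E T U : Type} (L : List (Pairing T)) (q : E → T × Perm (Fin 4))
    (M : List (Pairing U)) (r : E → U × Perm (Fin 4)) (f : T → U) (s : T → Perm (Fin 4)) : Prop :=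
  f.Bijective ∧
  (∀ g ∈ L, mapPairing f s g ∈ M ∨ revPairing (mapPairing f s g) ∈ M) ∧
  (∀ g ∈ M, ∃ g' ∈ L, mapPairing f s g' = g ∨ revPairing (mapPairing f s g') = g) ∧
  ∀ e, r e = (f (q e).1, s (q e).1 * (q e).2)


instance {E T U : Type} [Fintype E] [Fintype T] [Fintype U] [DecidableEq T] [DecidableEq U]
    (L : List (Pairing T)) (q : E → T × Perm (Fin 4)) (M : List (Pairing U))
    (r : E → U × Perm (Fin 4)) (f : T → U) (s : T → Perm (Fin 4)) :
    Decidable (Relabels L q M r f s) :=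
  haveI : Decidable (∀ g ∈ L, mapPairing f s g ∈ M ∨ revPairing (mapPairing f s g) ∈ M) :=
    inferInstance
  haveI : Decidable (∀ g ∈ M, ∃ g' ∈ L, mapPairing f s g' = g ∨
    revPairing (mapPairing f s g') = g) := inferInstance
  inferInstanceAs (Decidable (_ ∧ _ ∧ _ ∧ _))

theorem Lists.relabel {E : Type} {X Y : Ported E} {L : List (Pairing X.Cell)}
    {M : List (Pairing Y.Cell)} (hL : X.Lists L) (hM : Y.Lists M) (f : X.Cell → Y.Cell)
    (s : X.Cell → Perm (Fin 4)) (h : Relabels L X.port M Y.port f s) : X ≈ₚ Y :=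
  hL.equivalent hM (Equiv.ofBijective f h.1) s h.2.1 h.2.2.1 h.2.2.2

/-! ### Shortening a chain by local moves -/

def twistSnapPairings : List (Pairing ((Bool × Fin 3) ⊕ Fin 0)) :=
  [(.inl (false, 1), 3, .inl (false, 2), perm4 0 2 1 3),
    (.inl (true, 0), 3, .inl (true, 1), perm4 1 0 2 3)]

def twistSnapPorts (e : Bool) : ((Bool × Fin 3) ⊕ Fin 0) × Perm (Fin 4) :=
  cond e (.inl (true, 2), perm4 2 0 1 3) (.inl (false, 0), perm4 1 2 0 3)

def twistSnapMidPairings : List (Pairing (Fin 4 ⊕ Fin 0)) :=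
  [(.inl 2, 3, .inl 1, perm4 0 2 1 3)]

def twistSnapMidPorts (e : Bool) : (Fin 4 ⊕ Fin 0) × Perm (Fin 4) :=
  cond e (.inl 0, 1) (.inl 3, perm4 1 2 0 3)

/-- Two snapped tetrahedra glued with a twist make one. -/
theorem twistSnap_snap : twistSnap snap ≈ₚ snap := by
  -- The two tetrahedra share a face, so they are a bipyramid with two folds on its boundary, and
  -- the 2-3 move applies.
  have h0 : bipyramidTwo.assemble (Fin 0) {g | g ∈ twistSnapPairings} twistSnapPorts ≈ₚ
      twistSnap snap :=
    Lists.relabel (lists_bipyramidTwo.assemble _ _ _) (lists_snap.assemble _ _ _)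
      (Sum.elim (fun b => cond b (.inr ()) (.inl ())) ![])
      (Sum.elim (fun b => cond b (perm4 1 2 3 0) (1)) ![]) (by decide +kernel)
  have k0 := bipyramid_equivalent.assemble (C := Fin 0)
    (proper_of_list (R := twistSnapPairings) (p := twistSnapPorts) (by decide) (by decide))
  -- Of the five pairings among the three tetrahedra, four form a pleat; flattening it leaves one
  -- tetrahedron with a single fold.
  have h1 : (pleat {0, 1}).assemble (Fin 0) {g | g ∈ twistSnapMidPairings} twistSnapMidPorts ≈ₚ
      bipyramidThree.assemble (Fin 0) {g | g ∈ twistSnapPairings} twistSnapPorts :=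
    Lists.relabel ((lists_pleat _).assemble _ _ _) (lists_bipyramidThree.assemble _ _ _)
      (Sum.elim ![.inl 0, .inl 1, .inl 2] ![])
      (Sum.elim ![1, perm4 1 0 2 3, perm4 2 0 1 3] ![]) (by decide +kernel)
  have k1 := (pleat_equivalent (I := {0, 1}) (by decide) (by decide)).assemble (C := Fin 0)
    (proper_of_list (R := twistSnapMidPairings) (p := twistSnapMidPorts) (by decide) (by decide))
  have h : single.assemble (Fin 0) {g | g ∈ twistSnapMidPairings} twistSnapMidPorts ≈ₚ snap :=
    Lists.relabel (lists_single.assemble _ _ _) lists_snap (fun _ => ()) (fun _ => perm4 3 1 2 0) (by decide +kernel)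
  exact h0.symm.trans (k0.trans (h1.symm.trans (k1.trans h)))

def joinSnapPairings : List (Pairing ((Bool × Fin 3) ⊕ Fin 0)) :=
  [(.inl (false, 1), 3, .inl (false, 2), perm4 0 2 1 3),
    (.inl (true, 1), 3, .inl (true, 2), perm4 0 2 1 3)]

def joinSnapPorts (e : Bool) : ((Bool × Fin 3) ⊕ Fin 0) × Perm (Fin 4) :=
  cond e (.inl (true, 0), 1) (.inl (false, 0), perm4 1 2 0 3)

def joinSnapMidPairings : List (Pairing (Fin 4 ⊕ Fin 0)) :=
  [(.inl 2, 3, .inl 0, perm4 2 1 0 3)]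

def joinSnapMidPorts (e : Bool) : (Fin 4 ⊕ Fin 0) × Perm (Fin 4) :=
  cond e (.inl 1, perm4 1 0 2 3) (.inl 3, perm4 0 2 1 3)

/-- Two snapped tetrahedra make one. -/
theorem joinSnap_snap : joinSnap snap ≈ₚ snap := by
  have h0 : bipyramidTwo.assemble (Fin 0) {g | g ∈ joinSnapPairings} joinSnapPorts ≈ₚ
      joinSnap snap :=
    Lists.relabel (lists_bipyramidTwo.assemble _ _ _) (lists_snap.assemble _ _ _)
      (Sum.elim (fun b => cond b (.inr ()) (.inl ())) ![])
      (Sum.elim (fun b => cond b (perm4 3 1 2 0) (1)) ![]) (by decide +kernel)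
  have k0 := bipyramid_equivalent.assemble (C := Fin 0)
    (proper_of_list (R := joinSnapPairings) (p := joinSnapPorts) (by decide) (by decide))
  have h1 : (pleat {0}).assemble (Fin 0) {g | g ∈ joinSnapMidPairings} joinSnapMidPorts ≈ₚ
      bipyramidThree.assemble (Fin 0) {g | g ∈ joinSnapPairings} joinSnapPorts :=
    Lists.relabel ((lists_pleat _).assemble _ _ _) (lists_bipyramidThree.assemble _ _ _)
      (Sum.elim ![.inl 0, .inl 1, .inl 2] ![])
      (Sum.elim ![perm4 1 0 2 3, 1, perm4 0 2 1 3] ![]) (by decide +kernel)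
  have k1 := (pleat_equivalent (I := {0}) (by decide) (by decide)).assemble (C := Fin 0)
    (proper_of_list (R := joinSnapMidPairings) (p := joinSnapMidPorts) (by decide) (by decide))
  have h : single.assemble (Fin 0) {g | g ∈ joinSnapMidPairings} joinSnapMidPorts ≈ₚ snap :=
    Lists.relabel (lists_single.assemble _ _ _) lists_snap (fun _ => ()) (fun _ => perm4 1 3 2 0) (by decide +kernel)
  exact h0.symm.trans (k0.trans (h1.symm.trans (k1.trans h)))

def joinCapPairings : List (Pairing ((Bool × Fin 3) ⊕ Fin 1)) :=
  [(.inl (false, 1), 3, .inl (false, 2), perm4 0 2 1 3),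
    (.inl (true, 0), 3, .inr 0, perm4 3 2 1 0),
    (.inl (true, 2), 3, .inr 0, perm4 0 2 3 1),
    (.inr 0, 2, .inr 0, perm4 0 1 3 2)]

def joinCapPorts (e : Bool) : ((Bool × Fin 3) ⊕ Fin 1) × Perm (Fin 4) :=
  cond e (.inl (true, 1), 1) (.inl (false, 0), perm4 1 2 0 3)

def joinCapMidPairings : List (Pairing ((Bool × Fin 3) ⊕ Fin 1)) :=
  [(.inl (true, 0), 3, .inr 0, perm4 3 1 2 0),
    (.inr 0, 2, .inl (true, 2), perm4 0 1 3 2),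
    (.inr 0, 3, .inl (false, 2), 1),
    (.inl (true, 1), 3, .inl (false, 1), 1)]

def joinCapMidPorts (e : Bool) : ((Bool × Fin 3) ⊕ Fin 1) × Perm (Fin 4) :=
  cond e (.inr 0, perm4 0 3 2 1) (.inl (false, 0), perm4 0 2 1 3)

def joinCapMid'Pairings : List (Pairing (Fin 4 ⊕ Fin 0)) :=
  [(.inl 1, 3, .inl 3, 1)]

def joinCapMid'Ports (e : Bool) : (Fin 4 ⊕ Fin 0) × Perm (Fin 4) :=
  cond e (.inl 0, perm4 2 1 0 3) (.inl 2, perm4 1 2 0 3)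

/-- The two extra tetrahedra do not change a snapped tetrahedron. -/
theorem joinCap_snap : joinCap snap ≈ₚ snap := by
  have h0 : bipyramidTwo.assemble (Fin 1) {g | g ∈ joinCapPairings} joinCapPorts ≈ₚ
      joinCap snap :=
    Lists.relabel (lists_bipyramidTwo.assemble _ _ _) (lists_snap.assemble _ _ _)
      (Sum.elim (fun b => cond b (.inr false) (.inl ())) ![.inr true])
      (Sum.elim (fun b => cond b (perm4 2 0 3 1) (1)) ![1]) (by decide +kernel)
  have k0 := bipyramid_equivalent.assemble (C := Fin 1)
    (proper_of_list (R := joinCapPairings) (p := joinCapPorts) (by decide) (by decide))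
  -- The four tetrahedra also surround another edge of degree three, formed by cells `0, 2` and the
  -- outer cell. Undoing the move there instead leaves three tetrahedra that form a pleat.
  have h1 : bipyramidThree.assemble (Fin 1) {g | g ∈ joinCapMidPairings} joinCapMidPorts ≈ₚ
      bipyramidThree.assemble (Fin 1) {g | g ∈ joinCapPairings} joinCapPorts :=
    Lists.relabel (lists_bipyramidThree.assemble _ _ _) (lists_bipyramidThree.assemble _ _ _)
      (Sum.elim ![.inl 0, .inr 0, .inl 2] ![.inl 1])
      (Sum.elim ![perm4 1 0 2 3, perm4 0 2 1 3, perm4 0 2 1 3] ![1]) (by decide +kernel)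
  have k1 := bipyramid_equivalent.symm.assemble (C := Fin 1)
    (proper_of_list (R := joinCapMidPairings) (p := joinCapMidPorts) (by decide) (by decide))
  have h2 : (pleat {0, 1}).assemble (Fin 0) {g | g ∈ joinCapMid'Pairings} joinCapMid'Ports ≈ₚ
      bipyramidTwo.assemble (Fin 1) {g | g ∈ joinCapMidPairings} joinCapMidPorts :=
    Lists.relabel ((lists_pleat _).assemble _ _ _) (lists_bipyramidTwo.assemble _ _ _)
      (Sum.elim ![.inl false, .inl true, .inr 0] ![])
      (Sum.elim ![perm4 1 3 0 2, perm4 1 3 0 2, perm4 1 3 0 2] ![]) (by decide +kernel)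
  have k2 := (pleat_equivalent (I := {0, 1}) (by decide) (by decide)).assemble (C := Fin 0)
    (proper_of_list (R := joinCapMid'Pairings) (p := joinCapMid'Ports) (by decide) (by decide))
  have h : single.assemble (Fin 0) {g | g ∈ joinCapMid'Pairings} joinCapMid'Ports ≈ₚ snap :=
    Lists.relabel (lists_single.assemble _ _ _) lists_snap (fun _ => ()) (fun _ => perm4 3 1 0 2) (by decide +kernel)
  exact h0.symm.trans (k0.trans (h1.symm.trans (k1.trans (h2.symm.trans (k2.trans h)))))

end Ported

/-! ### The three-sphere as the join of two circles -/

/-- The point at fraction `a / (a + b)` of the circle of radius `√(a + b)`. -/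
noncomputable def circlePoint (a b : ℝ) : ℂ :=
  (√(a + b) : ℝ) * Complex.exp ((2 * Real.pi * (a / (a + b)) : ℝ) * Complex.I)

theorem norm_circlePoint (a b : ℝ) : ‖circlePoint a b‖ = √(a + b) := by
  rw [circlePoint, norm_mul, Complex.norm_exp_ofReal_mul_I, mul_one, Complex.norm_real,
    Real.norm_of_nonneg (Real.sqrt_nonneg _)]

/-- Where `a + b = 0` the angle is a division by zero, but the modulus `√(a + b)` tends to `0`
there. -/
theorem continuous_circlePoint : Continuous fun p : ℝ × ℝ => circlePoint p.1 p.2 := by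
  rw [continuous_iff_continuousAt]
  intro p
  by_cases h : p.1 + p.2 = 0
  · have h0 : circlePoint p.1 p.2 = 0 := by simp [circlePoint, h]
    rw [ContinuousAt, h0, tendsto_zero_iff_norm_tendsto_zero]
    simp only [norm_circlePoint]
    have : Continuous fun p : ℝ × ℝ => √(p.1 + p.2) := by fun_prop
    simpa [h] using this.tendsto p
  · unfold circlePoint
    fun_prop (disch := exact h)

theorem circlePoint_zero_left (b : ℝ) : circlePoint 0 b = circlePoint b 0 := by
  rcases eq_or_ne b 0 with rfl | hb
  · rfl
  · simp [circlePoint, hb, Complex.exp_two_pi_mul_I]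

/-- The modulus determines `a + b`, and the angle determines `a / (a + b)` modulo `1`. Two fractions
in `[0, 1]` can differ by a nonzero integer only if they are `0` and `1`: the ends of the segment
are all that is identified. -/
theorem circlePoint_eq {a b c d : ℝ} (ha : 0 ≤ a) (hb : 0 ≤ b) (hc : 0 ≤ c) (hd : 0 ≤ d)
    (h : circlePoint a b = circlePoint c d) :
    (c = a ∧ d = b) ∨ ((a = 0 ∨ b = 0) ∧ c = b ∧ d = a) := by
  have hs : a + b = c + d := by
    have := congrArg norm h
    rw [norm_circlePoint, norm_circlePoint] at this
    exact (Real.sqrt_inj (by positivity) (by positivity)).1 this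
  rcases eq_or_ne (a + b) 0 with h0 | h0
  · left; constructor <;> linarith
  have hpos : 0 < a + b := lt_of_le_of_ne (by positivity) h0.symm
  rw [circlePoint, circlePoint, ← hs] at h
  have h := mul_left_cancel₀ (by simpa using (Real.sqrt_pos.2 hpos).ne') h
  obtain ⟨n, hn⟩ := Complex.exp_eq_exp_iff_exists_int.1 h
  have hn' : a / (a + b) = c / (a + b) + n := by
    have h1 : ((2 * Real.pi * (a / (a + b)) : ℝ) : ℂ) = (2 * Real.pi * (c / (a + b) + n) : ℝ) := by
      apply mul_right_cancel₀ Complex.I_ne_zero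
      rw [hn]; push_cast; ring
    have h2 := Complex.ofReal_injective h1
    exact mul_left_cancel₀ (by positivity) h2
  have hac : a = c + n * (a + b) := by
    field_simp at hn'
    linarith
  have hn1 : (n : ℝ) ≤ 1 := by
    by_contra hlt
    nlinarith [mul_pos (sub_pos.2 (not_le.1 hlt)) hpos]
  have hn2 : -1 ≤ (n : ℝ) := by
    by_contra hlt
    nlinarith [mul_pos (sub_pos.2 (not_le.1 hlt)) hpos]
  have hn1 : n ≤ 1 := by exact_mod_cast hn1
  have hn2 : -1 ≤ n := by exact_mod_cast hn2
  interval_cases n <;> norm_num at hac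
  · right; refine ⟨.inl ?_, ?_, ?_⟩ <;> linarith
  · left; constructor <;> linarith
  · right; refine ⟨.inr ?_, ?_, ?_⟩ <;> linarith

theorem exists_circlePoint_eq (z : ℂ) :
    ∃ a b : ℝ, 0 ≤ a ∧ 0 ≤ b ∧ a + b = ‖z‖ ^ 2 ∧ circlePoint a b = z := by
  set θ := Complex.arg z / (2 * Real.pi)
  rcases eq_or_ne z 0 with rfl | hz
  · exact ⟨0, 0, le_rfl, le_rfl, by simp, by simp [circlePoint]⟩
  have hf := Int.fract_nonneg θ
  have hf' := (Int.fract_lt_one θ).le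
  have hs : ‖z‖ ^ 2 * Int.fract θ + ‖z‖ ^ 2 * (1 - Int.fract θ) = ‖z‖ ^ 2 := by ring
  refine ⟨‖z‖ ^ 2 * Int.fract θ, ‖z‖ ^ 2 * (1 - Int.fract θ), by positivity,
    mul_nonneg (by positivity) (by linarith), hs, ?_⟩
  have h1 : ‖z‖ ≠ 0 := by simpa using hz
  rw [circlePoint, hs, mul_div_cancel_left₀ _ (by positivity), Real.sqrt_sq (norm_nonneg z)]
  conv_rhs => rw [← Complex.norm_mul_exp_arg_mul_I z]
  congr 1
  rw [Complex.exp_eq_exp_iff_exists_int]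
  refine ⟨-⌊θ⌋, ?_⟩
  have : Complex.arg z = 2 * Real.pi * θ := by simp only [θ]; field_simp
  rw [this, ← Int.self_sub_floor]
  push_cast
  ring

namespace Ported

/-- The unit sphere of `ℂ²`. -/
abbrev Sphere : Type := Metric.sphere (0 : WithLp 2 (ℂ × ℂ)) 1

abbrev closeTwist (X : Ported Bool) : Ported Empty :=
  X.assemble (Fin 0) {g | g ∈ [(.inl true, 3, .inl false, 1)]} Empty.elim

abbrev closeJoin (X : Ported Bool) : Ported Empty :=
  X.assemble (Fin 0) {g | g ∈ [(.inl true, 3, .inl false, perm4 2 0 1 3)]} Empty.elim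

theorem Equivalent.closeTwist {X Y : Ported Bool} (h : X ≈ₚ Y) : X.closeTwist ≈ₚ Y.closeTwist :=
  h.assemble (proper_of_list (by decide) (by decide))

theorem Equivalent.closeJoin {X Y : Ported Bool} (h : X ≈ₚ Y) : X.closeJoin ≈ₚ Y.closeJoin :=
  h.assemble (proper_of_list (by decide) (by decide))

/-- Consider a cycle of two snapped tetrahedra with one straight and one twisted gluing. Absorbing a
tetrahedron across the straight gluing leaves the twisted closure, across the twisted gluing the
straight closure. -/
theorem closeTwist_snap : snap.closeTwist ≈ₚ snap.closeJoin := by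
  refine (joinSnap_snap.symm.closeTwist.trans ?_).trans twistSnap_snap.closeJoin
  exact Lists.relabel ((lists_snap.assemble _ _ _).assemble _ _ _)
    ((lists_snap.assemble _ _ _).assemble _ _ _) (Sum.map Sum.swap id) (fun _ => 1)
    (by decide +kernel)

/-- A tetrahedron is the join of its opposite edges `12` and `03`; the two folds close these edges
into circles. The masses on the edges become squared moduli, which makes the image the unit sphere.
-/
noncomputable def sphereMap (x : Tet) : WithLp 2 (ℂ × ℂ) :=
  WithLp.toLp 2 (circlePoint (x.1 1) (x.1 2), circlePoint (x.1 0) (x.1 3))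

theorem continuous_sphereMap : Continuous sphereMap := by
  refine (WithLp.prod_continuous_toLp 2 ℂ ℂ).comp (Continuous.prodMk ?_ ?_)
  · exact continuous_circlePoint.comp ((continuous_coord 1).prodMk (continuous_coord 2))
  · exact continuous_circlePoint.comp ((continuous_coord 0).prodMk (continuous_coord 3))

theorem norm_sphereMap (x : Tet) : ‖sphereMap x‖ = 1 := by
  have h0 := Tet.nonneg x 0
  have h1 := Tet.nonneg x 1
  have h2 := Tet.nonneg x 2
  have h3 := Tet.nonneg x 3
  rw [WithLp.prod_norm_eq_of_L2]
  change √(‖circlePoint (x.1 1) (x.1 2)‖ ^ 2 + ‖circlePoint (x.1 0) (x.1 3)‖ ^ 2) = 1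
  rw [norm_circlePoint, norm_circlePoint]
  rw [Real.sq_sqrt (by positivity), Real.sq_sqrt (by positivity), Real.sqrt_eq_one]
  linarith [sum_coord x]

/-- A tetrahedron with two pairs of faces folded together along opposite edges. -/
abbrev twoFolds : Ported Empty where
  Cell := Unit
  pairing := {g | g ∈ [((), 1, (), swap 1 2), ((), 3, (), swap 0 3)]}
  port := Empty.elim

theorem closeJoin_snap : snap.closeJoin ≈ₚ twoFolds :=
  Lists.relabel (lists_snap.assemble _ _ _) (Y := twoFolds) (fun _ => Iff.rfl) (fun _ => ())
    (fun _ => 1) (by decide +kernel)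

theorem twoFolds_pt_swap {i j : Fin 4} (h : (((), i, (), swap i j) : Pairing Unit) ∈
    [((), 1, (), swap 1 2), ((), 3, (), swap 0 3)] ∨ (((), j, (), swap i j) : Pairing Unit) ∈
    [((), 1, (), swap 1 2), ((), 3, (), swap 0 3)]) {x : Tet} (hx : x.1 i = 0 ∨ x.1 j = 0) :
    twoFolds.pt () (act (swap i j) x) = twoFolds.pt () x := by
  rcases h with h | h
  · rcases hx with hx | hx
    · exact (pt_eq (X := twoFolds) h hx).symm
    · have := pt_eq_symm (X := twoFolds) h (x := x) (by simpa using hx)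
      rw [swap_inv] at this
      exact this.symm
  · rcases hx with hx | hx
    · have := pt_eq_symm (X := twoFolds) h (x := x) (by simpa using hx)
      rw [swap_inv] at this
      exact this.symm
    · exact (pt_eq (X := twoFolds) h hx).symm

theorem sphereMap_inj {x y : Tet} (h : sphereMap x = sphereMap y) :
    twoFolds.pt () x = twoFolds.pt () y := by
  have h1 : circlePoint (x.1 1) (x.1 2) = circlePoint (y.1 1) (y.1 2) :=
    congrArg (fun z => z.fst) h
  have h2 : circlePoint (x.1 0) (x.1 3) = circlePoint (y.1 0) (y.1 3) :=
    congrArg (fun z => z.snd) h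
  have e1 := circlePoint_eq (Tet.nonneg x 1) (Tet.nonneg x 2) (Tet.nonneg y 1) (Tet.nonneg y 2) h1
  have e2 := circlePoint_eq (Tet.nonneg x 0) (Tet.nonneg x 3) (Tet.nonneg y 0) (Tet.nonneg y 3) h2
  have s1 : ∀ z : Tet, z.1 1 = 0 ∨ z.1 2 = 0 →
      twoFolds.pt () (act (swap 1 2) z) = twoFolds.pt () z := fun z hz =>
    twoFolds_pt_swap (by decide) hz
  have s2 : ∀ z : Tet, z.1 0 = 0 ∨ z.1 3 = 0 →
      twoFolds.pt () (act (swap 0 3) z) = twoFolds.pt () z := fun z hz =>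
    twoFolds_pt_swap (by decide) hz
  rcases e1 with ⟨a, b⟩ | ⟨c, a, b⟩ <;> rcases e2 with ⟨a', b'⟩ | ⟨c', a', b'⟩
  · have : y = x := ext_val fun v => by fin_cases v <;> assumption
    rw [this]
  · have : y = act (swap 0 3) x := ext_val fun v => by
      fin_cases v <;> simpa [swap_apply_def]
    rw [this, s2 x c']
  · have : y = act (swap 1 2) x := ext_val fun v => by
      fin_cases v <;> simpa [swap_apply_def]
    rw [this, s1 x c]
  · have : y = act (swap 1 2) (act (swap 0 3) x) := ext_val fun v => by
      fin_cases v <;> simpa [swap_apply_def]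
    rw [this, s1 _ (by simpa [swap_apply_def] using c), s2 x c']

theorem sphereMap_surj {z : WithLp 2 (ℂ × ℂ)} (hz : ‖z‖ = 1) : ∃ x, sphereMap x = z := by
  obtain ⟨a, b, ha, hb, hab, h1⟩ := exists_circlePoint_eq z.fst
  obtain ⟨c, d, hc, hd, hcd, h2⟩ := exists_circlePoint_eq z.snd
  have hs : a + b + (c + d) = 1 := by
    rw [hab, hcd, ← WithLp.prod_norm_sq_eq_of_L2, hz, one_pow]
  refine ⟨⟨![c, a, b, d], fun v => ?_, ?_⟩, ?_⟩
  · fin_cases v <;> assumption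
  · simp [Fin.sum_univ_four]; linarith
  · have : z = WithLp.toLp 2 (z.fst, z.snd) := rfl
    rw [this, ← h1, ← h2]
    rfl

theorem twoFolds_homeomorph : Nonempty (twoFolds.Space ≃ₜ Sphere) := by
  have hg : ∀ t i u τ, ((t, i, u, τ) : Pairing Unit) ∈ twoFolds.pairing → ∀ x : Tet, x.1 i = 0 →
      sphereMap x = sphereMap (act τ x) := by
    intro t i u τ h x hx
    replace h : ((t, i, u, τ) : Pairing Unit) ∈
      [((), 1, (), swap 1 2), ((), 3, (), swap 0 3)] := h
    simp only [List.mem_cons, List.not_mem_nil, Prod.mk.injEq, or_false] at h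
    rcases h with ⟨-, rfl, -, rfl⟩ | ⟨-, rfl, -, rfl⟩
    · simp [sphereMap, swap_apply_def, hx, circlePoint_zero_left]
    · simp [sphereMap, swap_apply_def, hx, circlePoint_zero_left]
  let f : twoFolds.Space → Sphere := twoFolds.desc
    (fun _ x => ⟨sphereMap x, by simpa using norm_sphereMap x⟩)
    fun t i u τ h x hx => Subtype.ext (hg t i u τ h x hx)
  have hf : Continuous f := continuous_desc _ _ _ fun _ => continuous_sphereMap.subtype_mk _
  have hb : f.Bijective := by
    constructor
    · rintro ⟨t, x⟩ ⟨u, y⟩ h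
      exact sphereMap_inj (congrArg Subtype.val h)
    · rintro ⟨z, hz⟩
      obtain ⟨x, hx⟩ := sphereMap_surj (z := z) (by simpa using hz)
      exact ⟨twoFolds.pt () x, Subtype.ext hx⟩
  exact ⟨(show Continuous (Equiv.ofBijective f hb) from hf).homeoOfEquivCompactToT2⟩

end Ported

/-- Spaces homeomorphic to the three-sphere. -/
theorem closedThreeManifold_of_homeomorph {X : Type} [TopologicalSpace X] (e : X ≃ₜ Ported.Sphere) :
    IsClosedThreeManifold X ∧ ConnectedSpace X := by
  have hdim : Module.finrank ℝ (WithLp 2 (ℂ × ℂ)) = 3 + 1 := by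
    rw [(WithLp.linearEquiv 2 ℝ (ℂ × ℂ)).finrank_eq, Module.finrank_prod,
      Complex.finrank_real_complex]
  have : Fact (Module.finrank ℝ (WithLp 2 (ℂ × ℂ)) = 3 + 1) := ⟨hdim⟩
  have hconn : ConnectedSpace Ported.Sphere := by
    rw [← isConnected_iff_connectedSpace]
    refine isConnected_sphere ?_ 0 zero_le_one
    rw [← Module.finrank_eq_rank, hdim]
    norm_num
  have := FiniteDimensional.proper_real (WithLp 2 (ℂ × ℂ))
  refine ⟨⟨e.symm.compactSpace, e.symm.t2Space, ⟨?_⟩⟩,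
    e.symm.surjective.connectedSpace e.symm.continuous⟩
  exact e.symm.chartedSpace

namespace Ported

variable {E E' : Type}

theorem Equivalent.joinSnap_snap {X : Ported Bool} (h : X ≈ₚ snap) : X.joinSnap ≈ₚ snap :=
  h.joinSnap.trans Ported.joinSnap_snap

theorem Equivalent.twistSnap_snap {X : Ported Bool} (h : X ≈ₚ snap) : X.twistSnap ≈ₚ snap :=
  h.twistSnap.trans Ported.twistSnap_snap

theorem Equivalent.joinCap_snap {X : Ported Bool} (h : X ≈ₚ snap) : X.joinCap ≈ₚ snap :=
  h.joinCap.trans Ported.joinCap_snap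

theorem Equivalent.closeTwist_sphere {X : Ported Bool} (h : X ≈ₚ snap) :
    Nonempty (X.closeTwist.Space ≃ₜ Sphere) := by
  obtain ⟨e, -⟩ := h.closeTwist.trans (closeTwist_snap.trans closeJoin_snap)
  obtain ⟨f⟩ := twoFolds_homeomorph
  exact ⟨e.trans f⟩

/-! ### Bookkeeping: every face is a port or is paired exactly once -/

/-- The pairings and their reverses. -/
def sides {T : Type} (P : Set (Pairing T)) : Set (Pairing T) := {g | g ∈ P ∨ revPairing g ∈ P}

/-- The face from which a pairing starts. -/
def face {T : Type} (g : Pairing T) : T × Fin 4 := (g.1, g.2.1)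

theorem revPairing_mem_sides {T : Type} {P : Set (Pairing T)} {g : Pairing T} (h : g ∈ sides P) :
    revPairing g ∈ sides P := by
  rcases h with h | h
  · right; rwa [revPairing_revPairing]
  · exact .inl h

/-- The face of a port. -/
def portFace {T : Type} (q : E → T × Perm (Fin 4)) (e : E) : T × Fin 4 := ((q e).1, (q e).2 3)

/-- Every face in `A` is a port or is paired, in exactly one way. -/
structure Tidy {T : Type} (P : Set (Pairing T)) (q : E → T × Perm (Fin 4))
    (A : Set (T × Fin 4)) : Prop where
  cover : ∀ a ∈ A, (∃ e, portFace q e = a) ∨ ∃ g ∈ sides P, face g = a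
  unique : ∀ g ∈ sides P, ∀ g' ∈ sides P, face g = face g' → g = g'
  ne_port : ∀ g ∈ sides P, ∀ e, face g ≠ portFace q e
  inj : (portFace q).Injective
  ne : ∀ g ∈ sides P, face (revPairing g) ≠ face g

/-- The faces available to the outer cells and ports of an assembly. -/
def available (E C : Type) : Set ((E ⊕ C) × Fin 4) := {a | a.1.isLeft → a.2 = 3}

def placeFace (X : Ported E) (C : Type) (a : (E ⊕ C) × Fin 4) : (X.Cell ⊕ C) × Fin 4 :=
  ((X.place C a.1).1, (X.place C a.1).2 a.2)

theorem placeFace_injOn {X : Ported E} (hX : (portFace X.port).Injective) (C : Type) :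
    Set.InjOn (X.placeFace C) (available E C) := by
  rintro ⟨e | c, i⟩ h ⟨e' | c', i'⟩ h' hh
  · obtain rfl : i = 3 := h rfl
    obtain rfl : i' = 3 := h' rfl
    simp only [placeFace, place, Prod.mk.injEq, Sum.inl.injEq] at hh
    rw [hX (Prod.ext hh.1 hh.2)]
  · simp [placeFace, place] at hh
  · simp [placeFace, place] at hh
  · simp only [placeFace, place, Prod.mk.injEq, Sum.inr.injEq, Perm.coe_one, id] at hh
    rw [hh.1, hh.2]

theorem revPairing_pushPairing (X : Ported E) (C : Type) (g : Pairing (E ⊕ C)) :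
    revPairing (X.pushPairing C g) = X.pushPairing C (revPairing g) := by
  simp [pushPairing, revPairing, mul_assoc]

theorem revPairing_inlPairing {A : Type} (C : Type) (g : Pairing A) :
    revPairing (inlPairing C g) = inlPairing C (revPairing g) := rfl

theorem face_inlPairing {A : Type} (C : Type) (g : Pairing A) :
    face (inlPairing C g) = (.inl (face g).1, (face g).2) := rfl

theorem mem_sides_assemble {X : Ported E} {C : Type} {P : Set (Pairing (E ⊕ C))}
    {g : Pairing (X.Cell ⊕ C)} :
    g ∈ sides (inlPairing C '' X.pairing ∪ X.pushPairing C '' P) ↔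
      (∃ g' ∈ sides X.pairing, inlPairing C g' = g) ∨ ∃ g' ∈ sides P, X.pushPairing C g' = g := by
  constructor
  · rintro ((⟨g', h, rfl⟩ | ⟨g', h, rfl⟩) | (⟨g', h, h'⟩ | ⟨g', h, h'⟩))
    · exact .inl ⟨g', .inl h, rfl⟩
    · exact .inr ⟨g', .inl h, rfl⟩
    · refine .inl ⟨revPairing g', revPairing_mem_sides (.inl h), ?_⟩
      rw [← revPairing_inlPairing, h', revPairing_revPairing]
    · refine .inr ⟨revPairing g', revPairing_mem_sides (.inl h), ?_⟩
      rw [← revPairing_pushPairing, h', revPairing_revPairing]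
  · rintro (⟨g', h | h, rfl⟩ | ⟨g', h | h, rfl⟩)
    · exact .inl (.inl ⟨_, h, rfl⟩)
    · exact .inr (.inl ⟨_, h, revPairing_inlPairing _ _⟩)
    · exact .inl (.inr ⟨_, h, rfl⟩)
    · exact .inr (.inr ⟨_, h, (revPairing_pushPairing _ _ _).symm⟩)

/-- The available faces embed into the assembly because the ports of `X` are distinct, and they
avoid the faces already paired in `X`. So tidiness splits into that of `X` and a condition on the
new pairings alone, which is a finite check even for an arbitrary piece `X`. -/
theorem Tidy.assemble {X : Ported E} (hX : Tidy X.pairing X.port Set.univ) {C : Type}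
    [TopologicalSpace C] [DiscreteTopology C] [Finite C] {P : Set (Pairing (E ⊕ C))}
    {p : E' → (E ⊕ C) × Perm (Fin 4)} (hP : Tidy P p (available E C)) (h : Proper P p) :
    Tidy (X.assemble C P p).pairing (X.assemble C P p).port Set.univ := by
  have inj := placeFace_injOn hX.inj C
  have hport : ∀ e, portFace (X.assemble C P p).port e = X.placeFace C (portFace p e) :=
    fun _ => rfl
  have av : ∀ g ∈ sides P, face g ∈ available E C := by
    rintro ⟨u | c, i, v, τ⟩ (hg | hg) hl
    · exact h.left _ _ _ _ hg
    · have := h.right _ _ _ _ hg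
      change i = 3
      simpa using this
    · simp [face] at hl
    · simp [face] at hl
  have avp : ∀ e, portFace p e ∈ available E C := by
    intro e hl
    rcases hp : p e with ⟨u | c, σ⟩
    · simpa [portFace, hp] using h.port _ _ _ hp
    · simp [portFace, hp] at hl
  have sep : ∀ g ∈ sides X.pairing, ∀ a ∈ available E C,
      face (inlPairing C g) ≠ X.placeFace C a := by
    rintro g hg ⟨e | c, i⟩ ha hh
    · obtain rfl : i = 3 := ha rfl
      simp only [face_inlPairing, placeFace, place, Prod.mk.injEq, Sum.inl.injEq] at hh
      exact hX.ne_port g hg e (Prod.ext hh.1 hh.2)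
    · simp [face_inlPairing, placeFace, place] at hh
  have fi : ∀ g g' : Pairing X.Cell, face (inlPairing C g) = face (inlPairing C g') →
      face g = face g' := by
    intro g g' hh
    simp only [face_inlPairing, Prod.mk.injEq, Sum.inl.injEq] at hh
    exact Prod.ext hh.1 hh.2
  have cov : ∀ a ∈ available E C, (∃ e, portFace (X.assemble C P p).port e = X.placeFace C a) ∨
      ∃ g ∈ sides (X.assemble C P p).pairing, face g = X.placeFace C a := by
    intro a ha
    rcases hP.cover a ha with ⟨e, rfl⟩ | ⟨g, hg, rfl⟩
    · exact .inl ⟨e, rfl⟩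
    · exact .inr ⟨_, mem_sides_assemble.2 (.inr ⟨g, hg, rfl⟩), rfl⟩
  refine ⟨?_, ?_, ?_, ?_, ?_⟩
  · rintro ⟨t | c, i⟩ -
    · rcases hX.cover (t, i) trivial with ⟨e, he⟩ | ⟨g, hg, he⟩
      · have := cov (.inl e, 3) fun _ => rfl
        have h2 : X.placeFace C (.inl e, 3) = (.inl t, i) := by
          simp only [portFace, Prod.mk.injEq] at he
          simp [placeFace, place, he]
        rwa [h2] at this
      · refine .inr ⟨_, mem_sides_assemble.2 (.inl ⟨g, hg, rfl⟩), ?_⟩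
        rw [face_inlPairing, he]
    · exact cov (.inr c, i) (by simp [available])
  · intro g hg g' hg' hh
    rcases mem_sides_assemble.1 hg with ⟨k, hk, rfl⟩ | ⟨k, hk, rfl⟩ <;>
      rcases mem_sides_assemble.1 hg' with ⟨k', hk', rfl⟩ | ⟨k', hk', rfl⟩
    · rw [hX.unique k hk k' hk' (fi _ _ hh)]
    · exact (sep k hk _ (av _ hk') hh).elim
    · exact (sep k' hk' _ (av _ hk) hh.symm).elim
    · rw [hP.unique k hk k' hk' (inj (av _ hk) (av _ hk') hh)]
  · intro g hg e hh
    rw [hport] at hh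
    rcases mem_sides_assemble.1 hg with ⟨k, hk, rfl⟩ | ⟨k, hk, rfl⟩
    · exact sep k hk _ (avp e) hh
    · exact hP.ne_port k hk e (inj (av _ hk) (avp e) hh)
  · intro e e' hh
    exact hP.inj (inj (avp e) (avp e') hh)
  · intro g hg hh
    rcases mem_sides_assemble.1 hg with ⟨k, hk, rfl⟩ | ⟨k, hk, rfl⟩
    · exact hX.ne k hk (fi _ _ hh)
    · rw [revPairing_pushPairing] at hh
      exact hP.ne k hk (inj (av _ (revPairing_mem_sides hk)) (av _ hk) hh)

theorem tidy_of_list {T : Type} {L : List (Pairing T)} {q : E → T × Perm (Fin 4)}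
    {A : Set (T × Fin 4)}
    (h₁ : ∀ a ∈ A, (∃ e, portFace q e = a) ∨ ∃ g ∈ L ++ L.map revPairing, face g = a)
    (h₂ : ∀ g ∈ L ++ L.map revPairing, ∀ g' ∈ L ++ L.map revPairing, g = g' ∨ face g ≠ face g')
    (h₃ : ∀ g ∈ L ++ L.map revPairing, ∀ e, face g ≠ portFace q e)
    (h₄ : (portFace q).Injective)
    (h₅ : ∀ g ∈ L ++ L.map revPairing, face (revPairing g) ≠ face g) : Tidy {g | g ∈ L} q A := by
  have key : ∀ g, g ∈ sides {g | g ∈ L} ↔ g ∈ L ++ L.map revPairing := by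
    intro g
    rw [List.mem_append, List.mem_map]
    refine or_congr Iff.rfl ⟨fun h => ⟨_, h, revPairing_revPairing g⟩, ?_⟩
    rintro ⟨g', h, rfl⟩
    change revPairing (revPairing g') ∈ L
    rwa [revPairing_revPairing]
  refine ⟨fun a ha => ?_, fun g hg g' hg' hh =>
    (h₂ g ((key g).1 hg) g' ((key g').1 hg')).resolve_right (not_not_intro hh),
    fun g hg => h₃ g ((key g).1 hg), h₄, fun g hg => h₅ g ((key g).1 hg)⟩
  simp_rw [key]
  exact h₁ a ha

instance (E C : Type) (a) : Decidable (a ∈ available E C) :=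
  inferInstanceAs (Decidable (a.1.isLeft → a.2 = 3))

theorem tidy_snap : Tidy snap.pairing snap.port Set.univ :=
  tidy_of_list (T := Unit) (L := [((), 1, (), perm4 0 2 1 3)])
    (q := fun e : Bool => ((), if e then 1 else perm4 1 2 3 0)) (by decide) (by decide) (by decide) (by decide) (by decide)

theorem Tidy.joinSnap {X : Ported Bool} (h : Tidy X.pairing X.port Set.univ) :
    Tidy X.joinSnap.pairing X.joinSnap.port Set.univ :=
  h.assemble (tidy_of_list (by decide) (by decide) (by decide) (by decide) (by decide))
    (proper_of_list (by decide) (by decide))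

theorem Tidy.twistSnap {X : Ported Bool} (h : Tidy X.pairing X.port Set.univ) :
    Tidy X.twistSnap.pairing X.twistSnap.port Set.univ :=
  h.assemble (tidy_of_list (by decide) (by decide) (by decide) (by decide) (by decide))
    (proper_of_list (by decide) (by decide))

theorem Tidy.joinCap {X : Ported Bool} (h : Tidy X.pairing X.port Set.univ) :
    Tidy X.joinCap.pairing X.joinCap.port Set.univ :=
  h.assemble (tidy_of_list (by decide +kernel) (by decide +kernel) (by decide) (by decide)
    (by decide)) (proper_of_list (by decide) (by decide))

theorem Tidy.closeTwist {X : Ported Bool} (h : Tidy X.pairing X.port Set.univ) :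
    Tidy X.closeTwist.pairing X.closeTwist.port Set.univ :=
  h.assemble (tidy_of_list (by decide) (by decide) (by decide) (by decide) (by decide))
    (proper_of_list (by decide) (by decide))

end Ported

/-! ### Normal arcs, matching equations, and passage to `FaceGluing` -/

/-- The coordinates of one tetrahedron. -/
abbrev Discs : Type := Fin 4 ⊕ Fin 3

/-- The number of normal arcs cutting off vertex `v` in face `i`. -/
noncomputable def arcs (y : Discs → ℝ) (i v : Fin 4) : ℝ :=
  y (.inl v) + ∑ q : Fin 3, if quadMate q i = v then y (.inr q) else 0

namespace Ported

/-- The matching equations of a piece. -/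
def Matched {E : Type} (X : Ported E) (x : X.Cell → Discs → ℝ) : Prop :=
  ∀ g ∈ X.pairing, ∀ v ≠ g.2.1,
    arcs (x g.1) g.2.1 v = arcs (x g.2.2.1) (g.2.2.2 g.2.1) (g.2.2.2 v)

theorem Matched.sides {E : Type} {X : Ported E} {x : X.Cell → Discs → ℝ} (h : X.Matched x)
    {g : Pairing X.Cell} (hg : g ∈ sides X.pairing) {v : Fin 4} (hv : v ≠ g.2.1) :
    arcs (x g.1) g.2.1 v = arcs (x g.2.2.1) (g.2.2.2 g.2.1) (g.2.2.2 v) := by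
  rcases hg with hg | hg
  · exact h g hg v hv
  · have := h _ hg (g.2.2.2 v) (by simpa [revPairing] using hv)
    simpa [revPairing] using this.symm

/-- Without ports, tidiness attaches to each face exactly one pairing, read in one of its two
directions; these pairings are the data of the gluing. -/
theorem exists_faceGluing {n : ℕ} (X : Ported Empty) (hX : Tidy X.pairing X.port Set.univ)
    (e : X.Cell ≃ Fin n) : ∃ T : FaceGluing n, Nonempty (T.Space ≃ₜ X.Space) ∧
      ∀ x : DiscType n → ℝ, T.Matching x ↔ X.Matched fun t d => x (e t, d) := by
  have cover : ∀ a, ∃ g ∈ sides X.pairing, face g = a := fun a =>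
    (hX.cover a trivial).resolve_left fun ⟨e, _⟩ => e.elim
  choose g hg hf using cover
  have hg' : ∀ k ∈ sides X.pairing, g (face k) = k := fun k hk => hX.unique _ (hg _) _ hk (hf _)
  have h1 : ∀ a, (g a).1 = a.1 := fun a => congrArg Prod.fst (hf a)
  have h2 : ∀ a, (g a).2.1 = a.2 := fun a => congrArg Prod.snd (hf a)
  -- By uniqueness the pairing chosen at the partner face is the reversed one; this yields the
  -- involution laws below.
  have hrev : ∀ a, g ((g a).2.2.1, (g a).2.2.2 a.2) = revPairing (g a) := fun a => by
    rw [← hg' _ (revPairing_mem_sides (hg a))]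
    simp [face, revPairing, h2]
  let T : FaceGluing n :=
    { nbr := fun t i => e (g (e.symm t, i)).2.2.1
      glue := fun t i => (g (e.symm t, i)).2.2.2
      nbr_nbr := fun t i => by
        rw [e.symm_apply_apply]
        rw [hrev (e.symm t, i)]
        simp [revPairing, h1]
      glue_glue := fun t i => by
        rw [e.symm_apply_apply]
        rw [hrev (e.symm t, i)]
        simp [revPairing]
      ne_self := fun t i hh => by
        refine hX.ne _ (hg (e.symm t, i)) ?_
        rw [hf]
        simp only [Prod.mk.injEq] at hh
        refine Prod.ext ?_ ?_
        · change (g (e.symm t, i)).2.2.1 = e.symm t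
          exact e.injective (by rw [e.apply_symm_apply]; exact hh.1)
        · simpa [face, revPairing, h2] using hh.2 }
  have hT : ∀ t i, (e.symm t, i, e.symm (T.nbr t i), T.glue t i) ∈ sides X.pairing := fun t i => by
    have : (e.symm t, i, e.symm (T.nbr t i), T.glue t i) = g (e.symm t, i) :=
      Prod.ext (h1 (e.symm t, i)).symm (Prod.ext (h2 (e.symm t, i)).symm
        (Prod.ext (e.symm_apply_apply _) rfl))
    rw [this]
    exact hg _
  have hT' : ∀ t i u τ, (t, i, u, τ) ∈ sides X.pairing → T.nbr (e t) i = e u ∧ T.glue (e t) i = τ := by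
    intro t i u τ h
    have := hg' _ h
    simp only [face] at this
    simp [T, this]
  refine ⟨T, ⟨?_⟩, fun x => ⟨fun h => ?_, fun h => ?_⟩⟩
  · let φ : T.Space → X.Space := Quot.lift (fun a => X.pt (e.symm a.1) a.2) (by
      rintro ⟨t, x⟩ ⟨u, y⟩ ⟨i, hx, hu, hy⟩
      dsimp only at hx hu hy ⊢
      have hy : y = act (T.glue t i) x := ext_val fun v => by
        rw [act_val, ← hy]; simp
      subst hu hy
      rcases hT t i with h | h
      · exact pt_eq h hx
      · rw [pt_eq_symm h (by simpa using hx)]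
        simp)
    let ψ : X.Space → T.Space := X.desc (fun t x => Quot.mk _ (e t, x)) (by
      intro t i u τ h x hx
      refine Quot.sound ⟨i, hx, ?_, ?_⟩
      · exact (hT' t i u τ (.inl h)).1.symm
      · intro v
        dsimp only
        rw [(hT' t i u τ (.inl h)).2, act_apply])
    have hφ : Continuous φ := continuous_quot_lift _
      (continuous_prod_of_discrete_left.2 fun t => X.continuous_pt (e.symm t))
    have hψ : Continuous ψ := X.continuous_desc _ _ fun t =>
      continuous_quot_mk.comp (Continuous.prodMk_right (e t))
    refine ⟨⟨φ, ψ, ?_, ?_⟩, hφ, hψ⟩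
    · rintro ⟨t, x⟩
      change Quot.mk _ (e (e.symm t), x) = _
      rw [e.apply_symm_apply]
    · refine ind fun t x => ?_
      change X.pt (e.symm (e t)) x = _
      rw [e.symm_apply_apply]
  · rintro ⟨t, i, u, τ⟩ hk v hv
    have := h (e t) i v hv
    rw [(hT' t i u τ (.inl hk)).1, (hT' t i u τ (.inl hk)).2] at this
    exact this
  · intro t i v hv
    have := h.sides (hT t i) hv
    simp only [e.apply_symm_apply] at this
    exact this

/-- A closed-up piece equivalent to a snapped tetrahedron gives a triangulated three-sphere. -/
theorem exists_manifold_faceGluing {n : ℕ} (X : Ported Bool)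
    (hX : Tidy X.pairing X.port Set.univ) (h : X ≈ₚ snap) (e : X.closeTwist.Cell ≃ Fin n) :
    ∃ T : FaceGluing n, T.IsClosedThreeManifoldTriangulation ∧ ConnectedSpace T.Space ∧
      ∀ x : DiscType n → ℝ, T.Matching x ↔ X.closeTwist.Matched fun t d => x (e t, d) := by
  obtain ⟨T, ⟨f⟩, hT⟩ := exists_faceGluing X.closeTwist hX.closeTwist e
  obtain ⟨k⟩ := h.closeTwist_sphere
  obtain ⟨h1, h2⟩ := closedThreeManifold_of_homeomorph (f.trans k)
  exact ⟨T, h1, h2, hT⟩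

end Ported

@[simp] theorem perm4_apply (a b c d : Fin 4) (h) (v : Fin 4) :
    perm4 a b c d h v = ![a, b, c, d] v := rfl

/-! ### Admissible solutions in a snapped tetrahedron and in a cap -/

/-- At most one quadrilateral coordinate is nonzero. -/
def QuadOne (y : Discs → ℝ) : Prop := ∀ q q', y (.inr q) ≠ 0 → y (.inr q') ≠ 0 → q = q'

/-- A snapped tetrahedron with loop arcs `c` and apex arcs `a` and `b`. -/
def snapTet (c a b s : ℝ) : Discs → ℝ := Sum.elim ![b - s, c, c, a - s] ![0, 0, s]

/-- The outer tetrahedron of a cap. -/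
def outerTet (c b Q : ℝ) : Discs → ℝ := Sum.elim ![c - Q, c - Q, b, c] ![Q, 0, 0]

/-- The inner, folded tetrahedron of a cap. -/
def innerTet (c b Q q : ℝ) : Discs → ℝ :=
  Sum.elim ![b + Q - q, c + Q - q, c - Q, c - Q] ![q, 0, 0]

theorem arcs_eq (y : Discs → ℝ) (i v : Fin 4) : arcs y i v = y (.inl v) +
    ((if quadMate 0 i = v then y (.inr 0) else 0) + (if quadMate 1 i = v then y (.inr 1) else 0) +
      (if quadMate 2 i = v then y (.inr 2) else 0)) := by
  rw [arcs, Fin.sum_univ_three]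

theorem discs_ext {y z : Discs → ℝ} (h : ∀ v, y (.inl v) = z (.inl v))
    (h' : ∀ q, y (.inr q) = z (.inr q)) : y = z := funext (Sum.rec h h')

theorem quadOne_snapTet (c a b s : ℝ) : QuadOne (snapTet c a b s) := by
  intro q q'; fin_cases q <;> fin_cases q' <;> simp [snapTet]

theorem quadOne_outerTet (c b Q : ℝ) : QuadOne (outerTet c b Q) := by
  intro q q'; fin_cases q <;> fin_cases q' <;> simp [outerTet]

theorem quadOne_innerTet (c b Q q : ℝ) : QuadOne (innerTet c b Q q) := by
  intro q q'; fin_cases q <;> fin_cases q' <;> simp [innerTet]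

theorem QuadOne.eq_zero {y : Discs → ℝ} (h : QuadOne y) {q q' : Fin 3} (hq : q ≠ q')
    (hy : y (.inr q) = y (.inr q')) : y (.inr q) = 0 := by
  by_contra h0
  exact hq (h q q' h0 (hy ▸ h0))

theorem forall_ne_one {p : Fin 4 → Prop} : (∀ v ≠ 1, p v) ↔ p 0 ∧ p 2 ∧ p 3 :=
  ⟨fun h => ⟨h _ (by decide), h _ (by decide), h _ (by decide)⟩, fun h v hv => by
    fin_cases v <;> simp_all⟩

theorem forall_ne_two {p : Fin 4 → Prop} : (∀ v ≠ 2, p v) ↔ p 0 ∧ p 1 ∧ p 3 :=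
  ⟨fun h => ⟨h _ (by decide), h _ (by decide), h _ (by decide)⟩, fun h v hv => by
    fin_cases v <;> simp_all⟩

theorem forall_ne_three {p : Fin 4 → Prop} : (∀ v ≠ 3, p v) ↔ p 0 ∧ p 1 ∧ p 2 :=
  ⟨fun h => ⟨h _ (by decide), h _ (by decide), h _ (by decide)⟩, fun h v hv => by
    fin_cases v <;> simp_all⟩

/-- The fold exchanges quadrilateral types `0` and `1`, and matching at its fixed vertices makes
their coordinates equal; the quadrilateral constraint then forces both to vanish. It thereby becomes
a linear condition. -/
theorem snapTet_iff (y : Discs → ℝ) :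
    (QuadOne y ∧ ∀ v ≠ 1, arcs y 1 v = arcs y 2 (perm4 0 2 1 3 (by decide) v)) ↔
      ∃ c a b s, y = snapTet c a b s := by
  rw [forall_ne_one]
  constructor
  · rintro ⟨hq, h⟩
    simp [arcs_eq, quadMate] at h
    obtain ⟨h1, h2, -⟩ := h
    have h0 := hq.eq_zero (by decide) h1
    refine ⟨y (.inl 1), y (.inl 3) + y (.inr 2), y (.inl 0) + y (.inr 2), y (.inr 2),
      discs_ext (fun v => ?_) fun q => ?_⟩
    · fin_cases v <;> simp [snapTet, h2]
    · fin_cases q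
      · exact h0
      · exact h1 ▸ h0
      · rfl
  · rintro ⟨c, a, b, s, rfl⟩
    refine ⟨quadOne_snapTet c a b s, ?_⟩
    simp [arcs_eq, quadMate, snapTet]

/-- The fold kills types `1, 2` in the inner tetrahedron `z`. The equations across the two shared
faces and the last hypothesis make types `1, 2` equal in `y`, so they vanish there too. That
hypothesis says that the two loop vertices of the entry face see equally many arcs. -/
theorem capTet_iff (y z : Discs → ℝ) :
    (QuadOne y ∧ QuadOne z ∧
      (∀ v ≠ 2, arcs y 2 v = arcs z 0 (perm4 2 3 0 1 (by decide) v)) ∧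
      (∀ v ≠ 3, arcs y 3 v = arcs z 1 (perm4 2 3 0 1 (by decide) v)) ∧
      (∀ v ≠ 2, arcs z 2 v = arcs z 3 (perm4 0 1 3 2 (by decide) v)) ∧
      arcs y 1 0 = arcs y 1 3) ↔
      ∃ c b Q q, y = outerTet c b Q ∧ z = innerTet c b Q q := by
  rw [forall_ne_two, forall_ne_three, forall_ne_two]
  constructor
  · rintro ⟨hy, hz, h1, h2, h3, h4⟩
    simp [arcs_eq, quadMate] at h1 h2 h3 h4
    obtain ⟨h31, -, h33⟩ := h3
    have z1 := hz.eq_zero (by decide) h31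
    have z2 : z (.inr 2) = 0 := h31 ▸ z1
    obtain ⟨h11, h12, h13⟩ := h1
    obtain ⟨h21, h22, h23⟩ := h2
    have y1 := hy.eq_zero (q := 1) (q' := 2) (by decide) (by linarith)
    have y2 : y (.inr 2) = 0 := by linarith
    refine ⟨y (.inl 3), y (.inl 2), y (.inr 0), z (.inr 0), discs_ext (fun v => ?_) fun q => ?_,
      discs_ext (fun v => ?_) fun q => ?_⟩
    · fin_cases v <;> simp [outerTet] <;> linarith
    · fin_cases q <;> simp [outerTet, y1, y2]
    · fin_cases v <;> simp [innerTet] <;> linarith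
    · fin_cases q <;> simp [innerTet, z1, z2]
  · rintro ⟨c, b, Q, q, rfl, rfl⟩
    refine ⟨quadOne_outerTet c b Q, quadOne_innerTet c b Q q, ?_⟩
    simp [arcs_eq, quadMate, outerTet, innerTet]

namespace Ported

variable {E E' : Type}

/-- The arcs in a port or in a face of an outer cell. -/
noncomputable def placeArcs (X : Ported E) (C : Type) (x : X.Cell ⊕ C → Discs → ℝ) (u : E ⊕ C)
    (i v : Fin 4) : ℝ :=
  arcs (x (X.place C u).1) ((X.place C u).2 i) ((X.place C u).2 v)

/-- The arcs in a port. -/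
noncomputable def portArcs (X : Ported E) (x : X.Cell → Discs → ℝ) (e : E) (v : Fin 4) : ℝ :=
  arcs (x (X.port e).1) ((X.port e).2 3) ((X.port e).2 v)

theorem matched_assemble {X : Ported E} {C : Type} [TopologicalSpace C] [DiscreteTopology C]
    [Finite C] {P : Set (Pairing (E ⊕ C))} {p : E' → (E ⊕ C) × Perm (Fin 4)}
    (x : X.Cell ⊕ C → Discs → ℝ) :
    (X.assemble C P p).Matched x ↔ X.Matched (fun t => x (.inl t)) ∧
      ∀ g ∈ P, ∀ v ≠ g.2.1, X.placeArcs C x g.1 g.2.1 v =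
        X.placeArcs C x g.2.2.1 (g.2.2.2 g.2.1) (g.2.2.2 v) := by
  constructor
  · intro h
    refine ⟨fun g hg => h _ (.inl ⟨g, hg, rfl⟩), fun g hg v hv => ?_⟩
    have := h _ (.inr ⟨g, hg, rfl⟩) ((X.place C g.1).2 v) (by simpa [pushPairing] using hv)
    simpa [pushPairing, placeArcs] using this
  · rintro ⟨h1, h2⟩ _ (⟨g, hg, rfl⟩ | ⟨g, hg, rfl⟩) v hv
    · exact h1 g hg v hv
    · have := h2 g hg ((X.place C g.1).2⁻¹ v) (by
        rintro hh
        apply hv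
        simp [pushPairing, ← hh])
      simpa [pushPairing, placeArcs] using this

end Ported

open Ported

/-! ### Chains as words, and how solutions propagate along them -/

/-- Pieces built from snapped tetrahedra and caps. -/
inductive Word
  | snap
  | twist (w : Word)
  | join (w : Word)
  | cap (w : Word)

namespace Word

/-- The piece described by a word. -/
@[reducible] def ported : Word → Ported Bool
  | snap => Ported.snap
  | twist w => w.ported.twistSnap
  | join w => w.ported.joinSnap
  | cap w => w.ported.joinCap

theorem ported_equivalent (w : Word) : w.ported ≈ₚ Ported.snap := by
  induction w with
  | snap => exact Equivalent.refl _
  | twist w ih => exact ih.twistSnap_snap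
  | join w ih => exact ih.joinSnap_snap
  | cap w ih => exact ih.joinCap_snap

theorem tidy_ported (w : Word) : Tidy w.ported.pairing w.ported.port Set.univ := by
  induction w with
  | snap => exact tidy_snap
  | twist w ih => exact ih.twistSnap
  | join w ih => exact ih.joinSnap
  | cap w ih => exact ih.joinCap

/-- Solutions of the matching equations and the quadrilateral constraints with loop arcs `c`, and
apex arcs `a` at the first and `b` at the last face. -/
def Flow : (w : Word) → ℝ → ℝ → ℝ → (w.ported.Cell → Discs → ℝ) → Prop
  | snap, c, a, b, x => ∃ s, x () = snapTet c a b s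
  | twist w, c, a, b, x => w.Flow c a c (fun t => x (Sum.inl t)) ∧
      ∃ s, x (Sum.inr ()) = snapTet c c b s
  | join w, c, a, b, x => ∃ d, w.Flow c a d (fun t => x (Sum.inl t)) ∧
      ∃ s, x (Sum.inr ()) = snapTet c d b s
  | cap w, c, a, b, x => w.Flow c a b (fun t => x (Sum.inl t)) ∧
      ∃ Q q, x (Sum.inr false) = outerTet c b Q ∧ x (Sum.inr true) = innerTet c b Q q

/-- This makes `Flow` composable: a neighbour sees only `c` and the apex number of the adjacent end.
The apex has label `2` in the first port and label `0` in the last. -/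
theorem Flow.portArcs {w : Word} {c a b : ℝ} {x : w.ported.Cell → Discs → ℝ} (h : w.Flow c a b x) :
    (w.ported.portArcs x false 0 = c ∧ w.ported.portArcs x false 1 = c ∧
      w.ported.portArcs x false 2 = a) ∧
    (w.ported.portArcs x true 0 = b ∧ w.ported.portArcs x true 1 = c ∧
      w.ported.portArcs x true 2 = c) := by
  induction w generalizing b with
  | snap =>
    obtain ⟨s, hs⟩ := h
    simp only [Ported.portArcs]
    simp [arcs_eq, quadMate, hs]
    simp [snapTet]
  | twist w ih =>
    obtain ⟨h, s, hs⟩ := h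
    refine ⟨(ih h).1, ?_⟩
    change arcs (x (.inr ())) _ _ = _ ∧ arcs (x (.inr ())) _ _ = _ ∧ arcs (x (.inr ())) _ _ = _
    rw [hs]
    simp [snapEnds, place, arcs_eq, quadMate, snapTet]
  | join w ih =>
    obtain ⟨d, h, s, hs⟩ := h
    refine ⟨(ih h).1, ?_⟩
    change arcs (x (.inr ())) _ _ = _ ∧ arcs (x (.inr ())) _ _ = _ ∧ arcs (x (.inr ())) _ _ = _
    rw [hs]
    simp [snapEnds, place, arcs_eq, quadMate, snapTet]
  | cap w ih =>
    obtain ⟨h, Q, q, hs, -⟩ := h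
    refine ⟨(ih h).1, ?_⟩
    change arcs (x (.inr false)) _ _ = _ ∧ arcs (x (.inr false)) _ _ = _ ∧
      arcs (x (.inr false)) _ _ = _
    rw [hs]
    simp [capEnds, place, arcs_eq, quadMate, outerTet]

theorem flow_of_matched (w : Word) (x : w.ported.Cell → Discs → ℝ) (h : w.ported.Matched x)
    (hq : ∀ t, QuadOne (x t)) : ∃ c a b, w.Flow c a b x := by
  induction w with
  | snap =>
    have := h ((), 1, (), perm4 0 2 1 3) (List.mem_singleton.2 rfl)
    obtain ⟨c, a, b, s, hs⟩ := (snapTet_iff (x ())).1 ⟨hq (), this⟩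
    exact ⟨c, a, b, s, hs⟩
  | twist w ih =>
    obtain ⟨h, h'⟩ := (matched_assemble x).1 h
    obtain ⟨c, a, b, hF⟩ := ih _ h fun t => hq _
    have h1 := h' (.inr (), 1, .inr (), perm4 0 2 1 3) (by simp [twistPairings])
    have h2 := h' (.inl true, 3, .inr (), perm4 1 2 3 0) (by simp [twistPairings])
    obtain ⟨c', a', b', s, hs⟩ := (snapTet_iff (x (.inr ()))).1 ⟨hq _, h1⟩
    obtain ⟨p0, p1, p2⟩ := hF.portArcs.2
    replace h2 : ∀ v ≠ 3, w.ported.portArcs (fun t => x (.inl t)) true v =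
      arcs (x (.inr ())) 0 (perm4 1 2 3 0 (by decide) v) := h2
    rw [forall_ne_three, p0, p1, p2, hs] at h2
    simp [arcs_eq, quadMate, snapTet] at h2
    -- The twist puts the apex on either side against a loop vertex on the other, so both apex
    -- numbers equal `c`.
    obtain ⟨rfl, rfl, rfl⟩ := h2
    exact ⟨c, a, b', hF, s, hs⟩
  | join w ih =>
    obtain ⟨h, h'⟩ := (matched_assemble x).1 h
    obtain ⟨c, a, b, hF⟩ := ih _ h fun t => hq _
    have h1 := h' (.inr (), 1, .inr (), perm4 0 2 1 3) (by simp [joinPairings])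
    have h2 := h' (.inl true, 3, .inr (), perm4 3 1 2 0) (by simp [joinPairings])
    obtain ⟨c', a', b', s, hs⟩ := (snapTet_iff (x (.inr ()))).1 ⟨hq _, h1⟩
    obtain ⟨p0, p1, p2⟩ := hF.portArcs.2
    replace h2 : ∀ v ≠ 3, w.ported.portArcs (fun t => x (.inl t)) true v =
      arcs (x (.inr ())) 0 (perm4 3 1 2 0 (by decide) v) := h2
    rw [forall_ne_three, p0, p1, p2, hs] at h2
    simp [arcs_eq, quadMate, snapTet] at h2
    obtain ⟨rfl, rfl⟩ := h2
    exact ⟨c, a, b', b, hF, s, hs⟩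
  | cap w ih =>
    obtain ⟨h, h'⟩ := (matched_assemble x).1 h
    obtain ⟨c, a, b, hF⟩ := ih _ h fun t => hq _
    have h1 := h' (.inl true, 3, .inr false, perm4 2 0 3 1) (by simp [capPairings])
    have h2 := h' (.inr false, 2, .inr true, perm4 2 3 0 1) (by simp [capPairings])
    have h3 := h' (.inr false, 3, .inr true, perm4 2 3 0 1) (by simp [capPairings])
    have h4 := h' (.inr true, 2, .inr true, perm4 0 1 3 2) (by simp [capPairings])
    obtain ⟨p0, p1, p2⟩ := hF.portArcs.2
    replace h1 : ∀ v ≠ 3, w.ported.portArcs (fun t => x (.inl t)) true v =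
      arcs (x (.inr false)) 1 (perm4 2 0 3 1 (by decide) v) := h1
    rw [forall_ne_three, p0, p1, p2] at h1
    -- The extra equation on the entry face is inherited from the piece, whose last port has `c`
    -- arcs at both loop vertices.
    obtain ⟨c', b', Q, q, hs, hs'⟩ := (capTet_iff (x (.inr false)) (x (.inr true))).1
      ⟨hq _, hq _, h2, h3, h4, h1.2.1.symm.trans h1.2.2⟩
    rw [hs] at h1
    simp [arcs_eq, quadMate, outerTet] at h1
    obtain ⟨rfl, rfl⟩ := h1
    exact ⟨c, a, b, hF, Q, q, hs, hs'⟩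

theorem matched_of_flow (w : Word) {c a b : ℝ} {x : w.ported.Cell → Discs → ℝ}
    (h : w.Flow c a b x) : w.ported.Matched x ∧ ∀ t, QuadOne (x t) := by
  induction w generalizing b with
  | snap =>
    obtain ⟨h1, h2⟩ := (snapTet_iff (x ())).2 ⟨c, a, b, h⟩
    refine ⟨fun g hg => ?_, fun _ => h1⟩
    obtain rfl := List.mem_singleton.1 hg
    exact h2
  | twist w ih =>
    obtain ⟨hF, s, hs⟩ := h
    obtain ⟨h1, h2⟩ := (snapTet_iff (x (.inr ()))).2 ⟨_, _, _, _, hs⟩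
    obtain ⟨i1, i2⟩ := ih hF
    refine ⟨(matched_assemble x).2 ⟨i1, fun g hg => ?_⟩, Sum.rec i2 fun _ => h1⟩
    have hg : g ∈ twistPairings := hg
    rw [twistPairings, List.mem_cons, List.mem_singleton] at hg
    rcases hg with rfl | rfl
    · exact h2
    · obtain ⟨p0, p1, p2⟩ := hF.portArcs.2
      change ∀ v ≠ 3, w.ported.portArcs (fun t => x (.inl t)) true v =
        arcs (x (.inr ())) 0 (perm4 1 2 3 0 (by decide) v)
      rw [forall_ne_three, p0, p1, p2, hs]
      simp [arcs_eq, quadMate, snapTet]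
  | join w ih =>
    obtain ⟨d, hF, s, hs⟩ := h
    obtain ⟨h1, h2⟩ := (snapTet_iff (x (.inr ()))).2 ⟨_, _, _, _, hs⟩
    obtain ⟨i1, i2⟩ := ih hF
    refine ⟨(matched_assemble x).2 ⟨i1, fun g hg => ?_⟩, Sum.rec i2 fun _ => h1⟩
    have hg : g ∈ joinPairings := hg
    rw [joinPairings, List.mem_cons, List.mem_singleton] at hg
    rcases hg with rfl | rfl
    · exact h2
    · obtain ⟨p0, p1, p2⟩ := hF.portArcs.2
      change ∀ v ≠ 3, w.ported.portArcs (fun t => x (.inl t)) true v =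
        arcs (x (.inr ())) 0 (perm4 3 1 2 0 (by decide) v)
      rw [forall_ne_three, p0, p1, p2, hs]
      simp [arcs_eq, quadMate, snapTet]
  | cap w ih =>
    obtain ⟨hF, Q, q, hs, hs'⟩ := h
    obtain ⟨h1, h1', h2, h3, h4, -⟩ := (capTet_iff (x (.inr false)) (x (.inr true))).2
      ⟨_, _, _, _, hs, hs'⟩
    obtain ⟨i1, i2⟩ := ih hF
    refine ⟨(matched_assemble x).2 ⟨i1, fun g hg => ?_⟩, Sum.rec i2 (Bool.rec h1 h1')⟩
    have hg : g ∈ capPairings := hg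
    rw [capPairings, List.mem_cons, List.mem_cons, List.mem_cons, List.mem_singleton] at hg
    rcases hg with rfl | rfl | rfl | rfl
    · obtain ⟨p0, p1, p2⟩ := hF.portArcs.2
      change ∀ v ≠ 3, w.ported.portArcs (fun t => x (.inl t)) true v =
        arcs (x (.inr false)) 1 (perm4 2 0 3 1 (by decide) v)
      rw [forall_ne_three, p0, p1, p2, hs]
      simp [arcs_eq, quadMate, outerTet]
    · exact h2
    · exact h3
    · exact h4

/-- Closing matches the arc numbers `(b, c, c)` of the last port with `(c, c, a)` of the first,
which means `a = b = c`. -/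
theorem matched_closeTwist_iff (w : Word) (x : w.ported.Cell ⊕ Fin 0 → Discs → ℝ) :
    (w.ported.closeTwist.Matched x ∧ ∀ t, QuadOne (x t)) ↔
      ∃ c, w.Flow c c c fun t => x (.inl t) := by
  have key : w.ported.closeTwist.Matched x ↔ w.ported.Matched (fun t => x (.inl t)) ∧
      ∀ v ≠ 3, w.ported.portArcs (fun t => x (.inl t)) true v =
        w.ported.portArcs (fun t => x (.inl t)) false v := by
    refine (matched_assemble x).trans (and_congr_right fun _ => ?_)
    constructor
    · intro h
      exact h _ (List.mem_singleton.2 rfl)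
    · intro h g hg
      obtain rfl := List.mem_singleton.1 hg
      exact h
  rw [key, forall_ne_three]
  constructor
  · rintro ⟨⟨h1, h2⟩, h3⟩
    obtain ⟨c, a, b, hF⟩ := w.flow_of_matched _ h1 fun t => h3 _
    obtain ⟨⟨p0, p1, p2⟩, p3, p4, p5⟩ := hF.portArcs
    rw [p0, p1, p2, p3, p4, p5] at h2
    obtain ⟨rfl, -, rfl⟩ := h2
    exact ⟨_, hF⟩
  · rintro ⟨c, hF⟩
    obtain ⟨⟨p0, p1, p2⟩, p3, p4, p5⟩ := hF.portArcs
    obtain ⟨h1, h2⟩ := w.matched_of_flow hF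
    rw [p0, p1, p2, p3, p4, p5]
    exact ⟨⟨h1, rfl, rfl, rfl⟩, Sum.rec h2 fun i => i.elim0⟩

end Word

end

/-! ### Extreme rays of a cone fibred over the parameter `c`, and products over blocks -/

section

open Filter Topology

/-- The coordinates of a block of tetrahedra. -/
abbrev Coords (T : Type) : Type := T → Discs → ℝ

namespace Coords

variable {T T₁ T₂ : Type}

/-- `y` vanishes where `x` does. -/
def SuppLE (y x : Coords T) : Prop := ∀ t d, x t d = 0 → y t d = 0

def total [Fintype T] (x : Coords T) : ℝ := ∑ t, ∑ d, x t d

def Nonneg (x : Coords T) : Prop := ∀ t d, 0 ≤ x t d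

theorem total_smul [Fintype T] (r : ℝ) (x : Coords T) : total (r • x) = r * total x := by
  simp only [total, Pi.smul_apply, smul_eq_mul, Finset.mul_sum]

theorem eq_zero_of_total [Fintype T] {x : Coords T} (hx : x.Nonneg) (h : total x = 0) : x = 0 := by
  funext t d
  have h1 := (Finset.sum_eq_zero_iff_of_nonneg (fun t _ => Finset.sum_nonneg fun d _ => hx t d)).1 h
    t (Finset.mem_univ t)
  exact (Finset.sum_eq_zero_iff_of_nonneg (fun d _ => hx t d)).1 h1 d (Finset.mem_univ d)

theorem total_pos [Fintype T] {x : Coords T} (hx : x.Nonneg) (h : x ≠ 0) : 0 < total x :=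
  lt_of_le_of_ne (Finset.sum_nonneg fun t _ => Finset.sum_nonneg fun d _ => hx t d)
    fun h' => h (eq_zero_of_total hx h'.symm)

/-- A linear space of pairs `(c, x)`, where `c` is one of the coordinates of `x`. -/
structure IsLinear (L : ℝ → Coords T → Prop) : Prop where
  zero : L 0 0
  combine : ∀ {c x c' x'}, L c x → L c' x' → ∀ r r', L (r * c + r' * c') (r • x + r' • x')
  coord : ∃ t d, ∀ c x, L c x → x t d = c

namespace IsLinear

variable {L : ℝ → Coords T → Prop}

theorem smul (hL : IsLinear L) {c : ℝ} {x : Coords T} (h : L c x) (r : ℝ) :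
    L (r * c) (r • x) := by
  simpa using hL.combine h hL.zero r 0

theorem sub (hL : IsLinear L) {c c' : ℝ} {x x' : Coords T} (h : L c x) (h' : L c' x') :
    L (c - c') (x - x') := by
  simpa [sub_eq_add_neg] using hL.combine h h' 1 (-1)

end IsLinear

/-- The points with `c = 1` determined by the set of their zero coordinates. -/
def rigidPoints (L : ℝ → Coords T → Prop) : Set (Coords T) :=
  {x | L 1 x ∧ x.Nonneg ∧ ∀ y, L 0 y → SuppLE y x → y = 0}

/-- The points with `c = 0` on extreme rays, normalized. -/
def extremeRays [Fintype T] (L : ℝ → Coords T → Prop) : Set (Coords T) :=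
  {x | L 0 x ∧ x.Nonneg ∧ total x = 1 ∧ ∀ y, L 0 y → SuppLE y x → ∃ r : ℝ, y = r • x}

/-- All points on extreme rays, normalized. -/
def vertices [Fintype T] (L : ℝ → Coords T → Prop) : Set (Coords T) :=
  {x | (∃ c, L c x) ∧ x.Nonneg ∧ total x = 1 ∧ ∀ c y, L c y → SuppLE y x → ∃ r : ℝ, y = r • x}

/-- Since `c` is itself a coordinate, it is nonnegative on the cone, and a vector supported where a
point with `c = 0` is supported has `c = 0` as well. So rays with `c = 0` are recognized inside that
slice, and the others meet the slice `c = 1` in one point each. -/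
theorem encard_vertices [Fintype T] {L : ℝ → Coords T → Prop} (hL : IsLinear L) :
    (vertices L).encard = (rigidPoints L).encard + (extremeRays L).encard := by
  obtain ⟨t₀, d₀, hc⟩ := hL.coord
  have ne0 : ∀ x ∈ rigidPoints L, x ≠ 0 := by
    rintro x hx rfl
    simpa using hc _ _ hx.1
  have hinj : Set.InjOn (fun x : Coords T => (total x)⁻¹ • x) (rigidPoints L) := by
    intro x hx y hy h
    have px := total_pos hx.2.1 (ne0 x hx)
    have py := total_pos hy.2.1 (ne0 y hy)
    have h1 := congrFun (congrFun h t₀) d₀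
    simp only [Pi.smul_apply, hc _ _ hx.1, hc _ _ hy.1, smul_eq_mul, mul_one, inv_inj] at h1
    have h2 := congrArg (fun z : Coords T => total x • z) h
    simpa [smul_smul, ← h1, px.ne'] using h2
  rw [← hinj.encard_image, ← Set.encard_union_eq]
  · congr 1
    ext x
    constructor
    · rintro ⟨⟨c, h1⟩, h2, h3, h4⟩
      rcases eq_or_ne c 0 with rfl | hc0
      · exact .inr ⟨h1, h2, h3, fun y => h4 0 y⟩
      · left
        have cpos : 0 < c := lt_of_le_of_ne (hc _ _ h1 ▸ h2 _ _) hc0.symm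
        refine ⟨c⁻¹ • x, ⟨?_, fun t d => mul_nonneg (by positivity) (h2 t d), ?_⟩, ?_⟩
        · simpa [hc0] using hL.smul h1 c⁻¹
        · intro y hy hs
          obtain ⟨r, rfl⟩ := h4 0 y hy fun t d ht => hs t d (by simp [ht])
          have := hc _ _ hy
          simp only [Pi.smul_apply, hc _ _ h1, smul_eq_mul, mul_eq_zero, hc0, or_false] at this
          rw [this, zero_smul]
        · simp [total_smul, h3, smul_smul, hc0]
    · rintro (⟨x, hx, rfl⟩ | ⟨h1, h2, h3, h4⟩)
      · have px := total_pos hx.2.1 (ne0 x hx)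
        refine ⟨⟨_, hL.smul hx.1 _⟩, fun t d => mul_nonneg (by positivity) (hx.2.1 t d), ?_, ?_⟩
        · rw [total_smul, inv_mul_cancel₀ px.ne']
        · intro c y hy hs
          -- Subtracting `c • x` moves `y` to the slice `c = 0`, where rigidity applies.
          have hz : y - c • x = 0 := by
            refine hx.2.2 _ (by simpa using hL.sub hy (hL.smul hx.1 c)) fun t d ht => ?_
            have := hs t d (by simp [ht])
            simp [this, ht]
          refine ⟨c * total x, ?_⟩
          simp [smul_smul, px.ne', sub_eq_zero.1 hz]
      · refine ⟨⟨0, h1⟩, h2, h3, fun c y hy hs => h4 y ?_ hs⟩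
        have : y t₀ d₀ = 0 := hs _ _ (hc _ _ h1)
        rwa [← hc _ _ hy, this] at hy
  · rw [Set.disjoint_left]
    rintro _ ⟨x, hx, rfl⟩ hy
    have px := total_pos hx.2.1 (ne0 x hx)
    have := hc _ _ hy.1
    simp [hc _ _ hx.1, px.ne'] at this

section product

/-- Coordinates on two blocks. -/
def glueCoords (e : T₁ ⊕ T₂ ≃ T) (x : Coords T₁) (y : Coords T₂) : Coords T :=
  fun t => Sum.elim x y (e.symm t)

def leftPart (e : T₁ ⊕ T₂ ≃ T) (x : Coords T) : Coords T₁ := fun t => x (e (.inl t))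

def rightPart (e : T₁ ⊕ T₂ ≃ T) (x : Coords T) : Coords T₂ := fun t => x (e (.inr t))

@[simp] theorem leftPart_glueCoords (e : T₁ ⊕ T₂ ≃ T) (x : Coords T₁) (y : Coords T₂) :
    leftPart e (glueCoords e x y) = x := by
  funext t; simp [leftPart, glueCoords]

@[simp] theorem rightPart_glueCoords (e : T₁ ⊕ T₂ ≃ T) (x : Coords T₁) (y : Coords T₂) :
    rightPart e (glueCoords e x y) = y := by
  funext t; simp [rightPart, glueCoords]

@[simp] theorem glueCoords_parts (e : T₁ ⊕ T₂ ≃ T) (x : Coords T) :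
    glueCoords e (leftPart e x) (rightPart e x) = x := by
  funext t
  obtain ⟨s | s, rfl⟩ := e.surjective t <;> simp [leftPart, rightPart, glueCoords]

theorem total_glueCoords [Fintype T] [Fintype T₁] [Fintype T₂]
    (e : T₁ ⊕ T₂ ≃ T) (x : Coords T₁) (y : Coords T₂) :
    total (glueCoords e x y) = total x + total y := by
  unfold total
  rw [← Equiv.sum_comp e, Fintype.sum_sum_type]
  simp [glueCoords]

theorem nonneg_glueCoords {e : T₁ ⊕ T₂ ≃ T} {x : Coords T₁} {y : Coords T₂} :
    (glueCoords e x y).Nonneg ↔ x.Nonneg ∧ y.Nonneg := by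
  constructor
  · intro h
    constructor
    · intro t d; simpa [glueCoords] using h (e (.inl t)) d
    · intro t d; simpa [glueCoords] using h (e (.inr t)) d
  · rintro ⟨h1, h2⟩ t d
    obtain ⟨s | s, rfl⟩ := e.surjective t
    · simpa [glueCoords] using h1 s d
    · simpa [glueCoords] using h2 s d

theorem suppLE_glueCoords {e : T₁ ⊕ T₂ ≃ T} {x x' : Coords T₁} {y y' : Coords T₂} :
    SuppLE (glueCoords e x y) (glueCoords e x' y') ↔ SuppLE x x' ∧ SuppLE y y' := by
  constructor
  · intro h
    constructor
    · intro t d; simpa [glueCoords] using h (e (.inl t)) d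
    · intro t d; simpa [glueCoords] using h (e (.inr t)) d
  · rintro ⟨h1, h2⟩ t d
    obtain ⟨s | s, rfl⟩ := e.surjective t
    · simpa [glueCoords] using h1 s d
    · simpa [glueCoords] using h2 s d

theorem glueCoords_smul (e : T₁ ⊕ T₂ ≃ T) (r : ℝ) (x : Coords T₁) (y : Coords T₂) :
    glueCoords e (r • x) (r • y) = r • glueCoords e x y := by
  funext t
  obtain ⟨s | s, rfl⟩ := e.surjective t <;> simp [glueCoords]

theorem glueCoords_injective (e : T₁ ⊕ T₂ ≃ T) :
    Function.Injective fun p : Coords T₁ × Coords T₂ => glueCoords e p.1 p.2 := by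
  intro p q h
  refine Prod.ext ?_ ?_
  · simpa using congrArg (leftPart e) h
  · simpa using congrArg (rightPart e) h

theorem glueCoords_zero (e : T₁ ⊕ T₂ ≃ T) : glueCoords e 0 0 = 0 := by
  simpa using glueCoords_smul e 0 0 0

theorem suppLE_zero (x : Coords T) : SuppLE 0 x := fun _ _ _ => rfl

variable {e : T₁ ⊕ T₂ ≃ T} {L : ℝ → Coords T → Prop} {L₁ : ℝ → Coords T₁ → Prop}
  {L₂ : ℝ → Coords T₂ → Prop}

/-- With `c = 1` fixed, the solution polyhedron is the product of those of the two blocks, and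
vertices of a product are pairs of vertices. -/
theorem encard_rigidPoints_glue (h₁ : IsLinear L₁) (h₂ : IsLinear L₂)
    (h : ∀ c x y, L c (glueCoords e x y) ↔ L₁ c x ∧ L₂ c y) :
    (rigidPoints L).encard = (rigidPoints L₁).encard * (rigidPoints L₂).encard := by
  rw [← Set.encard_prod, ← (glueCoords_injective e).encard_image]
  congr 1
  ext z
  constructor
  · rintro ⟨z1, z2, z3⟩
    rw [← glueCoords_parts e z] at z1 z2 z3
    rw [h] at z1
    rw [nonneg_glueCoords] at z2
    refine ⟨(leftPart e z, rightPart e z), ⟨⟨z1.1, z2.1, fun y hy hs => ?_⟩, z1.2, z2.2,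
      fun y hy hs => ?_⟩, glueCoords_parts e z⟩
    · have := z3 (glueCoords e y 0) ((h _ _ _).2 ⟨hy, h₂.zero⟩)
        (suppLE_glueCoords.2 ⟨hs, suppLE_zero _⟩)
      rw [← glueCoords_zero e] at this
      simpa using congrArg (leftPart e) this
    · have := z3 (glueCoords e 0 y) ((h _ _ _).2 ⟨h₁.zero, hy⟩)
        (suppLE_glueCoords.2 ⟨suppLE_zero _, hs⟩)
      rw [← glueCoords_zero e] at this
      simpa using congrArg (rightPart e) this
  · rintro ⟨⟨x, y⟩, ⟨⟨x1, x2, x3⟩, y1, y2, y3⟩, rfl⟩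
    refine ⟨(h _ _ _).2 ⟨x1, y1⟩, nonneg_glueCoords.2 ⟨x2, y2⟩, fun w hw hs => ?_⟩
    rw [← glueCoords_parts e w, h] at hw
    rw [← glueCoords_parts e w, suppLE_glueCoords] at hs
    rw [← glueCoords_parts e w, x3 _ hw.1 hs.1, y3 _ hw.2 hs.2, glueCoords_zero]

/-- With `c = 0` the blocks are independent cones, and an extreme ray of a product of cones lies in
one factor. -/
theorem encard_extremeRays_glue [Fintype T] [Fintype T₁] [Fintype T₂]
    (h₁ : IsLinear L₁) (h₂ : IsLinear L₂)
    (h : ∀ c x y, L c (glueCoords e x y) ↔ L₁ c x ∧ L₂ c y) :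
    (extremeRays L).encard = (extremeRays L₁).encard + (extremeRays L₂).encard := by
  have i1 : Function.Injective fun x : Coords T₁ => glueCoords e x (0 : Coords T₂) :=
    fun x y hh => congrArg Prod.fst (glueCoords_injective e (a₁ := (x, 0)) (a₂ := (y, 0)) hh)
  have i2 : Function.Injective fun x : Coords T₂ => glueCoords e (0 : Coords T₁) x :=
    fun x y hh => congrArg Prod.snd (glueCoords_injective e (a₁ := (0, x)) (a₂ := (0, y)) hh)
  have t1 : total (0 : Coords T₁) = 0 := by simp [total]
  have t2 : total (0 : Coords T₂) = 0 := by simp [total]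
  rw [← i1.encard_image, ← i2.encard_image, ← Set.encard_union_eq]
  · congr 1
    ext z
    constructor
    · rintro ⟨z1, z2, z3, z4⟩
      have hz := glueCoords_parts e z
      generalize leftPart e z = x at hz
      generalize rightPart e z = y at hz
      subst hz
      rw [h] at z1
      have z2' := nonneg_glueCoords.1 z2
      rw [total_glueCoords] at z3
      -- The truncation `(x, 0)` of `(x, y)` is supported in it, hence is a multiple of it; so one
      -- of the parts is zero.
      obtain ⟨r, hr⟩ := z4 (glueCoords e x 0) ((h _ _ _).2 ⟨z1.1, h₂.zero⟩)
        (suppLE_glueCoords.2 ⟨fun _ _ hh => hh, suppLE_zero _⟩)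
      rw [← glueCoords_smul] at hr
      have hr1 : x = r • x := by simpa using congrArg (leftPart e) hr
      have hr2 : 0 = r • y := by simpa using congrArg (rightPart e) hr
      rcases eq_or_ne r 0 with rfl | hr0
      · rw [zero_smul] at hr1
        subst hr1
        refine .inr ⟨y, ⟨z1.2, z2'.2, by simpa [t1] using z3, fun w hw hs => ?_⟩, rfl⟩
        obtain ⟨r, hr⟩ := z4 (glueCoords e 0 w) ((h _ _ _).2 ⟨h₁.zero, hw⟩)
          (suppLE_glueCoords.2 ⟨suppLE_zero _, hs⟩)
        rw [← glueCoords_smul] at hr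
        exact ⟨r, by simpa using congrArg (rightPart e) hr⟩
      · obtain rfl : y = 0 := (smul_eq_zero.1 hr2.symm).resolve_left hr0
        refine .inl ⟨x, ⟨z1.1, z2'.1, by simpa [t2] using z3, fun w hw hs => ?_⟩, rfl⟩
        obtain ⟨r, hr⟩ := z4 (glueCoords e w 0) ((h _ _ _).2 ⟨hw, h₂.zero⟩)
          (suppLE_glueCoords.2 ⟨hs, suppLE_zero _⟩)
        rw [← glueCoords_smul] at hr
        exact ⟨r, by simpa using congrArg (leftPart e) hr⟩
    · rintro (⟨x, ⟨x1, x2, x3, x4⟩, rfl⟩ | ⟨x, ⟨x1, x2, x3, x4⟩, rfl⟩)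
      · refine ⟨(h _ _ _).2 ⟨x1, h₂.zero⟩, nonneg_glueCoords.2 ⟨x2, fun _ _ => le_rfl⟩,
          by simp [total_glueCoords, t2, x3], fun w hw hs => ?_⟩
        rw [← glueCoords_parts e w, h] at hw
        rw [← glueCoords_parts e w, suppLE_glueCoords] at hs
        obtain ⟨r, hr⟩ := x4 _ hw.1 hs.1
        refine ⟨r, ?_⟩
        have : rightPart e w = 0 := funext fun t => funext fun d => hs.2 t d rfl
        dsimp only
        rw [← glueCoords_smul, ← glueCoords_parts e w, hr, this, smul_zero]
      · refine ⟨(h _ _ _).2 ⟨h₁.zero, x1⟩, nonneg_glueCoords.2 ⟨fun _ _ => le_rfl, x2⟩,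
          by simp [total_glueCoords, t1, x3], fun w hw hs => ?_⟩
        rw [← glueCoords_parts e w, h] at hw
        rw [← glueCoords_parts e w, suppLE_glueCoords] at hs
        obtain ⟨r, hr⟩ := x4 _ hw.2 hs.2
        refine ⟨r, ?_⟩
        have : leftPart e w = 0 := funext fun t => funext fun d => hs.1 t d rfl
        dsimp only
        rw [← glueCoords_smul, ← glueCoords_parts e w, hr, this, smul_zero]
  · rw [Set.disjoint_left]
    rintro _ ⟨x, hx, rfl⟩ ⟨y, hy, hh⟩
    have h0 : y = 0 := by simpa using congrArg (rightPart e) hh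
    have := hy.2.2.1
    rw [h0, t2] at this
    exact zero_ne_one this

end product

end Coords

end

/-! ### Points with `c = 1` in a chain without twists -/

section

open Coords

theorem forall_discs {p : Discs → Prop} : (∀ d, p d) ↔ (p (.inl 0) ∧ p (.inl 1) ∧ p (.inl 2) ∧
    p (.inl 3)) ∧ p (.inr 0) ∧ p (.inr 1) ∧ p (.inr 2) := by
  simp [Sum.forall, Fin.forall_fin_succ]

/-- The combinatorial shape of a chain: `K` are the snapped tetrahedra, `I` the caps, and `J` the
segments of consecutive caps.  A snapped tetrahedron lies between segments or ends of the chain. -/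
structure Shape (J K I : Type) where
  left : K → Option J
  right : K → Option J
  seg : I → J
  seg_surjective : seg.Surjective

namespace Shape

variable {J K I : Type} (S : Shape J K I)

/-- The apex arcs: `c` at the ends of the chain, and `b j` in segment `j`. -/
def apex (c : ℝ) (b : J → ℝ) (o : Option J) : ℝ := o.elim c b

/-- The solution of the matching equations with the given parameters. -/
def form (c : ℝ) (b : J → ℝ) (s : K → ℝ) (Q q : I → ℝ) : Coords (K ⊕ I × Bool) :=
  Sum.elim (fun k => snapTet c (apex c b (S.left k)) (apex c b (S.right k)) (s k))
    fun p => if p.2 then innerTet c (b (S.seg p.1)) (Q p.1) (q p.1)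
      else outerTet c (b (S.seg p.1)) (Q p.1)

theorem forall_cells {p : K ⊕ I × Bool → Prop} :
    (∀ t, p t) ↔ (∀ k, p (.inl k)) ∧ ∀ i, p (.inr (i, false)) ∧ p (.inr (i, true)) := by
  simp [Sum.forall, Prod.forall, Bool.forall_bool]

theorem nonneg_form {c : ℝ} {b : J → ℝ} {s : K → ℝ} {Q q : I → ℝ} :
    (S.form c b s Q q).Nonneg ↔
      (∀ k, 0 ≤ c ∧ 0 ≤ s k ∧ s k ≤ apex c b (S.left k) ∧ s k ≤ apex c b (S.right k)) ∧
      ∀ i, 0 ≤ c ∧ 0 ≤ b (S.seg i) ∧ 0 ≤ Q i ∧ Q i ≤ c ∧ 0 ≤ q i ∧ q i ≤ b (S.seg i) + Q i ∧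
        q i ≤ c + Q i := by
  unfold Nonneg
  rw [forall_cells]
  refine and_congr (forall_congr' fun k => ?_) (forall_congr' fun i => ?_)
  · simp only [forall_discs, form, snapTet, Sum.elim_inl, Sum.elim_inr]
    simp
    tauto
  · simp only [forall_discs, form, outerTet, innerTet, Sum.elim_inr]
    simp
    tauto

/-- Vanishing coordinates are tight inequalities between parameters. The condition says that the
perturbation `(b', s', Q', q')`, with `c` unchanged, keeps each tight inequality tight. -/
theorem suppLE_form {c : ℝ} {b b' : J → ℝ} {s s' : K → ℝ} {Q Q' q q' : I → ℝ} :
    SuppLE (S.form 0 b' s' Q' q') (S.form c b s Q q) ↔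
      (∀ k, (s k = 0 → s' k = 0) ∧ (s k = apex c b (S.left k) → s' k = apex 0 b' (S.left k)) ∧
        (s k = apex c b (S.right k) → s' k = apex 0 b' (S.right k))) ∧
      ∀ i, (b (S.seg i) = 0 → b' (S.seg i) = 0) ∧ (Q i = 0 → Q' i = 0) ∧ (Q i = c → Q' i = 0) ∧
        (q i = 0 → q' i = 0) ∧ (q i = b (S.seg i) + Q i → q' i = b' (S.seg i) + Q' i) ∧
        (q i = c + Q i → q' i = Q' i) := by
  have e : ∀ x y : ℝ, x - y = 0 ↔ y = x := fun x y => sub_eq_zero.trans eq_comm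
  unfold SuppLE
  rw [forall_cells]
  refine and_congr (forall_congr' fun k => ?_) (forall_congr' fun i => ?_)
  · simp only [forall_discs, form, snapTet, Sum.elim_inl, Sum.elim_inr]
    simp [e]
    tauto
  · simp only [forall_discs, form, outerTet, innerTet, Sum.elim_inr]
    simp [e]
    tauto

def family (c : ℝ) (x : Coords (K ⊕ I × Bool)) : Prop := ∃ b s Q q, x = S.form c b s Q q

theorem form_injective {c : ℝ} {b b' : J → ℝ} {s s' : K → ℝ} {Q Q' q q' : I → ℝ}
    (h : S.form c b s Q q = S.form c b' s' Q' q') : b = b' ∧ s = s' ∧ Q = Q' ∧ q = q' := by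
  refine ⟨funext fun j => ?_, funext fun k => ?_, funext fun i => ?_, funext fun i => ?_⟩
  · obtain ⟨i, rfl⟩ := S.seg_surjective j
    simpa [form, outerTet] using congrFun (congrFun h (.inr (i, false))) (.inl 2)
  · simpa [form, snapTet] using congrFun (congrFun h (.inl k)) (.inr 2)
  · simpa [form, outerTet] using congrFun (congrFun h (.inr (i, false))) (.inr 0)
  · simpa [form, innerTet] using congrFun (congrFun h (.inr (i, true))) (.inr 0)

theorem form_zero : S.form 0 0 0 0 0 = 0 := by
  funext t d
  rcases t with k | ⟨i, _ | _⟩ <;> rcases d with v | v <;> fin_cases v <;>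
    simp [form, snapTet, innerTet, outerTet, apex] <;> cases S.left k <;> cases S.right k <;> simp

theorem form_smul (r c : ℝ) (b : J → ℝ) (s : K → ℝ) (Q q : I → ℝ) :
    S.form (r * c) (r • b) (r • s) (r • Q) (r • q) = r • S.form c b s Q q := by
  have e : ∀ o, apex (r * c) (r • b) o = r * apex c b o := by rintro (_ | _) <;> rfl
  funext t d
  rcases t with k | ⟨i, _ | _⟩ <;> rcases d with v | v <;> fin_cases v <;>
    simp [form, snapTet, innerTet, outerTet, e] <;> ring

/-- The number `0` or `1`. -/
def bit (a : Bool) : ℝ := if a then 1 else 0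

theorem bit_eq_zero {a : Bool} : bit a = 0 ↔ a = false := by cases a <;> simp [bit]

theorem bit_injective : Function.Injective bit := by
  intro a b h
  cases a <;> cases b <;> simp_all [bit]

/-- Choices of which inequalities are tight. -/
abbrev Choice (J K I : Type) : Type := (J → Bool) × (K → Bool) × (I → Bool) × (I → Bool)

/-- The point determined by a choice. -/
def point (t : Choice J K I) : Coords (K ⊕ I × Bool) :=
  S.form 1 (fun j => bit (t.1 j)) (fun k => bit (t.2.1 k)) (fun i => bit (t.2.2.1 i))
    fun i => bit (t.2.2.2 i) * (bit (t.1 (S.seg i)) + bit (t.2.2.1 i))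

/-- A choice determines its point. -/
def Pinned (t : Choice J K I) : Prop :=
  ∀ v : J → ℝ, (∀ j, t.1 j = false → v j = 0) →
    (∀ k, t.2.1 k = true → apex 0 v (S.left k) = apex 0 v (S.right k)) →
    (∀ i, t.1 (S.seg i) = true → t.2.2.2 i = true → v (S.seg i) = 0) → v = 0

/-- The choices that describe each point once. -/
def Canonical (t : Choice J K I) : Prop :=
  (∀ k, t.2.1 k = true → (S.left k).elim true t.1 = true ∧ (S.right k).elim true t.1 = true) ∧
  ∀ i, t.2.2.2 i = true → t.1 (S.seg i) = true ∨ t.2.2.1 i = true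

/-- The bits `b`, `s`, `Q` are coordinates of the point. A bit `q` could be lost only where its
factor `b + Q` is zero, and canonicity sets it to `false` there. -/
theorem point_injOn : Set.InjOn S.point {t | S.Canonical t} := by
  rintro ⟨β, σ, Q, q⟩ ht ⟨β', σ', Q', q'⟩ ht' h
  obtain ⟨h1, h2, h3, h4⟩ := S.form_injective h
  obtain rfl : β = β' := funext fun j => bit_injective (congrFun h1 j)
  obtain rfl : σ = σ' := funext fun j => bit_injective (congrFun h2 j)
  obtain rfl : Q = Q' := funext fun j => bit_injective (congrFun h3 j)
  obtain rfl : q = q' := funext fun i => by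
    have h5 := congrFun h4 i
    have h6 := ht.2 i
    have h7 := ht'.2 i
    dsimp only at h5 h6 h7
    revert h5 h6 h7
    cases q i <;> cases q' i <;> cases β (S.seg i) <;> cases Q i <;>
      norm_num [bit]
  rfl

theorem apex_bit (β : J → Bool) (o : Option J) :
    apex 1 (fun j => bit (β j)) o = bit (o.elim true β) := by
  cases o
  · simp [apex, bit]
  · rfl

/-- Every `Q` is at one of its bounds `0, c`, so a support-preserving perturbation has `Q' = 0`.
Pinning then gives `b' = 0`, and each `s` and `q` is tied to a bound that no longer moves. -/
theorem point_mem_rigidPoints {t : Choice J K I} (hc : S.Canonical t) (hp : S.Pinned t) :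
    S.point t ∈ rigidPoints S.family := by
  obtain ⟨β, σ, Q, q⟩ := t
  obtain ⟨h1, h2⟩ := hc
  dsimp only at h1 h2
  refine ⟨⟨_, _, _, _, rfl⟩, S.nonneg_form.2 ⟨fun k => ?_, fun i => ?_⟩, ?_⟩
  · simp only [apex_bit]
    have := h1 k
    revert this
    cases σ k <;> cases (S.left k).elim true β <;> cases (S.right k).elim true β <;> simp [bit]
  · dsimp only
    have := h2 i
    revert this
    cases q i <;> cases β (S.seg i) <;> cases Q i <;> simp [bit]
  · rintro _ ⟨b', s', Q', q', rfl⟩ hs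
    obtain ⟨k1, k2⟩ := S.suppLE_form.1 hs
    simp only [apex_bit] at k1 k2
    have hQ : Q' = 0 := funext fun i => by
      have := k2 i
      revert this
      cases Q i <;> simp [bit] <;> tauto
    have hb : b' = 0 := by
      refine hp b' (fun j hj => ?_) (fun k hk => ?_) fun i hi hi' => ?_
      · obtain ⟨i, rfl⟩ := S.seg_surjective j
        exact (k2 i).1 (bit_eq_zero.2 hj)
      · obtain ⟨e1, e2⟩ := h1 k hk
        dsimp only at hk
        obtain ⟨-, l, r⟩ := k1 k
        rw [hk, e1] at l
        rw [hk, e2] at r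
        exact (l rfl).symm.trans (r rfl)
      -- As `b = c = 1`, both upper bounds `b + Q` and `c + Q` of `q` are tight, so `q'` equals both
      -- `b' + Q'` and `Q'`.
      · obtain ⟨-, -, -, -, e1, e2⟩ := k2 i
        dsimp only at hi hi'
        simp only [hi, hi', if_true, bit] at e1 e2
        have := e1 (one_mul _)
        rw [e2 (one_mul _)] at this
        linarith
    subst hQ hb
    have ha : ∀ o : Option J, apex 0 (0 : J → ℝ) o = 0 := by rintro (_ | _) <;> rfl
    have hs' : s' = 0 := funext fun k => by
      have e := k1 k
      have e' := h1 k
      simp only [ha] at e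
      revert e e'
      cases σ k <;> cases (S.left k).elim true β <;> simp [bit] <;> tauto
    have hq : q' = 0 := funext fun i => by
      have e := k2 i
      revert e
      cases hqi : q i <;> cases β (S.seg i) <;> cases Q i <;> simp [bit] <;> tauto
    rw [hs', hq, form_zero]

-- If a parameter were not at one of the expected values, it could be moved, together with those
-- tied to it, without loosening a tight inequality; rigidity forbids this. So all of `b`, `s`, `Q`
-- are `0` or `1`, and the support is a choice.
open Classical in
theorem exists_of_mem_rigidPoints {x : Coords (K ⊕ I × Bool)} (hx : x ∈ rigidPoints S.family) :
    ∃ t, (S.Canonical t ∧ S.Pinned t) ∧ S.point t = x := by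
  obtain ⟨⟨b, s, Q, q, rfl⟩, hn, hr⟩ := hx
  obtain ⟨n1, n2⟩ := S.nonneg_form.1 hn
  have rigid : ∀ b' s' Q' q', SuppLE (S.form 0 b' s' Q' q') (S.form 1 b s Q q) →
      b' = 0 ∧ s' = 0 ∧ Q' = 0 ∧ q' = 0 := by
    intro b' s' Q' q' h
    have := hr _ ⟨b', s', Q', q', rfl⟩ h
    rw [← S.form_zero] at this
    exact S.form_injective this
  have ha : ∀ o : Option J, apex 0 (0 : J → ℝ) o = 0 := by rintro (_ | _) <;> rfl
  have hQ : ∀ i, Q i = 0 ∨ Q i = 1 := by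
    intro i
    by_contra! h
    -- Both upper bounds of `q i` contain `Q i`, so a nonzero `q i` is carried along; if `q i = 0`,
    -- these bounds are not tight because `Q i > 0`.
    have := (rigid 0 0 (Pi.single i 1) (fun m => if m = i ∧ q i ≠ 0 then 1 else 0)
      (S.suppLE_form.2 ⟨fun k => by simp [ha], fun m => ?_⟩)).2.2.1
    · simpa using congrFun this i
    · rcases eq_or_ne m i with rfl | hm
      · obtain ⟨-, m1, m2, m3, -⟩ := n2 m
        have : 0 < Q m := lt_of_le_of_ne m2 h.1.symm
        by_cases hq : q m = 0
        · simp only [hq]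
          simp [h.1, h.2]
          exact ⟨fun hh => absurd hh (by linarith), fun hh => absurd hh (by linarith)⟩
        · simp [h.1, h.2, hq]
      · simp [hm]
  have hq : ∀ i, q i = 0 ∨ q i = b (S.seg i) + Q i ∨ q i = 1 + Q i := by
    intro i
    by_contra! h
    have := (rigid 0 0 0 (Pi.single i 1)
      (S.suppLE_form.2 ⟨fun k => by simp [ha], fun m => ?_⟩)).2.2.2
    · simpa using congrFun this i
    · rcases eq_or_ne m i with rfl | hm
      · simp [h.1, h.2.1, h.2.2]
      · simp [hm]
  have hs : ∀ k, s k = 0 ∨ s k = apex 1 b (S.left k) ∨ s k = apex 1 b (S.right k) := by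
    intro k
    by_contra! h
    have := (rigid 0 (Pi.single k 1) 0 0
      (S.suppLE_form.2 ⟨fun m => ?_, fun m => by simp⟩)).2.1
    · simpa using congrFun this k
    · rcases eq_or_ne m k with rfl | hm
      · simp [h.1, h.2.1, h.2.2]
      · simp [hm, ha]
  have hb : ∀ j, b j = 0 ∨ b j = 1 := by
    intro j
    by_contra! h
    have e : ∀ o : Option J, apex 0 (fun m => if b m = b j then (1 : ℝ) else 0) o =
        if apex 1 b o = b j then 1 else 0 := by
      rintro (_ | m)
      · simp [apex, h.2.symm]
      · rfl
    -- All parameters `b`, `s` equal to `b j` move at once, which preserves the equalities among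
    -- them; each `q` tied to a moving bound `b + Q` follows. The ends of the chain stay fixed since
    -- `b j ≠ 1`.
    have := (rigid (fun m => if b m = b j then 1 else 0) (fun k => if s k = b j then 1 else 0) 0
      (fun i => if q i = b (S.seg i) + Q i ∧ b (S.seg i) = b j then 1 else 0)
      (S.suppLE_form.2 ⟨fun k => ⟨fun hk => ?_, fun hk => ?_, fun hk => ?_⟩,
        fun i => ⟨fun hi => ?_, fun _ => rfl, fun _ => rfl, fun hi => ?_, fun hi => ?_,
          fun hi => ?_⟩⟩)).1
    · simpa using congrFun this j
    · simp [hk, h.1.symm]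
    · rw [e, hk]
    · rw [e, hk]
    · simp [hi, h.1.symm]
    · refine if_neg fun hh => h.1 ?_
      obtain ⟨-, m0, m1, -⟩ := n2 i
      linarith [hh.1, hh.2]
    · simp [hi]
    · refine if_neg fun hh => h.2 ?_
      linarith [hh.1, hh.2]
  have bb : ∀ {r : ℝ}, r = 0 ∨ r = 1 → bit (decide (r ≠ 0)) = r := by
    rintro r (rfl | rfl) <;> simp [bit]
  have hap : ∀ o : Option J, apex 1 b o = 0 ∨ apex 1 b o = 1 := by
    rintro (_ | j)
    · exact .inr rfl
    · exact hb j
  have hs' : ∀ k, s k = 0 ∨ s k = 1 := by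
    intro k
    rcases hs k with h | h | h
    · exact .inl h
    · exact h ▸ hap _
    · exact h ▸ hap _
  have hpt : S.point (fun j => decide (b j ≠ 0), fun k => decide (s k ≠ 0),
      fun i => decide (Q i ≠ 0), fun i => decide (q i ≠ 0)) = S.form 1 b s Q q := by
    unfold point
    dsimp only
    have e1 : (fun j => bit (decide (b j ≠ 0))) = b := funext fun j => bb (hb j)
    have e2 : (fun j => bit (decide (s j ≠ 0))) = s := funext fun j => bb (hs' j)
    have e3 : (fun j => bit (decide (Q j ≠ 0))) = Q := funext fun j => bb (hQ j)
    rw [e1, e2, e3]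
    congr 1
    funext i
    rw [bb (hb _), bb (hQ _)]
    rcases eq_or_ne (q i) 0 with h | h
    · simp [h, bit]
    · simp only [h, ne_eq, not_false_eq_true, decide_true, bit, if_true, one_mul]
      rcases hq i with h' | h' | h'
      · exact absurd h' h
      · exact h'.symm
      -- When `q = 1 + Q`, the bound `q ≤ b + Q` excludes `b = 0`; hence `b = 1` and the two bounds
      -- coincide.
      · obtain ⟨-, m1, -, -, -, m2, -⟩ := n2 i
        rcases hb (S.seg i) with h'' | h''
        · linarith
        · linarith
  have hap' : ∀ o : Option J, o.elim true (fun j => decide (b j ≠ 0)) = true ↔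
      apex 1 b o ≠ 0 := by
    rintro (_ | j) <;> simp [apex]
  refine ⟨_, ⟨⟨fun k hk => ?_, fun i hi => ?_⟩, ?_⟩, hpt⟩
  · simp only [hap']
    obtain ⟨-, m0, m1, m2⟩ := n1 k
    have hk : s k ≠ 0 := by simpa using hk
    have : 0 < s k := lt_of_le_of_ne m0 hk.symm
    exact ⟨(this.trans_le m1).ne', (this.trans_le m2).ne'⟩
  · obtain ⟨-, m0, m1, -, m2, m3, -⟩ := n2 i
    have hi : q i ≠ 0 := by simpa using hi
    have : 0 < q i := lt_of_le_of_ne m2 hi.symm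
    by_contra! hh
    simp at hh
    linarith [hh.1, hh.2]
  · intro v v1 v2 v3
    have w1 : ∀ j, b j = 0 → v j = 0 := fun j hj => v1 j (by simpa using hj)
    have w2 : ∀ k, s k ≠ 0 → apex 0 v (S.left k) = apex 0 v (S.right k) :=
      fun k hk => v2 k (by simpa using hk)
    have w3 : ∀ i, b (S.seg i) ≠ 0 → q i ≠ 0 → v (S.seg i) = 0 :=
      fun i hi hi' => v3 i (by simpa using hi) (by simpa using hi')
    have w4 : ∀ o : Option J, apex 1 b o = 0 → apex 0 v o = 0 := by
      rintro (_ | j) h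
      · rfl
      · exact w1 j h
    -- A vector `v` that violates pinning extends to a perturbation: nonzero `s` follow their
    -- apices, nonzero `q` follow `v`, and `Q` rests.
    refine (rigid v (fun k => if s k = 0 then 0 else apex 0 v (S.left k)) 0
      (fun i => if q i = 0 then 0 else v (S.seg i))
      (S.suppLE_form.2 ⟨fun k => ⟨fun hk => ?_, fun hk => ?_, fun hk => ?_⟩,
        fun i => ⟨fun hi => ?_, fun _ => rfl, fun _ => rfl, fun hi => ?_, fun hi => ?_,
          fun hi => ?_⟩⟩)).1
    · simp [hk]
    · split_ifs with h
      · exact (w4 _ (hk ▸ h)).symm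
      · rfl
    · split_ifs with h
      · exact (w4 _ (hk ▸ h)).symm
      · exact w2 k h
    · exact w1 _ hi
    · simp [hi]
    · obtain ⟨-, m0, m1, -⟩ := n2 i
      split_ifs with h
      · have := w1 (S.seg i) (by linarith)
        simp [this]
      · simp
    · obtain ⟨-, m0, m1, -, -, m2, -⟩ := n2 i
      split_ifs with h
      · rfl
      · exact w3 i (by intro h0; linarith) h

theorem rigidPoints_family :
    rigidPoints S.family = S.point '' {t | S.Canonical t ∧ S.Pinned t} :=
  Set.Subset.antisymm (fun _ hx => S.exists_of_mem_rigidPoints hx) (by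
    rintro _ ⟨t, ⟨h1, h2⟩, rfl⟩
    exact S.point_mem_rigidPoints h1 h2)

theorem encard_rigidPoints_family :
    (rigidPoints S.family).encard = {t | S.Canonical t ∧ S.Pinned t}.encard := by
  rw [rigidPoints_family]
  exact (S.point_injOn.mono fun _ h => h.1).encard_image

/-! ### Extreme rays with `c = 0` in a chain without twists -/

variable {J K I : Type} (S : Shape J K I)

/-- The solution with `c = 0` determined by a choice of segments and tetrahedra. -/
def ray (t : (J → Bool) × (K → Bool)) : Coords (K ⊕ I × Bool) :=
  S.form 0 (fun j => bit (t.1 j)) (fun k => bit (t.2 k)) 0 0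

/-- The choices that give extreme rays. -/
def Connected (t : (J → Bool) × (K → Bool)) : Prop :=
  (∃ j, t.1 j = true) ∧
  (∀ k, t.2 k = true → (S.left k).elim false t.1 = true ∧ (S.right k).elim false t.1 = true) ∧
  ∀ v : J → ℝ, (∀ j, t.1 j = false → v j = 0) →
    (∀ k, t.2 k = true → apex 0 v (S.left k) = apex 0 v (S.right k)) →
    ∃ r : ℝ, v = fun j => r * bit (t.1 j)

theorem apex_zero_bit (β : J → Bool) (o : Option J) :
    apex 0 (fun j => bit (β j)) o = bit (o.elim false β) := by
  cases o
  · simp [apex, bit]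
  · rfl

theorem total_ray_pos [Fintype K] [Fintype I] {t : (J → Bool) × (K → Bool)} (ht : S.Connected t) :
    (S.ray t).Nonneg ∧ 0 < total (S.ray t) := by
  have hn : (S.ray t).Nonneg := S.nonneg_form.2 ⟨fun k => by
      have := ht.2.1 k
      simp only [apex_zero_bit]
      revert this
      cases t.2 k <;> cases (S.left k).elim false t.1 <;> cases (S.right k).elim false t.1 <;>
        simp [bit], fun i => by
      cases h : t.1 (S.seg i) <;> simp [bit]⟩
  refine ⟨hn, total_pos hn fun h => ?_⟩
  obtain ⟨j, hj⟩ := ht.1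
  have := congrFun (S.form_injective (h.trans S.form_zero.symm)).1 j
  simp [hj, bit] at this

theorem ray_injOn [Fintype K] [Fintype I] :
    Set.InjOn (fun t => (total (S.ray t))⁻¹ • S.ray t) {t | S.Connected t} := by
  intro t ht t' ht' h
  have p := (S.total_ray_pos ht).2
  have p' := (S.total_ray_pos ht').2
  have key : ∀ {r r' : ℝ}, 0 < r → 0 < r' → ∀ {a a' : Bool}, r⁻¹ * bit a = r'⁻¹ * bit a' →
      a = a' := by
    intro r r' hr hr' a a' h
    have h1 := inv_pos.2 hr
    have h2 := inv_pos.2 hr'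
    cases a <;> cases a' <;> simp [bit] at h <;> first | rfl | (exfalso; linarith)
  dsimp only at h
  unfold ray at h p p'
  rw [← form_smul, ← form_smul, mul_zero, mul_zero] at h
  obtain ⟨h1, h2, -⟩ := S.form_injective h
  exact Prod.ext (funext fun j => key p p' (congrFun h1 j)) (funext fun k => key p p' (congrFun h2 k))

theorem ray_mem_extremeRays [Fintype K] [Fintype I] {t : (J → Bool) × (K → Bool)}
    (ht : S.Connected t) : (total (S.ray t))⁻¹ • S.ray t ∈ extremeRays S.family := by
  obtain ⟨hn, p⟩ := S.total_ray_pos ht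
  refine ⟨?_, fun t d => mul_nonneg (by positivity) (hn t d), ?_, ?_⟩
  · have := S.form_smul (total (S.ray t))⁻¹ 0 (fun j => bit (t.1 j)) (fun k => bit (t.2 k)) 0 0
    rw [mul_zero] at this
    exact ⟨_, _, _, _, this.symm⟩
  · rw [total_smul, inv_mul_cancel₀ p.ne']
  · rintro _ ⟨b', s', Q', q', rfl⟩ hs
    replace hs : SuppLE (S.form 0 b' s' Q' q') (S.ray t) := fun u d h => hs u d (by simp [h])
    obtain ⟨k1, k2⟩ := S.suppLE_form.1 hs
    simp only [apex_zero_bit, bit_eq_zero] at k1 k2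
    have k3 : ∀ k, t.2 k = true → s' k = apex 0 b' (S.left k) ∧ s' k = apex 0 b' (S.right k) := by
      intro k hk
      obtain ⟨e1, e2⟩ := ht.2.1 k hk
      have := (k1 k).2
      rw [hk, e1, e2] at this
      exact ⟨this.1 rfl, this.2 rfl⟩
    obtain ⟨r, hr⟩ := ht.2.2 b' (fun j hj => by
      obtain ⟨i, rfl⟩ := S.seg_surjective j
      exact (k2 i).1 hj) fun k hk => (k3 k hk).1.symm.trans (k3 k hk).2
    refine ⟨r * total (S.ray t), ?_⟩
    rw [smul_smul, mul_assoc, mul_inv_cancel₀ p.ne', mul_one, ray, ← form_smul]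
    have hQ : Q' = r • (0 : I → ℝ) := funext fun i => by simpa using (k2 i).2.1 rfl
    have hq : q' = r • (0 : I → ℝ) := funext fun i => by simpa using (k2 i).2.2.2.1 rfl
    have hs : s' = r • fun k => bit (t.2 k) := funext fun k => by
      cases hk : t.2 k
      · simpa [hk, bit] using (k1 k).1 hk
      · rw [(k3 k hk).1, hr]
        have e := (ht.2.1 k hk).1
        simp only [Pi.smul_apply, hk]
        cases hl : S.left k with
        | none => rw [hl] at e; cases e
        | some j =>
          rw [hl] at e
          have e : t.1 j = true := e
          simp [apex, e]
    rw [hQ, hq, hs, hr, mul_zero]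
    rfl

-- With `c = 0` the bounds `Q ≤ c` and `q ≤ c + Q` annihilate all `Q` and `q`. Only the comparisons
-- of `s` with apex values remain, and an extreme solution of these is a multiple of an indicator.
open Classical in
theorem exists_of_mem_extremeRays [Fintype K] [Fintype I] {x : Coords (K ⊕ I × Bool)}
    (hx : x ∈ extremeRays S.family) :
    ∃ t, S.Connected t ∧ (total (S.ray t))⁻¹ • S.ray t = x := by
  obtain ⟨⟨b, s, Q, q, rfl⟩, hn, ht, hr⟩ := hx
  obtain ⟨n1, n2⟩ := S.nonneg_form.1 hn
  have hQ : Q = 0 := funext fun i => by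
    obtain ⟨-, -, m1, m2, -⟩ := n2 i
    exact le_antisymm m2 m1
  subst hQ
  have hq : q = 0 := funext fun i => by
    obtain ⟨-, -, -, -, m1, -, m2⟩ := n2 i
    exact le_antisymm (by simpa using m2) m1
  subst hq
  have rigid : ∀ b' s', (∀ j, b j = 0 → b' j = 0) → (∀ k, s k = 0 → s' k = 0) →
      (∀ k, s k = apex 0 b (S.left k) → s' k = apex 0 b' (S.left k)) →
      (∀ k, s k = apex 0 b (S.right k) → s' k = apex 0 b' (S.right k)) →
      ∃ r : ℝ, b' = r • b ∧ s' = r • s := by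
    intro b' s' h1 h2 h3 h4
    obtain ⟨r, h⟩ := hr _ ⟨b', s', 0, 0, rfl⟩
      (S.suppLE_form.2 ⟨fun k => ⟨h2 k, h3 k, h4 k⟩, fun i => by
        have := h1 (S.seg i)
        simp only [Pi.zero_apply, add_zero, implies_true, true_and, and_true]
        exact ⟨this, fun h => (this h.symm).symm⟩⟩)
    rw [← form_smul, mul_zero] at h
    obtain ⟨h1, h2, -⟩ := S.form_injective h
    exact ⟨r, h1, h2⟩
  have hj : ∃ j, b j ≠ 0 := by
    by_contra! h
    have hb : b = 0 := funext h
    subst hb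
    have hs : s = 0 := funext fun k => by
      obtain ⟨-, m1, m2, -⟩ := n1 k
      have : apex 0 (0 : J → ℝ) (S.left k) = 0 := by cases S.left k <;> rfl
      exact le_antisymm (m2.trans this.le) m1
    subst hs
    rw [form_zero] at ht
    simp [total] at ht
  obtain ⟨j, hj⟩ := hj
  have e : ∀ o : Option J, apex 0 (fun m => if b m = b j then (1 : ℝ) else 0) o =
      if apex 0 b o = b j then 1 else 0 := by
    rintro (_ | m)
    · simp [apex, hj.symm]
    · rfl
  -- The indicator of the level set of a nonzero value is supported in the solution and keeps its
  -- tight inequalities tight, so it is proportional to the solution.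
  obtain ⟨r, hb, hs⟩ := rigid (fun m => if b m = b j then 1 else 0)
    (fun k => if s k = b j then 1 else 0) (fun m hm => by simp [hm, hj.symm])
    (fun k hk => by simp [hk, hj.symm]) (fun k hk => by rw [e, hk]) fun k hk => by rw [e, hk]
  have hrj : r * b j = 1 := by simpa using (congrFun hb j).symm
  have hr0 : r ≠ 0 := by rintro rfl; simp at hrj
  have hbit : ∀ {y : ℝ}, (if y = b j then (1 : ℝ) else 0) = r * y →
      bit (decide (y ≠ 0)) = r * y := by
    intro y hy
    split_ifs at hy with h
    · simp [h, hj, bit, hrj]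
    · have : y = 0 := (mul_eq_zero.1 hy.symm).resolve_left hr0
      simp [this, bit]
  have e1 : (fun m => bit (decide (b m ≠ 0))) = r • b := funext fun m => hbit (congrFun hb m)
  have e2 : (fun k => bit (decide (s k ≠ 0))) = r • s := funext fun k => hbit (congrFun hs k)
  have e3 : S.ray (fun m => decide (b m ≠ 0), fun k => decide (s k ≠ 0)) =
      r • S.form 0 b s 0 0 := by
    unfold ray
    dsimp only
    rw [e1, e2, ← form_smul, mul_zero, smul_zero]
  have hap : ∀ o : Option J, o.elim false (fun j => decide (b j ≠ 0)) = true ↔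
      apex 0 b o ≠ 0 := by
    rintro (_ | j) <;> simp [apex]
  have hap' : ∀ v : J → ℝ, (∀ j, b j = 0 → v j = 0) → ∀ o : Option J, apex 0 b o = 0 →
      apex 0 v o = 0 := by
    rintro v hv (_ | j) h
    · rfl
    · exact hv j h
  refine ⟨(fun m => decide (b m ≠ 0), fun k => decide (s k ≠ 0)),
    ⟨⟨j, by simpa using hj⟩, fun k hk => ?_, fun v v1 v2 => ?_⟩, ?_⟩
  rotate_left 2
  · rw [e3, total_smul, ht, mul_one, smul_smul, inv_mul_cancel₀ hr0, one_smul]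
  · simp only [hap]
    obtain ⟨-, m0, m1, m2⟩ := n1 k
    have hk : s k ≠ 0 := by simpa using hk
    have : 0 < s k := lt_of_le_of_ne m0 hk.symm
    exact ⟨(this.trans_le m1).ne', (this.trans_le m2).ne'⟩
  · have w1 : ∀ j, b j = 0 → v j = 0 := fun j hj => v1 j (by simpa using hj)
    have w2 : ∀ k, s k ≠ 0 → apex 0 v (S.left k) = apex 0 v (S.right k) :=
      fun k hk => v2 k (by simpa using hk)
    obtain ⟨r', h, -⟩ := rigid v (fun k => if s k = 0 then 0 else apex 0 v (S.left k)) w1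
      (fun k hk => by simp [hk])
      (fun k hk => by
        split_ifs with h
        · exact (hap' v w1 _ (hk ▸ h)).symm
        · rfl)
      (fun k hk => by
        split_ifs with h
        · exact (hap' v w1 _ (hk ▸ h)).symm
        · exact w2 k h)
    refine ⟨r' * r⁻¹, funext fun m => ?_⟩
    have := congrFun e1 m
    dsimp only at this ⊢
    rw [this, h]
    simp only [Pi.smul_apply, smul_eq_mul]
    field_simp

theorem encard_extremeRays_family [Fintype K] [Fintype I] :
    (extremeRays S.family).encard = {t | S.Connected t}.encard := by
  rw [← S.ray_injOn.encard_image]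
  congr 1
  refine Set.Subset.antisymm (fun _ hx => S.exists_of_mem_extremeRays hx) ?_
  rintro _ ⟨t, ht, rfl⟩
  exact S.ray_mem_extremeRays ht

/-! ### The four shapes that are needed -/

/-- A chain with one segment of `r + 1` caps. -/
def oneSegment (r : ℕ) : Shape Unit Bool (Fin (r + 1)) where
  left k := if k then some () else none
  right k := if k then none else some ()
  seg _ := ()
  seg_surjective _ := ⟨0, rfl⟩

/-- A chain with two segments; cap `i` lies in segment `f i`. -/
def twoSegments {r : ℕ} (f : Fin r → Bool) (hf : f.Surjective) : Shape Bool (Fin 3) (Fin r) where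
  left k := ![none, some false, some true] k
  right k := ![some false, some true, none] k
  seg := f
  seg_surjective := hf

/-- Either snapped tetrahedron with `s = 1` ties the segment to a fixed end of the chain, and a
nonzero `q` ties it directly; nothing else can hold it when `b = 1`. -/
theorem pinned_oneSegment {r : ℕ} {t : Choice Unit Bool (Fin (r + 1))} :
    (oneSegment r).Pinned t ↔
      (t.1 () = true → t.2.1 false = true ∨ t.2.1 true = true ∨ ∃ i, t.2.2.2 i = true) := by
  constructor
  · intro h ht
    by_contra! hh
    have := congrFun (h (fun _ => 1) (fun j hj => by cases j; simp [ht] at hj)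
      (fun k hk => by cases k <;> simp_all) fun i _ hi => by simp_all) ()
    exact one_ne_zero this
  · intro h v h1 h2 h3
    funext j
    cases j
    cases ht : t.1 ()
    · exact h1 _ ht
    · rcases h ht with h | h | ⟨i, h⟩
      · exact (h2 _ h).symm
      · exact h2 _ h
      · exact h3 i ht h

theorem connected_oneSegment {r : ℕ} {t : (Unit → Bool) × (Bool → Bool)} :
    (oneSegment r).Connected t ↔ t.1 () = true ∧ ∀ k, t.2 k = false := by
  constructor
  · rintro ⟨⟨⟨⟩, h1⟩, h2, -⟩
    refine ⟨h1, fun k => ?_⟩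
    cases hk : t.2 k
    · rfl
    · have := h2 k hk
      cases k <;> simp [oneSegment] at this
  · rintro ⟨h1, h2⟩
    exact ⟨⟨(), h1⟩, fun k hk => by simp [h2] at hk,
      fun v _ _ => ⟨v (), funext fun j => by cases j; simp [h1, bit]⟩⟩

section twoSegments

variable {r : ℕ} {f : Fin r → Bool} {hf : f.Surjective}

/-- Each segment with `b = 1` must be connected to something fixed, an outer tetrahedron or a
nonzero `q`, either itself or through the middle tetrahedron and the other segment. -/
theorem pinned_twoSegments {t : Choice Bool (Fin 3) (Fin r)}
    (hc : (twoSegments f hf).Canonical t) : (twoSegments f hf).Pinned t ↔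
      (t.1 false = true → (t.2.1 0 = true ∨ ∃ i, f i = false ∧ t.2.2.2 i = true) ∨
        t.2.1 1 = true ∧ (t.2.1 2 = true ∨ ∃ i, f i = true ∧ t.2.2.2 i = true)) ∧
      (t.1 true = true → (t.2.1 2 = true ∨ ∃ i, f i = true ∧ t.2.2.2 i = true) ∨
        t.2.1 1 = true ∧ (t.2.1 0 = true ∨ ∃ i, f i = false ∧ t.2.2.2 i = true)) := by
  have hm : t.2.1 1 = true → t.1 false = true ∧ t.1 true = true := hc.1 1
  have h0 : t.2.1 0 = true → t.1 false = true := fun h => (hc.1 0 h).2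
  have h2 : t.2.1 2 = true → t.1 true = true := fun h => (hc.1 2 h).1
  have key : ∀ v : Bool → ℝ, (∀ k, t.2.1 k = true → apex 0 v ((twoSegments f hf).left k) =
      apex 0 v ((twoSegments f hf).right k)) ↔ (t.2.1 0 = true → v false = 0) ∧
      (t.2.1 1 = true → v false = v true) ∧ (t.2.1 2 = true → v true = 0) := by
    intro v
    simp [Fin.forall_fin_succ, twoSegments, apex, eq_comm (a := (0 : ℝ))]
  unfold Pinned
  simp only [key]
  constructor
  · intro h
    constructor
    · intro hF
      by_contra! hh
      -- The test vector is the indicator of the component of segment `false`, which contains the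
      -- other segment when the middle tetrahedron ties them.
      have := congrFun (h (fun j => if j = false ∨ t.2.1 1 = true then 1 else 0) ?_ ?_ ?_) false
      · simp at this
      · rintro (_ | _) hj
        · simp [hF] at hj
        · have : t.2.1 1 ≠ true := fun h => by simp [(hm h).2] at hj
          simp [this]
      · refine ⟨fun h => absurd h hh.1.1, fun h => by simp [h], fun h => ?_⟩
        have : t.2.1 1 ≠ true := fun h' => (hh.2 h').1 h
        simp [this]
      · intro i hi hi'
        have e1 : f i ≠ false := fun h => hh.1.2 i h hi'
        have e2 : t.2.1 1 ≠ true := fun h => (hh.2 h).2 i (by simpa using e1) hi'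
        simp [twoSegments, e1, e2]
    · intro hT
      by_contra! hh
      have := congrFun (h (fun j => if j = true ∨ t.2.1 1 = true then 1 else 0) ?_ ?_ ?_) true
      · simp at this
      · rintro (_ | _) hj
        · have : t.2.1 1 ≠ true := fun h => by simp [(hm h).1] at hj
          simp [this]
        · simp [hT] at hj
      · refine ⟨fun h => ?_, fun h => by simp [h], fun h => absurd h hh.1.1⟩
        have : t.2.1 1 ≠ true := fun h' => (hh.2 h').1 h
        simp [this]
      · intro i hi hi'
        have e1 : f i ≠ true := fun h => hh.1.2 i h hi'
        have e2 : t.2.1 1 ≠ true := fun h => (hh.2 h).2 i (by simpa using e1) hi'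
        simp [twoSegments, e1, e2]
  · rintro ⟨hF, hT⟩ v v1 ⟨v2, v3, v4⟩ v5
    have aF : t.1 false = true → (t.2.1 0 = true ∨ ∃ i, f i = false ∧ t.2.2.2 i = true) →
        v false = 0 := by
      rintro hb (h | ⟨i, hi, h⟩)
      · exact v2 h
      · have := v5 i (by simpa [twoSegments, hi] using hb) h
        simpa [twoSegments, hi] using this
    have aT : t.1 true = true → (t.2.1 2 = true ∨ ∃ i, f i = true ∧ t.2.2.2 i = true) →
        v true = 0 := by
      rintro hb (h | ⟨i, hi, h⟩)
      · exact v4 h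
      · have := v5 i (by simpa [twoSegments, hi] using hb) h
        simpa [twoSegments, hi] using this
    funext j
    cases j
    · cases hb : t.1 false
      · exact v1 _ hb
      · rcases hF hb with h | ⟨h, h'⟩
        · exact aF hb h
        · exact (v3 h).trans (aT (hm h).2 h')
    · cases hb : t.1 true
      · exact v1 _ hb
      · rcases hT hb with h | ⟨h, h'⟩
        · exact aT hb h
        · exact (v3 h).symm.trans (aF (hm h).1 h')

/-- The outer tetrahedra have an apex value `c = 0`, so their `s` vanishes. The supports are either
segment alone, or both linked by the middle tetrahedron. -/
theorem connected_twoSegments {t : (Bool → Bool) × (Fin 3 → Bool)} :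
    (twoSegments f hf).Connected t ↔ (t.1 false = true ∨ t.1 true = true) ∧ t.2 0 = false ∧
      t.2 2 = false ∧ t.2 1 = (t.1 false && t.1 true) := by
  have key : ∀ v : Bool → ℝ, t.2 0 = false → t.2 2 = false →
      ((∀ k, t.2 k = true → apex 0 v ((twoSegments f hf).left k) =
      apex 0 v ((twoSegments f hf).right k)) ↔ (t.2 1 = true → v false = v true)) := by
    intro v e1 e2
    simp [Fin.forall_fin_succ, twoSegments, apex, e1, e2]
  constructor
  · rintro ⟨h1, h2, h3⟩
    have e0 : t.2 0 = false := by
      by_contra h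
      have := (h2 0 (by simpa using h)).1
      simp [twoSegments] at this
    have e2 : t.2 2 = false := by
      by_contra h
      have := (h2 2 (by simpa using h)).2
      simp [twoSegments] at this
    refine ⟨by simpa [Bool.exists_bool] using h1, e0, e2, ?_⟩
    simp only [key _ e0 e2] at h3
    cases hm : t.2 1
    · cases hF : t.1 false
      · rfl
      · cases hT : t.1 true
        · rfl
        -- With both segments on and no link, the indicator of one segment is a competitor that is
        -- not proportional to that of both.
        · obtain ⟨r, hr⟩ := h3 (fun j => if j then 1 else 0)
            (by rintro (_ | _) h <;> simp_all) (by simp [hm])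
          have r1 := congrFun hr false
          have r2 := congrFun hr true
          simp [hF, bit] at r1
          simp [hT, bit, ← r1] at r2
    · have := h2 1 hm
      simp [twoSegments] at this
      simp [this]
  · rintro ⟨h1, e0, e2, h3⟩
    refine ⟨by simpa [Bool.exists_bool] using h1, fun k hk => ?_, ?_⟩
    · fin_cases k
      · simp [e0] at hk
      · rw [show t.2 1 = true from hk] at h3
        simpa [twoSegments] using h3.symm
      · simp [e2] at hk
    · simp only [key _ e0 e2]
      intro v v1 v2
      cases hF : t.1 false
      · have := v1 _ hF
        refine ⟨v true, funext fun j => ?_⟩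
        cases j <;> simp_all [bit]
      · refine ⟨v false, funext fun j => ?_⟩
        cases j
        · simp [hF, bit]
        · cases hT : t.1 true
          · simp [v1 _ hT, bit]
          · rw [hF, hT] at h3
            simp [v2 h3, bit]

end twoSegments

instance {J K I : Type} [Fintype K] [Fintype I] (S : Shape J K I) (t : Choice J K I) :
    Decidable (S.Canonical t) :=
  inferInstanceAs (Decidable ((∀ _, _ → _ ∧ _) ∧ ∀ _, _ → _ ∨ _))

theorem encard_setOf {α : Type} [Fintype α] {p q : α → Prop} [DecidablePred q]
    (h : ∀ a, p a ↔ q a) {n : ℕ} (hn : (Finset.univ.filter q).card = n) :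
    {a | p a}.encard = n := by
  have : {a | p a} = ((Finset.univ.filter q : Finset α) : Set α) := by
    ext a; simp [h]
  rw [this, Set.encard_coe_eq_coe_finsetCard, hn]

/-- The count splits by the bit `b`: for `b = 0` the cap alone gives `3`; for `b = 1` there are `2 ^
4` choices, of which the `2` with all `s` and `q` zero are not pinned. -/
theorem encard_oneSegment_one :
    {t | (oneSegment 0).Canonical t ∧ (oneSegment 0).Pinned t}.encard = (17 : ℕ) :=
  encard_setOf (fun _ => and_congr_right fun _ => pinned_oneSegment) (by decide +kernel)

/-- Here `b = 0` gives `3 ^ 2`, and `b = 1` gives `2 ^ 6 - 4`. -/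
theorem encard_oneSegment_two :
    {t | (oneSegment 1).Canonical t ∧ (oneSegment 1).Pinned t}.encard = (69 : ℕ) :=
  encard_setOf (fun _ => and_congr_right fun _ => pinned_oneSegment) (by decide +kernel)

theorem encard_connected_oneSegment (r : ℕ) :
    {t | (oneSegment r).Connected t}.encard = (1 : ℕ) :=
  encard_setOf (fun _ => connected_oneSegment) (by decide +kernel)

theorem encard_connected_twoSegments {r : ℕ} {f : Fin r → Bool} {hf : f.Surjective} :
    {t | (twoSegments f hf).Connected t}.encard = (3 : ℕ) :=
  encard_setOf (fun _ => connected_twoSegments) (by decide +kernel)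

/-- Two segments with one cap each. -/
def twoSmall : Shape Bool (Fin 3) (Fin 2) := twoSegments ![false, true] (by decide)

/-- Two segments, with two caps and one. -/
def twoLarge : Shape Bool (Fin 3) (Fin 3) := twoSegments ![false, false, true] (by decide)

/-- By the values of the two bits `b`: `9` for neither, `18 + 18` for exactly one, and `36 + 60` for
both, without or with the middle link. -/
theorem encard_twoSmall :
    {t | twoSmall.Canonical t ∧ twoSmall.Pinned t}.encard = (141 : ℕ) :=
  encard_setOf (fun _ => and_congr_right fun h => pinned_twoSegments h) (by decide +kernel)

/-- By the values of the two bits `b`: `27` for neither, `84 + 54` for exactly one, and `168 + 248`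
for both, without or with the middle link. -/
theorem encard_twoLarge :
    {t | twoLarge.Canonical t ∧ twoLarge.Pinned t}.encard = (581 : ℕ) :=
  encard_setOf (fun _ => and_congr_right fun h => pinned_twoSegments h) (by decide +kernel)

end Shape

/-! ### Vertices of the projective solution space and solutions along a word -/

/-- A point of the projective solution space is a vertex if and only if it is determined up to
scaling by its zero coordinates. -/
theorem mem_extremePoints_projectiveSolutionSpace {n : ℕ} (T : FaceGluing n) (x : DiscType n → ℝ) :
    x ∈ T.projectiveSolutionSpace.extremePoints ℝ ↔ x ∈ T.projectiveSolutionSpace ∧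
      ∀ y, T.Matching y → (∀ d, x d = 0 → y d = 0) → ∃ r : ℝ, y = r • x := by
  have lin : ∀ (r r' : ℝ) (x y : DiscType n → ℝ), T.Matching x → T.Matching y →
      T.Matching (r • x + r' • y) := by
    intro r r' x y hx hy t i v hv
    have e : ∀ t i v, FaceGluing.arcCount (r • x + r' • y) t i v =
        r * FaceGluing.arcCount x t i v + r' * FaceGluing.arcCount y t i v := by
      intro t i v
      simp only [FaceGluing.arcCount, Fin.sum_univ_three, Pi.add_apply, Pi.smul_apply, smul_eq_mul]
      split_ifs <;> ring
    rw [e, e, hx t i v hv, hy t i v hv]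
  rw [mem_extremePoints_iff_left]
  refine and_congr_right fun hx => ⟨fun h y hy hs => ?_, fun h x₁ h₁ x₂ h₂ hseg => ?_⟩
  -- Removing a multiple of `x` makes the coordinate sum zero, so `x + ε z` and `x - ε z` are points
  -- of the polytope for small `ε`, with midpoint `x`.
  · set z := y - (∑ d, y d) • x with hz
    have hzs : ∑ d, z d = 0 := by
      simp [hz, Finset.sum_sub_distrib, ← Finset.mul_sum, hx.2.2]
    have hzm : T.Matching z := by
      simpa [hz, sub_eq_add_neg] using lin 1 (-∑ d, y d) y x hy hx.2.1
    have hz0 : ∀ d, x d = 0 → z d = 0 := fun d hd => by simp [hz, hd, hs d hd]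
    obtain ⟨ε, hε, hb⟩ : ∃ ε > 0, ∀ d, ε * |z d| ≤ x d := by
      have : ∀ᶠ ε : ℝ in nhdsWithin 0 (Set.Ioi 0), ∀ d, ε * |z d| ≤ x d := by
        rw [Filter.eventually_all]
        intro d
        rcases eq_or_ne (x d) 0 with hd | hd
        · simp [hd, hz0 d hd]
        · have hpos : 0 < x d := lt_of_le_of_ne (hx.1 d) hd.symm
          have ht : Filter.Tendsto (fun ε : ℝ => ε * |z d|) (nhdsWithin 0 (Set.Ioi 0)) (nhds 0) := by
            have : Continuous fun ε : ℝ => ε * |z d| := by fun_prop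
            simpa using (this.tendsto 0).mono_left nhdsWithin_le_nhds
          exact (ht.eventually (gt_mem_nhds hpos)).mono fun _ h => le_of_lt h
      obtain ⟨ε, h1, h2⟩ := (this.and self_mem_nhdsWithin).exists
      exact ⟨ε, h2, h1⟩
    have mem : ∀ δ : ℝ, |δ| = ε → x + δ • z ∈ T.projectiveSolutionSpace := by
      intro δ hδ
      refine ⟨fun d => ?_, by simpa using lin 1 δ x z hx.2.1 hzm, ?_⟩
      · have h1 := hb d
        rw [← hδ, ← abs_mul] at h1
        have := neg_abs_le (δ * z d)
        simp only [Pi.add_apply, Pi.smul_apply, smul_eq_mul]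
        linarith
      · simp [Finset.sum_add_distrib, ← Finset.mul_sum, hzs, hx.2.2]
    have := h _ (mem ε (abs_of_pos hε)) _ (mem (-ε) (by rw [abs_neg, abs_of_pos hε]))
      ⟨1 / 2, 1 / 2, by norm_num, by norm_num, by norm_num, by
        funext d; simp; ring⟩
    have hz' : z = 0 := by
      have h1 : ε • z = 0 := by simpa using this
      exact (smul_eq_zero.1 h1).resolve_left hε.ne'
    exact ⟨∑ d, y d, sub_eq_zero.1 hz'⟩
  · obtain ⟨a, b, ha, hb, -, hab⟩ := hseg
    -- By nonnegativity an endpoint of a segment through `x` vanishes where `x` does, so it is a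
    -- multiple of `x`; the normalization makes the factor `1`.
    obtain ⟨r, hr⟩ := h x₁ h₁.2.1 fun d hd => by
      have := congrFun hab d
      simp only [Pi.add_apply, Pi.smul_apply, smul_eq_mul, hd] at this
      have m1 := mul_nonneg ha.le (h₁.1 d)
      have m2 := mul_nonneg hb.le (h₂.1 d)
      exact (mul_eq_zero.1 (by linarith : a * x₁ d = 0)).resolve_left ha.ne'
    have hs := h₁.2.2
    simp only [hr, Pi.smul_apply, smul_eq_mul, ← Finset.mul_sum, hx.2.2, mul_one] at hs
    rw [hr, hs, one_smul]

namespace Word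

noncomputable instance (w : Word) : Fintype w.ported.Cell := Fintype.ofFinite _

/-- Solutions with all arcs at both ends equal to `c`. -/
def family (w : Word) (c : ℝ) (x : Coords w.ported.Cell) : Prop := w.Flow c c c x

theorem flow_zero (w : Word) : w.Flow 0 0 0 fun _ _ => 0 := by
  have e1 : (fun _ => 0 : Discs → ℝ) = snapTet 0 0 0 0 := by
    funext d; rcases d with d | d <;> fin_cases d <;> simp [snapTet]
  have e2 : (fun _ => 0 : Discs → ℝ) = outerTet 0 0 0 := by
    funext d; rcases d with d | d <;> fin_cases d <;> simp [outerTet]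
  have e3 : (fun _ => 0 : Discs → ℝ) = innerTet 0 0 0 0 := by
    funext d; rcases d with d | d <;> fin_cases d <;> simp [innerTet]
  induction w with
  | snap => exact ⟨0, e1⟩
  | twist w ih => exact ⟨ih, 0, e1⟩
  | join w ih => exact ⟨0, ih, 0, e1⟩
  | cap w ih => exact ⟨ih, 0, 0, e2, e3⟩

theorem flow_combine (w : Word) {c a b c' a' b' : ℝ} {x x' : Coords w.ported.Cell}
    (h : w.Flow c a b x) (h' : w.Flow c' a' b' x') (r r' : ℝ) :
    w.Flow (r * c + r' * c') (r * a + r' * a') (r * b + r' * b') (r • x + r' • x') := by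
  have e1 : ∀ c a b s c' a' b' s', r • snapTet c a b s + r' • snapTet c' a' b' s' =
      snapTet (r * c + r' * c') (r * a + r' * a') (r * b + r' * b') (r * s + r' * s') := by
    intros
    funext d; rcases d with d | d <;> fin_cases d <;> simp [snapTet] <;> ring
  have e2 : ∀ c b Q c' b' Q', r • outerTet c b Q + r' • outerTet c' b' Q' =
      outerTet (r * c + r' * c') (r * b + r' * b') (r * Q + r' * Q') := by
    intros
    funext d; rcases d with d | d <;> fin_cases d <;> simp [outerTet] <;> ring
  have e3 : ∀ c b Q q c' b' Q' q', r • innerTet c b Q q + r' • innerTet c' b' Q' q' =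
      innerTet (r * c + r' * c') (r * b + r' * b') (r * Q + r' * Q') (r * q + r' * q') := by
    intros
    funext d; rcases d with d | d <;> fin_cases d <;> simp [innerTet] <;> ring
  have e : ∀ {T : Type} (x x' : Coords T) (t : T), (r • x + r' • x') t = r • x t + r' • x' t :=
    fun _ _ _ => rfl
  induction w generalizing b b' with
  | snap =>
    obtain ⟨s, hs⟩ := h
    obtain ⟨s', hs'⟩ := h'
    exact ⟨r * s + r' * s', by rw [e, hs, hs', e1]⟩
  | twist w ih =>
    obtain ⟨h, s, hs⟩ := h
    obtain ⟨h', s', hs'⟩ := h'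
    exact ⟨ih h h', r * s + r' * s', by rw [e, hs, hs', e1]⟩
  | join w ih =>
    obtain ⟨d, h, s, hs⟩ := h
    obtain ⟨d', h', s', hs'⟩ := h'
    exact ⟨_, ih h h', r * s + r' * s', by rw [e, hs, hs', e1]⟩
  | cap w ih =>
    obtain ⟨h, Q, q, hs, ht⟩ := h
    obtain ⟨h', Q', q', hs', ht'⟩ := h'
    exact ⟨ih h h', r * Q + r' * Q', r * q + r' * q', by rw [e, hs, hs', e2],
      by rw [e, ht, ht', e3]⟩

theorem exists_flow_coord (w : Word) :
    ∃ t d, ∀ c a b (x : Coords w.ported.Cell), w.Flow c a b x → x t d = c := by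
  induction w with
  | snap => exact ⟨(), .inl 1, fun c a b x ⟨s, hs⟩ => by rw [hs]; rfl⟩
  | twist w ih =>
    obtain ⟨t, d, h⟩ := ih
    exact ⟨.inl t, d, fun c a b x hx => h _ _ _ _ hx.1⟩
  | join w ih =>
    obtain ⟨t, d, h⟩ := ih
    exact ⟨.inl t, d, fun c a b x ⟨_, hx, _⟩ => h _ _ _ _ hx⟩
  | cap w ih =>
    obtain ⟨t, d, h⟩ := ih
    exact ⟨.inl t, d, fun c a b x hx => h _ _ _ _ hx.1⟩

theorem isLinear_family (w : Word) : IsLinear w.family where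
  zero := w.flow_zero
  combine h h' r r' := w.flow_combine h h' r r'
  coord := by
    obtain ⟨t, d, h⟩ := w.exists_flow_coord
    exact ⟨t, d, fun c x => h c c c x⟩

/-- The number of admissible vertices of a closed-up chain. -/
theorem admissibleVertexCount_eq {n : ℕ} (w : Word) (T : FaceGluing n)
    (e : w.ported.closeTwist.Cell ≃ Fin n)
    (hT : ∀ x : DiscType n → ℝ, T.Matching x ↔
      w.ported.closeTwist.Matched fun t d => x (e t, d)) :
    T.admissibleVertexCount = (rigidPoints w.family).encard + (extremeRays w.family).encard := by
  rw [← encard_vertices w.isLinear_family]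
  let k : w.ported.Cell ≃ Fin n :=
    { toFun := fun t => e (.inl t)
      invFun := fun i => Sum.elim id Fin.elim0 (e.symm i)
      left_inv := fun t => by simp
      right_inv := fun i => by
        rcases h : e.symm i with t | t
        · dsimp only
          rw [h, Sum.elim_inl, id, ← h, e.apply_symm_apply]
        · exact t.elim0 }
  let Φ : Coords w.ported.Cell → DiscType n → ℝ := fun y p => y (k.symm p.1) p.2
  let Ψ : (DiscType n → ℝ) → Coords w.ported.Cell := fun x t d => x (k t, d)
  have hΦ : ∀ x, Φ (Ψ x) = x := fun x => funext fun p => by simp [Φ, Ψ]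
  have hΨ : ∀ y, Ψ (Φ y) = y := fun y => funext fun t => funext fun d => by simp [Φ, Ψ]
  have inj : Function.Injective Φ := Function.LeftInverse.injective hΨ
  have hfam : ∀ x, (T.Matching x ∧ FaceGluing.QuadConstraints x) ↔ ∃ c, w.family c (Ψ x) := by
    intro x
    rw [hT]
    refine Iff.trans (and_congr_right fun _ => ?_) (w.matched_closeTwist_iff fun t d => x (e t, d))
    constructor
    · intro h t q q'
      exact h (e t) q q'
    · intro h t q q'
      have := h (e.symm t) q q'
      simpa using this
  have htot : ∀ x, ∑ d, x d = total (Ψ x) := by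
    intro x
    rw [Fintype.sum_prod_type, ← k.sum_comp]
    rfl
  rw [FaceGluing.admissibleVertexCount, ← inj.encard_image]
  congr 1
  ext x
  have hmem : x ∈ Φ '' vertices w.family ↔ Ψ x ∈ vertices w.family := by
    constructor
    · rintro ⟨y, hy, rfl⟩
      rwa [hΨ]
    · intro h
      exact ⟨_, h, hΦ x⟩
  rw [hmem]
  change (_ ∧ _) ↔ _
  rw [mem_extremePoints_projectiveSolutionSpace]
  constructor
  · rintro ⟨⟨⟨h1, h2, h3⟩, h4⟩, h5⟩
    refine ⟨(hfam x).1 ⟨h2, h5⟩, fun t d => h1 _, by rw [← htot, h3], fun c y hy hs => ?_⟩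
    have hy' : T.Matching (Φ y) := ((hfam (Φ y)).2 ⟨c, by rwa [hΨ]⟩).1
    obtain ⟨r, hr⟩ := h4 (Φ y) hy' fun d hd => hs _ _ (by simpa [Ψ] using hd)
    refine ⟨r, ?_⟩
    rw [← hΨ y, hr]
    rfl
  · rintro ⟨h1, h2, h3, h4⟩
    obtain ⟨h5, h6⟩ := (hfam x).2 h1
    refine ⟨⟨⟨fun d => ?_, h5, by rw [htot, h3]⟩, fun y hy hs => ?_⟩, h6⟩
    · have := h2 (k.symm d.1) d.2
      simpa [Ψ] using this
    -- The polytope ignores the quadrilateral constraints, but a competitor `y` supported in the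
    -- admissible `x` inherits them, so it lies in the linear family.
    · obtain ⟨c, hc⟩ := (hfam y).1 ⟨hy, fun t q q' hq hq' =>
        h6 t q q' (fun h => hq (hs _ h)) fun h => hq' (hs _ h)⟩
      obtain ⟨r, hr⟩ := h4 c _ hc fun t d hd => hs _ hd
      refine ⟨r, ?_⟩
      rw [← hΦ y, hr, ← hΦ x]
      simp only [hΨ]
      rfl

end Word

end

/-! ### Splitting a chain at its twists, and the counts -/

section

open Coords Ported

theorem encard_rigidPoints_congr {T T' : Type} (e : T' ≃ T) {L : ℝ → Coords T → Prop}
    {L' : ℝ → Coords T' → Prop} (h : ∀ c x, L c x ↔ L' c fun t => x (e t)) :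
    (rigidPoints L).encard = (rigidPoints L').encard := by
  have inj : Function.Injective fun (x : Coords T) t => x (e t) := e.surjective.injective_comp_right
  rw [← inj.encard_image]
  congr 1
  ext y
  obtain ⟨x, rfl⟩ : ∃ x : Coords T, (fun t => x (e t)) = y :=
    ⟨fun t => y (e.symm t), by simp⟩
  rw [inj.mem_set_image]
  refine and_congr (h 1 x) (and_congr ⟨fun h t => h (e t), fun h t d => by
    simpa using h (e.symm t) d⟩ ?_)
  constructor
  · intro hx z hz hs
    have h0 := hx (fun t => z (e.symm t)) ((h _ _).2 (by simpa using hz)) fun t d ht => by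
      obtain ⟨t, rfl⟩ := e.surjective t
      simpa using hs t d ht
    have := congrArg (fun (x : Coords T) t => x (e t)) h0
    exact (funext fun t => by simp : z = fun t => z (e.symm (e t))).trans this
  · intro hx z hz hs
    have h0 := hx (fun t => z (e t)) ((h _ _).1 hz) fun t d ht => hs (e t) d ht
    exact inj h0

theorem encard_extremeRays_congr {T T' : Type} [Fintype T] [Fintype T'] (e : T' ≃ T)
    {L : ℝ → Coords T → Prop} {L' : ℝ → Coords T' → Prop}
    (h : ∀ c x, L c x ↔ L' c fun t => x (e t)) :
    (extremeRays L).encard = (extremeRays L').encard := by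
  have inj : Function.Injective fun (x : Coords T) t => x (e t) := e.surjective.injective_comp_right
  rw [← inj.encard_image]
  congr 1
  ext y
  obtain ⟨x, rfl⟩ : ∃ x : Coords T, (fun t => x (e t)) = y :=
    ⟨fun t => y (e.symm t), by simp⟩
  rw [inj.mem_set_image]
  have htot : total (fun t => x (e t)) = total x := by
    unfold total
    exact e.sum_comp fun t => ∑ d, x t d
  refine and_congr (h 0 x) (and_congr ⟨fun h t => h (e t), fun h t d => by
    simpa using h (e.symm t) d⟩
    (and_congr (by rw [htot]) ?_))
  constructor
  · intro hx z hz hs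
    obtain ⟨r, h0⟩ := hx (fun t => z (e.symm t)) ((h _ _).2 (by simpa using hz)) fun t d ht => by
      obtain ⟨t, rfl⟩ := e.surjective t
      simpa using hs t d ht
    refine ⟨r, ?_⟩
    have := congrArg (fun (x : Coords T) t => x (e t)) h0
    exact (funext fun t => by simp : z = fun t => z (e.symm (e t))).trans this
  · intro hx z hz hs
    obtain ⟨r, h0⟩ := hx (fun t => z (e t)) ((h _ _).1 hz) fun t d ht => hs (e t) d ht
    exact ⟨r, inj h0⟩

namespace Word

/-- The number of tetrahedra. -/
def size : Word → ℕ
  | snap => 1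
  | twist w => w.size + 1
  | join w => w.size + 1
  | cap w => w.size + 2

theorem card_cell (w : Word) : Nat.card w.ported.Cell = w.size := by
  induction w with
  | snap => exact Nat.card_unique
  | twist w ih =>
    change Nat.card (w.ported.Cell ⊕ Unit) = w.size + 1
    rw [Nat.card_sum, ih, Nat.card_unique]
  | join w ih =>
    change Nat.card (w.ported.Cell ⊕ Unit) = w.size + 1
    rw [Nat.card_sum, ih, Nat.card_unique]
  | cap w ih =>
    change Nat.card (w.ported.Cell ⊕ Bool) = w.size + 2
    rw [Nat.card_sum, ih, Nat.card_eq_fintype_card, Fintype.card_bool]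

/-- One segment with one cap. -/
abbrev small : Word := join (cap snap)

/-- One segment with two caps. -/
abbrev medium : Word := join (cap (cap snap))

/-- `m` further blocks appended to a chain. -/
def extend (w : Word) : ℕ → Word
  | 0 => w
  | m + 1 => join (cap (twist (extend w m)))

theorem size_extend (w : Word) (m : ℕ) : (w.extend m).size = w.size + 4 * m := by
  induction m with
  | zero => rfl
  | succ m ih => simp only [extend, size, ih]; ring

/-- The cells of a chain with one more block. -/
def appendEquiv (w : Word) :
    w.ported.Cell ⊕ small.ported.Cell ≃ (join (cap (twist w))).ported.Cell where
  toFun := Sum.elim (fun t => (Sum.inl (Sum.inl (Sum.inl t)) : ((w.ported.Cell ⊕ Unit) ⊕ Bool) ⊕ Unit))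
    (Sum.elim (Sum.elim (fun u => Sum.inl (Sum.inl (Sum.inr u))) fun b => Sum.inl (Sum.inr b))
      Sum.inr)
  invFun := Sum.elim (Sum.elim (Sum.elim
    (fun t => (Sum.inl t : w.ported.Cell ⊕ ((Unit ⊕ Bool) ⊕ Unit)))
    (fun u => Sum.inr (Sum.inl (Sum.inl u)))) fun b => Sum.inr (Sum.inl (Sum.inr b)))
    fun u => Sum.inr (Sum.inr u)
  left_inv := by rintro (_ | (_ | _) | _) <;> rfl
  right_inv := by rintro (((_ | _) | _) | _) <;> rfl

/-- The twist fixes the apex numbers on its two sides to be `c`. So both parts satisfy the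
conditions of a separately closed chain, and the proof merely regroups the data. -/
theorem family_append (w : Word) (c : ℝ) (x : Coords w.ported.Cell)
    (y : Coords small.ported.Cell) :
    (join (cap (twist w))).family c (glueCoords w.appendEquiv x y) ↔
      w.family c x ∧ small.family c y := by
  constructor
  · rintro ⟨d, ⟨⟨h1, s, hs⟩, Q, q, hQ, hq⟩, s', hs'⟩
    exact ⟨h1, d, ⟨⟨s, hs⟩, Q, q, hQ, hq⟩, s', hs'⟩
  · rintro ⟨h1, d, ⟨⟨s, hs⟩, Q, q, hQ, hq⟩, s', hs'⟩
    exact ⟨d, ⟨⟨h1, s, hs⟩, Q, q, hQ, hq⟩, s', hs'⟩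

noncomputable def smallEquiv : Bool ⊕ Fin 1 × Bool ≃ small.ported.Cell :=
  Equiv.ofBijective (Sum.elim (fun k => cond k (Sum.inr ()) (Sum.inl (Sum.inl ())))
    fun p => Sum.inl (Sum.inr p.2) : Bool ⊕ Fin 1 × Bool → (Unit ⊕ Bool) ⊕ Unit) (by decide)

theorem small_family (c : ℝ) (x : Coords small.ported.Cell) :
    small.family c x ↔ (Shape.oneSegment 0).family c fun t => x (smallEquiv t) := by
  constructor
  · rintro ⟨d, ⟨⟨s, hs⟩, Q, q, hQ, hq⟩, s', hs'⟩
    refine ⟨fun _ => d, fun k => cond k s' s, fun _ => Q, fun _ => q, funext ?_⟩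
    rintro ((_ | _) | ⟨i, _ | _⟩)
    exacts [hs, hs', hQ, hq]
  · rintro ⟨b, s, Q, q, h⟩
    exact ⟨b (), ⟨⟨s false, congrFun h (.inl false)⟩, Q 0, q 0, congrFun h (.inr (0, false)),
      congrFun h (.inr (0, true))⟩, s true, congrFun h (.inl true)⟩

noncomputable def mediumEquiv : Bool ⊕ Fin 2 × Bool ≃ medium.ported.Cell :=
  Equiv.ofBijective (Sum.elim (fun k => cond k (Sum.inr ()) (Sum.inl (Sum.inl (Sum.inl ()))))
    fun p => ![Sum.inl (Sum.inl (Sum.inr p.2)), Sum.inl (Sum.inr p.2)] p.1 :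
      Bool ⊕ Fin 2 × Bool → ((Unit ⊕ Bool) ⊕ Bool) ⊕ Unit) (by decide)

theorem medium_family (c : ℝ) (x : Coords medium.ported.Cell) :
    medium.family c x ↔ (Shape.oneSegment 1).family c fun t => x (mediumEquiv t) := by
  constructor
  · rintro ⟨d, ⟨⟨⟨s, hs⟩, Q, q, hQ, hq⟩, Q', q', hQ', hq'⟩, s', hs'⟩
    refine ⟨fun _ => d, fun k => cond k s' s, ![Q, Q'], ![q, q'], funext ?_⟩
    rintro ((_ | _) | ⟨i, _ | _⟩)
    · exact hs
    · exact hs'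
    · fin_cases i
      exacts [hQ, hQ']
    · fin_cases i
      exacts [hq, hq']
  · rintro ⟨b, s, Q, q, h⟩
    exact ⟨b (), ⟨⟨⟨s false, congrFun h (.inl false)⟩, Q 0, q 0, congrFun h (.inr (0, false)),
      congrFun h (.inr (0, true))⟩, Q 1, q 1, congrFun h (.inr (1, false)),
      congrFun h (.inr (1, true))⟩, s true, congrFun h (.inl true)⟩

noncomputable def smallSmallEquiv : Fin 3 ⊕ Fin 2 × Bool ≃ (join (cap small)).ported.Cell :=
  Equiv.ofBijective (Sum.elim
    ![Sum.inl (Sum.inl (Sum.inl (Sum.inl ()))), Sum.inl (Sum.inl (Sum.inr ())), Sum.inr ()]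
    fun p => ![Sum.inl (Sum.inl (Sum.inl (Sum.inr p.2))), Sum.inl (Sum.inr p.2)] p.1 :
      Fin 3 ⊕ Fin 2 × Bool → (((Unit ⊕ Bool) ⊕ Unit) ⊕ Bool) ⊕ Unit) (by decide)

theorem small_small_family (c : ℝ) (x : Coords (join (cap small)).ported.Cell) :
    (join (cap small)).family c x ↔ Shape.twoSmall.family c fun t => x (smallSmallEquiv t) := by
  constructor
  · rintro ⟨d', ⟨⟨d, ⟨⟨s, hs⟩, Q, q, hQ, hq⟩, s', hs'⟩, Q', q', hQ', hq'⟩, s'', hs''⟩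
    refine ⟨fun j => cond j d' d, ![s, s', s''], ![Q, Q'], ![q, q'], funext ?_⟩
    rintro (k | ⟨i, _ | _⟩)
    · fin_cases k
      exacts [hs, hs', hs'']
    · fin_cases i
      exacts [hQ, hQ']
    · fin_cases i
      exacts [hq, hq']
  · rintro ⟨b, s, Q, q, h⟩
    exact ⟨b true, ⟨⟨b false, ⟨⟨s 0, congrFun h (.inl 0)⟩, Q 0, q 0, congrFun h (.inr (0, false)),
      congrFun h (.inr (0, true))⟩, s 1, congrFun h (.inl 1)⟩, Q 1, q 1,
      congrFun h (.inr (1, false)), congrFun h (.inr (1, true))⟩, s 2, congrFun h (.inl 2)⟩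

set_option synthInstance.maxHeartbeats 400000 in
set_option synthInstance.maxSize 1000 in
noncomputable def mediumSmallEquiv : Fin 3 ⊕ Fin 3 × Bool ≃ (join (cap medium)).ported.Cell :=
  Equiv.ofBijective (Sum.elim
    ![Sum.inl (Sum.inl (Sum.inl (Sum.inl (Sum.inl ())))), Sum.inl (Sum.inl (Sum.inr ())),
      Sum.inr ()]
    fun p => ![Sum.inl (Sum.inl (Sum.inl (Sum.inl (Sum.inr p.2)))),
      Sum.inl (Sum.inl (Sum.inl (Sum.inr p.2))), Sum.inl (Sum.inr p.2)] p.1 :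
      Fin 3 ⊕ Fin 3 × Bool → ((((Unit ⊕ Bool) ⊕ Bool) ⊕ Unit) ⊕ Bool) ⊕ Unit) (by decide)

theorem medium_small_family (c : ℝ) (x : Coords (join (cap medium)).ported.Cell) :
    (join (cap medium)).family c x ↔ Shape.twoLarge.family c fun t => x (mediumSmallEquiv t) := by
  constructor
  · rintro ⟨d', ⟨⟨d, ⟨⟨⟨s, hs⟩, Q, q, hQ, hq⟩, Q₁, q₁, hQ₁, hq₁⟩, s', hs'⟩, Q', q', hQ', hq'⟩,
      s'', hs''⟩
    refine ⟨fun j => cond j d' d, ![s, s', s''], ![Q, Q₁, Q'], ![q, q₁, q'], funext ?_⟩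
    rintro (k | ⟨i, _ | _⟩)
    · fin_cases k
      exacts [hs, hs', hs'']
    · fin_cases i
      exacts [hQ, hQ₁, hQ']
    · fin_cases i
      exacts [hq, hq₁, hq']
  · rintro ⟨b, s, Q, q, h⟩
    exact ⟨b true, ⟨⟨b false, ⟨⟨⟨s 0, congrFun h (.inl 0)⟩, Q 0, q 0, congrFun h (.inr (0, false)),
      congrFun h (.inr (0, true))⟩, Q 1, q 1, congrFun h (.inr (1, false)),
      congrFun h (.inr (1, true))⟩, s 1, congrFun h (.inl 1)⟩, Q 2, q 2,
      congrFun h (.inr (2, false)), congrFun h (.inr (2, true))⟩, s 2, congrFun h (.inl 2)⟩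

/-- The numbers of solutions that contribute to the admissible vertex count. -/
structure HasCounts (w : Word) (a r : ℕ) : Prop where
  rigid : (rigidPoints w.family).encard = a
  rays : (extremeRays w.family).encard = r

theorem hasCounts_of_shape {J K I : Type} [Fintype K] [Fintype I] (S : Shape J K I) (w : Word)
    (e : K ⊕ I × Bool ≃ w.ported.Cell) {a r : ℕ}
    (h : ∀ c x, w.family c x ↔ S.family c fun t => x (e t))
    (ha : {t | S.Canonical t ∧ S.Pinned t}.encard = a) (hr : {t | S.Connected t}.encard = r) :
    w.HasCounts a r where
  rigid := by rw [encard_rigidPoints_congr e h, S.encard_rigidPoints_family, ha]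
  rays := by rw [encard_extremeRays_congr e h, S.encard_extremeRays_family, hr]

theorem hasCounts_small : small.HasCounts 17 1 :=
  hasCounts_of_shape _ _ smallEquiv small_family Shape.encard_oneSegment_one
    (Shape.encard_connected_oneSegment 0)

theorem hasCounts_medium : medium.HasCounts 69 1 :=
  hasCounts_of_shape _ _ mediumEquiv medium_family Shape.encard_oneSegment_two
    (Shape.encard_connected_oneSegment 1)

theorem hasCounts_small_small : (join (cap small)).HasCounts 141 3 :=
  hasCounts_of_shape _ _ smallSmallEquiv small_small_family Shape.encard_twoSmall
    Shape.encard_connected_twoSegments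

theorem hasCounts_medium_small : (join (cap medium)).HasCounts 581 3 :=
  hasCounts_of_shape _ _ mediumSmallEquiv medium_small_family Shape.encard_twoLarge
    Shape.encard_connected_twoSegments

/-- Each appended block is a copy of `small` behind a twist, contributing a factor `17` to the
points with `c = 1` and one ray with `c = 0`. -/
theorem HasCounts.extend {w : Word} {a r : ℕ} (h : w.HasCounts a r) (m : ℕ) :
    (w.extend m).HasCounts (a * 17 ^ m) (r + m) := by
  induction m with
  | zero => simpa [Word.extend] using h
  | succ m ih =>
    constructor
    · rw [Word.extend, encard_rigidPoints_glue (w.extend m).isLinear_family small.isLinear_family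
        (w.extend m).family_append, ih.rigid, hasCounts_small.rigid, pow_succ]
      push_cast
      ring
    · have := encard_extremeRays_glue (T := (w.extend (m + 1)).ported.Cell)
        (L := (w.extend (m + 1)).family) (w.extend m).isLinear_family small.isLinear_family
        (w.extend m).family_append
      refine this.trans ((congrArg₂ _ ih.rays (Eq.trans ?_ hasCounts_small.rays)).trans ?_)
      · congr!
      · push_cast
        ring

/-- Closing up a chain gives a triangulated three-sphere with a known admissible vertex count. -/
theorem HasCounts.exists_faceGluing {w : Word} {a r : ℕ} (h : w.HasCounts a r) (m : ℕ) {n : ℕ}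
    (hn : n = w.size + 4 * m) : ∃ T : FaceGluing n, T.IsClosedThreeManifoldTriangulation ∧
      ConnectedSpace T.Space ∧ T.admissibleVertexCount = ((a * 17 ^ m + (r + m) : ℕ) : ℕ∞) := by
  have hcard : Nat.card (w.extend m).ported.closeTwist.Cell = n := by
    change Nat.card ((w.extend m).ported.Cell ⊕ Fin 0) = n
    rw [Nat.card_sum, card_cell, size_extend, hn, Nat.card_eq_fintype_card, Fintype.card_fin,
      add_zero]
  let e := Finite.equivFinOfCardEq hcard
  obtain ⟨T, h1, h2, h3⟩ := exists_manifold_faceGluing _ (w.extend m).tidy_ported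
    (w.extend m).ported_equivalent e
  refine ⟨T, h1, h2, ?_⟩
  rw [admissibleVertexCount_eq _ T e h3, (h.extend m).rigid, (h.extend m).rays]
  norm_cast

end Word

end

/-! ### The four residue classes modulo 4 -/

theorem theorem3 (n : ℕ) (hpos : 0 < n) (h1 : n ≠ 1) (h2 : n ≠ 2) (h3 : n ≠ 3) (h5 : n ≠ 5) :
    ∃ T : FaceGluing n, T.IsClosedThreeManifoldTriangulation ∧ ConnectedSpace T.Space ∧
      (∀ k : ℕ, 1 ≤ k → n = 4 * k →
        T.admissibleVertexCount = ((17 ^ k + k : ℕ) : ℕ∞)) ∧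
      (∀ k : ℕ, 2 ≤ k → n = 4 * k + 1 →
        T.admissibleVertexCount = ((581 * 17 ^ (k - 2) + k + 1 : ℕ) : ℕ∞)) ∧
      (∀ k : ℕ, 1 ≤ k → n = 4 * k + 2 →
        T.admissibleVertexCount = ((69 * 17 ^ (k - 1) + k : ℕ) : ℕ∞)) ∧
      (∀ k : ℕ, 1 ≤ k → n = 4 * k + 3 →
        T.admissibleVertexCount = ((141 * 17 ^ (k - 1) + k + 2 : ℕ) : ℕ∞)) := by
  -- The numbers `4, 6, 7, 9` are the sizes of the starting chains, one in each residue class; `1,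
  -- 2, 3, 5` are exactly the positive integers not reached by adding blocks of four. As the class
  -- of `1` starts at `9`, it has `k = m + 2` rather than `m + 1`.
  obtain ⟨m, hm⟩ : ∃ m, n = 4 + 4 * m ∨ n = 6 + 4 * m ∨ n = 7 + 4 * m ∨ n = 9 + 4 * m := by
    have : n % 4 < 4 := Nat.mod_lt _ (by norm_num)
    rcases (by omega : n % 4 = 0 ∨ n % 4 = 2 ∨ n % 4 = 3 ∨ n % 4 = 1) with h | h | h | h
    · exact ⟨n / 4 - 1, by omega⟩
    · exact ⟨n / 4 - 1, by omega⟩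
    · exact ⟨n / 4 - 1, by omega⟩
    · exact ⟨n / 4 - 2, by omega⟩
  rcases hm with hm | hm | hm | hm
  · obtain ⟨T, t1, t2, t3⟩ := Word.hasCounts_small.exists_faceGluing m hm
    refine ⟨T, t1, t2, fun k _ hk' => ?_, by omega, by omega, by omega⟩
    obtain rfl : k = m + 1 := by omega
    rw [t3]; congr 1; ring
  · obtain ⟨T, t1, t2, t3⟩ := Word.hasCounts_medium.exists_faceGluing m hm
    refine ⟨T, t1, t2, by omega, by omega, fun k _ hk' => ?_, by omega⟩
    obtain rfl : k = m + 1 := by omega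
    rw [t3, Nat.add_sub_cancel]; congr 1; ring
  · obtain ⟨T, t1, t2, t3⟩ := Word.hasCounts_small_small.exists_faceGluing m hm
    refine ⟨T, t1, t2, by omega, by omega, by omega, fun k _ hk' => ?_⟩
    obtain rfl : k = m + 1 := by omega
    rw [t3, Nat.add_sub_cancel]; congr 1; ring
  · obtain ⟨T, t1, t2, t3⟩ := Word.hasCounts_medium_small.exists_faceGluing m hm
    refine ⟨T, t1, t2, by omega, fun k _ hk' => ?_, by omega, by omega⟩
    obtain rfl : k = m + 2 := by omega
    rw [t3, Nat.add_sub_cancel]; congr 1; ring
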